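/- **Setting.** Let $k$ be a number field with set of places $M_k$, and for each $v\in M_k$ fix an extension of $|\cdot|_v$ to $\bar k$; let $\bar k_v$ be the completion of $\bar k$ (so $\bar k_v\cong\mathbb C$ for $v\mid\infty$). Here $|\cdot|_v$ extends the standard absolute value of $\mathbb Q$, and $n_v=[k_v:\mathbb Q_v]/[k:\mathbb Q]$. Let $X/k$ be a smooth projective curve with function field $K=k(X)$, let $f\in K[z]$ have degree $d\ge 2$, and let $P\in K$. For $\beta\in X(\bar k)$ put $$\hat\lambda_{f,\beta}(P)=\lim_{N\to\infty}d^{-N}\max\{0,-\operatorname{ord}_\beta(f^N(P))\},\qquad D=D(f,P)=\sum_{\beta\in X(\bar k)}\hat\lambda_{f,\beta}(P)\,(\beta).$$ For $t\in X(k)$ at which $f$ has good reduction (all coefficients of $f$ are regular at $t$ and the leading one does not vanish at $t$), let $f_t\in k[z]$ and $P_t\in\mathbb P^1(k)$ be the specializations, and $$\hat h_{f_t}(P_t)=\sum_{v\in M_k}n_v\lim_{N\to\infty}d^{-N}\max\{0,\log|f_t^N(P_t)|_v\},$$ with $\hat h_{f_t}(\infty)=0$. Assume $D\neq0$. Given $N\ge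 0$ and $g\in K$ whose divisor of poles is $g^*(\infty)=d^N(d-1)D$, put $$h_D(t)=\sum_{v\in M_k}n_v\,\frac{\max\{0,\log|g(t)|_v\}}{d^N(d-1)}\quad (t\notin\operatorname{Supp}(D)),\qquad h_D(t)=0\quad (t\in \operatorname{Supp}(D)).$$ For each $\beta\in\operatorname{Supp}(D)$ let $w_\beta\in K$ be a uniformizer at $\beta$; elements of the completed local ring $\widehat{\mathcal O}_{\beta,X}\cong k(\beta)[[w_\beta]]$ are written as power series in $w_\beta$ with coefficients in the residue field $k(\beta)\subseteq\bar k$. **Theorem.** A pair $(N,g)$ as above exists, and for every such pair there are - a finite set of places $S\subseteq M_k$ containing all infinite places; - for all $\beta\in\operatorname{Supp}(D)$ and $v\in S$ an open neighbourhood $U_{\beta,v}\subseteq X(\bar k_v)$ of $\beta$; - for all $\beta\in\operatorname{Supp}(D)$ and $v\mid\infty$ a real-analytic function $F_{\beta,v}:U_{\beta,v}\to\mathbb R$ with $F_{\beta,v}(\beta)=0$; such that for every $\phi:S\to\operatorname{Supp}(D)$ there is a constant $C(\phi)\in\mathbb R$ with the following property. Let $t\in X(k)$ satisfy $t\in U_{\phi(v),v}$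 for all $v\in S$. If $t\notin\operatorname{Supp}(D)$, then $f$ has good reduction at $t$ and $P$ is regular at $t$. Whenever $f$ has good reduction at $t$, $$\hat h_{f_t}(P_t)=h_D(t)+C(\phi)+\sum_{v\mid\infty}F_{\phi(v),v}(t).$$ In particular $\hat h_{f_t}(P_t)=h_D(t)+C(\phi)+o(1)$, where $o(1)\to0$ as $t\to\phi(v)$ in the $v$-adic topology simultaneously for all $v\in S$ (over $t\in X(k)$ of good reduction). Moreover, for each $\beta\in\operatorname{Supp}(D)$ there is a germ $\tilde F_\beta\in\widehat{\mathcal O}_{\beta,X}$, independent of $v$, which is $v$-adically analytic at $\beta$ for every $v\in M_k$ (its power series converges on a disc of positive radius in $\bar k_v$), such that for all $v\mid\infty$ and $t\in U_{\beta,v}$ the series $\tilde F_\beta(t)$ converges to a non-zero value and $$F_{\beta,v}(t)=\frac{[k_v:\mathbb Q_v]}{[k:\mathbb Q]}\log|\tilde F_\beta(t)|_v .$$ -/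

import Mathlib

open Filter Topology Polynomial NumberField

namespace PolyFamily

noncomputable section

/-! ### The curve attached to a function field, and its points

`K` is the function field of a smooth projective curve `X` over `k`. The local rings of `X` at its
points (the generic point included) are exactly the valuation subrings of `K` which contain `k`, so
an `L`-valued point `Spec L ⟶ X` is such a local ring together with a local homomorphism
to `L` over `k`. -/

/-- The set `X(L)` of points of the smooth projective curve over `k` with function field `K`, with
values in a field `L` that is a `k`-algebra through `ι`. -/
structure CurvePoint {k : Type*} (K : Type*) {L : Type*} [Field k] [Field K] [Algebra k K]
    [Field L] (ι : k →+* L) where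
  /-- The local ring of `X` at the image of the point. -/
  localRing : ValuationSubring K
  /-- Evaluation at the point of the functions that are regular there. -/
  residue : localRing →+* L
  isLocalHom_residue : IsLocalHom residue
  algebraMap_mem : ∀ c : k, algebraMap k K c ∈ localRing
  residue_algebraMap : ∀ c : k, residue ⟨algebraMap k K c, algebraMap_mem c⟩ = ι c

namespace CurvePoint

variable {k K L L' : Type*} [Field k] [Field K] [Algebra k K] [Field L] [Field L'] {ι : k →+* L}

open Classical in
/-- The value `x(t)` of a rational function `x` regular at `t` (and `0` if `x` has a pole there). -/
def value (t : CurvePoint K ι) (x : K) : L :=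
  if h : x ∈ t.localRing then t.residue ⟨x, h⟩ else 0

/-- The map `X(L) → X(L')` induced by a homomorphism `L → L'` of extensions of `k`. -/
def map (t : CurvePoint K ι) (j : L →+* L') (ι' : k →+* L') (h : ∀ c, j (ι c) = ι' c) :
    CurvePoint K ι' where
  localRing := t.localRing
  residue := j.comp t.residue
  isLocalHom_residue :=
    have := t.isLocalHom_residue
    RingHom.isLocalHom_comp j t.residue
  algebraMap_mem := t.algebraMap_mem
  residue_algebraMap c := by
    rw [RingHom.comp_apply, t.residue_algebraMap, h]

/-- The topology on `X(L)` for a topological field `L`: the coarsest one for which all rational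
functions `X(L) → ℙ¹(L)` are continuous. Neighbourhoods of poles of `x` are covered by `x⁻¹`. -/
instance [TopologicalSpace L] : TopologicalSpace (CurvePoint K ι) :=
  TopologicalSpace.generateFrom
    {s | ∃ (x : K) (V : Set L), IsOpen V ∧ s = {t | x ∈ t.localRing ∧ t.value x ∈ V}}

/-- `w` is a uniformizer at (the image in `X` of) `t`. -/
def IsUniformizer (t : CurvePoint K ι) (w : K) : Prop :=
  ∃ h : w ∈ t.localRing, IsLocalRing.maximalIdeal t.localRing = Ideal.span {⟨w, h⟩}

/-- The order of the pole of `x` at `t`, i.e. `max {0, -ord_t x}`: the least `n` such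
that `𝔪ⁿ x` consists of functions regular at `t`. -/
def poleOrder (t : CurvePoint K ι) (x : K) : ℕ :=
  sInf {n | ∀ a ∈ IsLocalRing.maximalIdeal t.localRing ^ n, (a : K) * x ∈ t.localRing}

/-- The family `f` of polynomials has good reduction at `t`: all coefficients are
regular at `t` and the leading coefficient does not vanish there. -/
def GoodReduction (f : K[X]) (t : CurvePoint K ι) : Prop :=
  (∀ i, f.coeff i ∈ t.localRing) ∧ t.value f.leadingCoeff ≠ 0

/-- The specialization `f_t`. -/
def specialize (f : K[X]) (t : CurvePoint K ι) : L[X] :=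
  ∑ i ∈ f.support, monomial i (t.value (f.coeff i))

end CurvePoint

/-- `fᴺ(z)`, the `N`-th iterate of the polynomial `f` at `z`. -/
def iter {R : Type*} [CommRing R] (f : R[X]) (N : ℕ) (z : R) : R := (fun y => f.eval y)^[N] z

/-! ### Geometric and rational points, and the divisor `D(f, P)` -/

/-- `X(k̄)`. -/
abbrev GeomPoint (k K : Type*) [Field k] [Field K] [Algebra k K] : Type _ :=
  CurvePoint K (algebraMap k (AlgebraicClosure k))

/-- `X(k)`. -/
abbrev RatPoint (k K : Type*) [Field k] [Field K] [Algebra k K] : Type _ :=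
  CurvePoint K (RingHom.id k)

section Divisor

variable {k K : Type*} [Field k] [Field K] [Algebra k K]

/-- The inclusion `X(k) → X(k̄)`. -/
def RatPoint.toGeom (t : RatPoint k K) : GeomPoint k K :=
  t.map (algebraMap k (AlgebraicClosure k)) _ (fun _ => rfl)

/-- The multiplicity of `β` in `D(f, P)`: the local canonical height
`lim_N d⁻ᴺ max {0, -ord_β (fᴺ(P))}`, where `d = deg f`. -/
def divisorCoeff (f : K[X]) (P : K) (β : GeomPoint k K) : ℝ :=
  limUnder atTop fun N : ℕ => (β.poleOrder (iter f N P) : ℝ) / (f.natDegree : ℝ) ^ N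

/-- The support of the divisor `D(f, P) = ∑_β divisorCoeff f P β · (β)` on `X(k̄)`. -/
def divisorSupport (k : Type*) {K : Type*} [Field k] [Field K] [Algebra k K]
    (f : K[X]) (P : K) : Set (GeomPoint k K) :=
  {β | divisorCoeff f P β ≠ 0}

/-- The pair `(N, g)` defines the local heights relative to `D = D(f, P)`: the divisor of poles of
`g : X → ℙ¹` is `g^*(∞) = dᴺ (d - 1) D`. -/
def IsHeightDatum (k : Type*) {K : Type*} [Field k] [Field K] [Algebra k K]
    (f : K[X]) (P : K) (N : ℕ) (g : K) : Prop :=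
  ∀ β : GeomPoint k K, (β.poleOrder g : ℝ) =
    (f.natDegree : ℝ) ^ N * ((f.natDegree : ℝ) - 1) * divisorCoeff f P β

end Divisor

/-! ### Places of the number field `k` and heights -/

/-- The set `M_k` of places of the number field `k`. -/
abbrev Place (k : Type*) [Field k] [NumberField k] : Type _ := InfinitePlace k ⊕ FinitePlace k

section Places

variable {k : Type*} [Field k] [NumberField k]

/-- The absolute value of a place. At finite places it is the normalized one, i.e. the
`[k_v : ℚ_v]`-th power of the absolute value which extends the standard one of `ℚ`. -/
def Place.abv : Place k → AbsoluteValue k ℝ :=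
  Sum.elim (fun v => v.1) (fun v => v.1)

/-- The weight of a place in sums of logarithms of `Place.abv`: `[k_v : ℚ_v] / [k : ℚ]` at infinite
places; at finite places the factor `[k_v : ℚ_v]` is already part of `Place.abv`. -/
def Place.weight : Place k → ℝ :=
  Sum.elim (fun v => (v.mult : ℝ) / Module.finrank ℚ k) (fun _ => 1 / (Module.finrank ℚ k : ℝ))

/-- The local canonical height `lim_N d⁻ᴺ max {0, log |fᴺ(z)|_v}`, where `d = deg f`. -/
def localCanonicalHeight (v : Place k) (f : k[X]) (z : k) : ℝ :=
  limUnder atTop fun N : ℕ => Real.posLog (v.abv (iter f N z)) / (f.natDegree : ℝ) ^ N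

/-- The global canonical height attached to `f` on `k`. -/
def canonicalHeight (f : k[X]) (z : k) : ℝ :=
  ∑ᶠ v : Place k, v.weight * localCanonicalHeight v f z

variable {K : Type*} [Field K] [Algebra k K]

open Classical in
/-- `ĥ_{f_t}(P_t)` for a point `t ∈ X(k)` of good reduction. If `P` has a pole at `t`, then `P_t` is
the fixed point `∞` of `f_t`, which has canonical height `0`. -/
def fiberHeight (f : K[X]) (P : K) (t : RatPoint k K) : ℝ :=
  if P ∈ t.localRing then canonicalHeight (t.specialize f) (t.value P) else 0

open Classical in
/-- The height `h_D(t)` on `X(k)` relative to `D = D(f, P)`, defined through `(N, g)`. -/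
def divisorHeight (f : K[X]) (P : K) (N : ℕ) (g : K) (t : RatPoint k K) : ℝ :=
  if t.toGeom ∈ divisorSupport k f P then 0
  else ∑ᶠ v : Place k, v.weight *
    (Real.posLog (v.abv (t.value g)) / ((f.natDegree : ℝ) ^ N * ((f.natDegree : ℝ) - 1)))

end Places

/-! ### Points over the completions, and analytic functions -/

/-- A choice, for each place `v` of `k`, of an extension of `|·|_v` to `k̄`. -/
structure PlaceExtension (k : Type*) [Field k] [NumberField k] where
  inf : InfinitePlace k → InfinitePlace (AlgebraicClosure k)
  inf_comap : ∀ v, (inf v).comap (algebraMap k (AlgebraicClosure k)) = v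
  fin : FinitePlace k → AbsoluteValue (AlgebraicClosure k) ℝ
  fin_apply : ∀ v x, fin v (algebraMap k (AlgebraicClosure k) x) = v x

namespace PlaceExtension

variable {k : Type*} [Field k] [NumberField k] (e : PlaceExtension k)

/-- The chosen absolute value on `k̄`. -/
def abv : Place k → AbsoluteValue (AlgebraicClosure k) ℝ :=
  Sum.elim (fun v => (e.inf v).1) e.fin

/-- `k̄_v`, the completion of `k̄` at the chosen extension of `v`. -/
abbrev Cv (v : Place k) : Type _ := (e.abv v).Completion

/-- The embedding of `k̄` into `k̄_v`. -/
def emb (v : Place k) : AlgebraicClosure k →+* e.Cv v :=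
  (UniformSpace.Completion.coeRingHom).comp (WithAbs.equiv (e.abv v)).symm.toRingHom

/-- The identification of `k̄_v` with `ℂ` for an infinite place `v`. -/
def toComplex (v : InfinitePlace k) : e.Cv (.inl v) →+* ℂ :=
  (InfinitePlace.Completion.extensionEmbedding (e.inf v)).comp
    (InfinitePlace.Completion.equiv (e.inf v)).symm.toRingHom

variable (K : Type*) [Field K] [Algebra k K]

/-- `X(k̄_v)`. -/
abbrev Pts (v : Place k) : Type _ :=
  CurvePoint K ((e.emb v).comp (algebraMap k (AlgebraicClosure k)))

variable {K}

/-- The inclusion `X(k̄) → X(k̄_v)`. -/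
def ofGeom (v : Place k) (β : GeomPoint k K) : e.Pts K v :=
  β.map (e.emb v) _ (fun _ => rfl)

/-- The inclusion `X(k) → X(k̄_v)`. -/
def ofRat (v : Place k) (t : RatPoint k K) : e.Pts K v :=
  e.ofGeom v t.toGeom

/-- The real-valued function `F` on `X(k̄_v) = X(ℂ)` is real-analytic at the point `p`: near `p` it
is a real-analytic function of some `w ∈ K` regular at `p`. (One can always take for `w` a local
coordinate of the Riemann surface `X(ℂ)` at `p`, and conversely every regular `w` is holomorphic.) -/
def RealAnalyticAt {v : InfinitePlace k} (F : e.Pts K (.inl v) → ℝ) (p : e.Pts K (.inl v)) :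
    Prop :=
  ∃ w ∈ p.localRing, ∃ h : ℂ → ℝ, AnalyticAt ℝ h (e.toComplex v (p.value w)) ∧
    ∀ᶠ t in 𝓝 p, F t = h (e.toComplex v (t.value w))

/-- The power series `G` over `k̄` is `v`-adically analytic: it converges absolutely on some disc
of positive radius in `k̄_v`. -/
def IsAnalytic (v : Place k) (G : PowerSeries (AlgebraicClosure k)) : Prop :=
  ∃ ε > 0, ∀ x : e.Cv v, ‖x‖ < ε →
    Summable fun n : ℕ => ‖e.emb v (PowerSeries.coeff n G) * x ^ n‖

end PlaceExtension

/-- The power series `G` over `k̄` represents, in terms of a uniformizer at `β`, a germ in the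
completed local ring of `X/k` at `β`, that is, its coefficients lie in the residue field of `β`. -/
def IsGermAt {k K : Type*} [Field k] [Field K] [Algebra k K] (β : GeomPoint k K)
    (G : PowerSeries (AlgebraicClosure k)) : Prop :=
  ∀ n, PowerSeries.coeff n G ∈ β.residue.range

end

end PolyFamily

open PolyFamily

/-! Write d for the degree and l for the leading coefficient of f. Near infinity use the coordinate
y = c/z with c = g^e. In it f becomes y ↦ A y^d / (1 + ε(y)), where ε(y) is the sum of b_j y^(d-j)
over j < d (`EscapeData`); for e large, A and the b_j vanish on Supp D. Let Y_0 = Y = c / f^N(P),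
and let Y_n be its orbit. Then -log|Y_(n+1)| = d (-log|Y_n|) - log|A| + log|1 + ε(Y_n)|, and summing
this recurrence (`EscapeData.tendsto`) gives the escape rate of f^N(P) as -log|Y| - log|A|/(d-1) + ∑
d^(-n-1) log|1 + ε(Y_n)|.

The formula is used twice. On K, with the absolute value of a closed point, the error series
vanishes and the multiplicity in D becomes the pole order of l f^N(P)^(d-1) divided by d^N (d-1).
Approximating that function by one that is regular off Supp D produces a height datum
(`exists_isHeightDatum`). For any datum (M, g), moreover, u = g^(d^(N-M)) A Y^(d-1) is a unit along
Supp D (`IsHeightDatum.exists_escapeFunctions`). On k, with a place v and after specialization at t,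
the local height of P_t is log|g(t)|/(d^M (d-1)) - log|u(t)|/(d^N (d-1)) + d^(-N) ∑ d^(-n-1) log|1 +
ε(Y_n(t))| (`EscapeFunctions.tendsto`). The first term belongs to h_D; the rest is the deviation.

There are three kinds of places. At a finite v in S, with t near β, the series vanishes and |u(t)| =
|u(β)|, so the deviation is constant. At an infinite v, with t near β, the deviation is the constant
from u(β) plus the real part of a power series in w. That series is formed algebraically over the
residue field of β, and its exponential is the germ, which therefore does not depend on v. At almost
all finite v there must be no deviation at all, for every relevant t, near Supp D or not. If |g(t)|
> 1, then u, 1/u, A, b_j and Y are v-integral at t and the same formula applies with |u(t)| = 1. If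
|g(t)| ≤ 1, the orbit has to be bounded, and the exceptional v must not depend on the number of
iterations. This is `eventually_forall_mul_iter_mem`: over k, points off Supp D have bounded orbits,
so Q(g)^2 f^n(P) is integral over k[g] for all n; above v, some Q(g)^m f^n(P) with m depending on n
is integral; a Gauss lemma (`mem_of_forall_monic_mul_mem`) combines both.

Summing over v (`fiberHeight_eq_of_local`), C(φ) is minus the weighted sum over S of
log|u(φ(v))|/(d^N (d-1)). If t itself lies in Supp D, then φ(v) = t for all v in S, and the product
formula makes this constant zero, in agreement with the convention for both heights.

Convergence of the germ at every place rests on two facts. Functions regular at β are quotients of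
polynomials in w and a simple root θ, so Hensel's lemma and a majorant argument give expansions
convergent at all places (`exists_isExpansion`). And the denominators of the logarithm and
exponential series grow at most geometrically at every place. -/

namespace PolyFamily

/-! ### Places of a function field of one variable -/

section FunctionField

open scoped IntermediateField.algebraAdjoinAdjoin

variable {k K : Type*} [Field k] [Field K] [Algebra k K]

/-- `K` is an algebraic function field of one variable over `k`. -/
structure IsCurveField (k K : Type*) [Field k] [Field K] [Algebra k K] : Prop where
  fg : (⊤ : IntermediateField k K).FG
  trdeg_eq_one : Algebra.trdeg k K = 1

theorem isAlgebraic_of_trdeg_eq_one (htr : Algebra.trdeg k K = 1) {x : K}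
    (hx : Transcendental k x) :
    Algebra.IsAlgebraic (Algebra.adjoin k {x}) K := by
  have hind : AlgebraicIndependent k (fun _ : Unit => x) :=
    (algebraicIndependent_unique_type_iff (ι := Unit)).2 hx
  have := hind.isTranscendenceBasis_of_lift_trdeg_le (by rw [htr]; exact Cardinal.one_lt_aleph0)
    (by rw [htr]; simp)
  have h2 := hind.isTranscendenceBasis_iff_isAlgebraic.1 this
  rwa [Set.range_const] at h2

theorem isPrincipalIdealRing_adjoin (x : K) :
    IsPrincipalIdealRing (Algebra.adjoin k {x}) := by
  have hsurj : Function.Surjective ((aeval x : k[X] →ₐ[k] K).codRestrict (Algebra.adjoin k {x})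
      (fun p => aeval_mem_adjoin_singleton k x)) := by
    rintro ⟨y, hy⟩
    rw [Algebra.adjoin_singleton_eq_range_aeval] at hy
    obtain ⟨p, rfl⟩ := hy
    exact ⟨p, rfl⟩
  exact IsPrincipalIdealRing.of_surjective
    ((aeval x : k[X] →ₐ[k] K).codRestrict (Algebra.adjoin k {x}) _).toRingHom hsurj

open IntermediateField in
theorem finiteDimensional_of_trdeg_eq_one (hfg : (⊤ : IntermediateField k K).FG)
    (htr : Algebra.trdeg k K = 1) {x : K} (hx : Transcendental k x) :
    FiniteDimensional k⟮x⟯ K := by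
  have halg := isAlgebraic_of_trdeg_eq_one htr hx
  have : Algebra.IsAlgebraic k⟮x⟯ K := by
    constructor
    intro y
    exact (halg.isAlgebraic y).extendScalars
      (R := Algebra.adjoin k {x}) (S := k⟮x⟯) (FaithfulSMul.algebraMap_injective _ _)
  obtain ⟨S, hS⟩ := hfg
  have h1 : IntermediateField.adjoin k⟮x⟯ (S : Set K) = ⊤ := by
    rw [eq_top_iff]
    intro y _
    have : y ∈ IntermediateField.adjoin k (S : Set K) := by rw [hS]; trivial
    have hle : IntermediateField.adjoin k (S : Set K) ≤
        (IntermediateField.adjoin k⟮x⟯ (S : Set K)).restrictScalars k := by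
      rw [IntermediateField.adjoin_le_iff]
      exact IntermediateField.subset_adjoin _ _
    exact hle this
  have h2 : FiniteDimensional k⟮x⟯ (IntermediateField.adjoin k⟮x⟯ (S : Set K)) :=
    IntermediateField.finiteDimensional_adjoin fun y _ => Algebra.IsIntegral.isIntegral y
  rw [h1] at h2
  exact Module.Finite.equiv (IntermediateField.topEquiv (F := k⟮x⟯) (E := K)).toLinearEquiv

variable [CharZero k]

open IntermediateField in
-- In characteristic zero `K` is a finite separable extension of `k(x)`, and `k[x]` is a principal
-- ideal domain, so the classical finiteness of integral closures applies. The places at which `x`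
-- is regular then become maximal ideals of this ring.
theorem integralClosure_adjoin_isDedekindDomain (hK : IsCurveField k K)
    {x : K} (hx : Transcendental k x) :
    IsDedekindDomain (integralClosure (Algebra.adjoin k {x}) K) ∧
      Module.Finite (Algebra.adjoin k {x}) (integralClosure (Algebra.adjoin k {x}) K) ∧
      IsFractionRing (integralClosure (Algebra.adjoin k {x}) K) K := by
  have := finiteDimensional_of_trdeg_eq_one hK.fg hK.trdeg_eq_one hx
  have := isPrincipalIdealRing_adjoin (k := k) x
  have : CharZero k⟮x⟯ := charZero_of_injective_algebraMap (algebraMap k k⟮x⟯).injective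
  have : IsIntegrallyClosed (Algebra.adjoin k {x}) := inferInstance
  exact ⟨integralClosure.isDedekindDomain (Algebra.adjoin k {x}) k⟮x⟯ K,
    IsIntegralClosure.finite (Algebra.adjoin k {x}) k⟮x⟯ K _,
    integralClosure.isFractionRing_of_finite_extension k⟮x⟯ K⟩

end FunctionField

end PolyFamily

namespace PolyFamily

/-! ### Valuation rings above a Dedekind domain. -/

section Dedekind

variable {A K : Type*} [CommRing A] [IsDedekindDomain A] [Field K] [Algebra A K]
  [IsFractionRing A K]

open IsDedekindDomain in
-- The maximal ideal of `V` contracts to a nonzero prime, since otherwise all fractions would lie in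
-- `V`. The localization at this prime is a discrete valuation ring inside `V`, and it has no proper
-- overring other than the field.
theorem exists_heightOneSpectrum_of_algebraMap_mem {V : ValuationSubring K} (hV : V ≠ ⊤)
    (h : ∀ a : A, algebraMap A K a ∈ V) :
    ∃ v : HeightOneSpectrum A, (∀ a, a ∈ v.asIdeal ↔ algebraMap A K a ∈ V.nonunits) ∧
      (v.valuation K).valuationSubring = V := by
  let i : A →+* V := (algebraMap A K).codRestrict V.toSubring h
  have hi : ∀ a, a ∈ (IsLocalRing.maximalIdeal V).comap i ↔ algebraMap A K a ∈ V.nonunits := by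
    intro a
    rw [Ideal.mem_comap, ← ValuationSubring.coe_mem_nonunits_iff]
    rfl
  have hne : (IsLocalRing.maximalIdeal V).comap i ≠ ⊥ := by
    intro hbot
    apply hV
    rw [eq_top_iff]
    intro x _
    obtain ⟨a, s, hs, rfl⟩ := IsFractionRing.div_surjective (A := A) x
    rw [div_eq_mul_inv]
    refine V.mul_mem _ _ (h a) ?_
    have hs0 : s ≠ 0 := nonZeroDivisors.ne_zero hs
    have : s ∉ (IsLocalRing.maximalIdeal V).comap i := by rw [hbot]; exact hs0
    rw [hi, ValuationSubring.mem_nonunits_iff_or, not_or, not_not] at this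
    exact this.2
  let v : HeightOneSpectrum A := ⟨(IsLocalRing.maximalIdeal V).comap i,
    Ideal.comap_isPrime _ _, hne⟩
  refine ⟨v, hi, ?_⟩
  have hle : (v.valuation K).valuationSubring ≤ V := by
    intro x hx
    obtain ⟨n, d, hnd⟩ := v.exists_primeCompl_mul_eq_of_integer x
      ((Valuation.mem_valuationSubring_iff _ _).1 hx)
    have hd : (d : A) ∉ v.asIdeal := d.2
    rw [show (d : A) ∉ v.asIdeal ↔ _ from (hi d).not, ValuationSubring.mem_nonunits_iff_or,
      not_or, not_not] at hd
    have : x = algebraMap A K n * (algebraMap A K d)⁻¹ := by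
      rw [← hnd]; field_simp [hd.1]
    rw [this]
    exact V.mul_mem _ _ (h n) hd.2
  refine le_antisymm hle ?_
  rw [← HeightOneSpectrum.valuationSubringAtPrime_eq_valuationSubring] at hle ⊢
  exact (ValuationSubring.eq_of_le_of_ne_top _ hle hV).ge

end Dedekind

/-! ### Closed points as discrete valuation rings. -/

section Place

variable {K : Type*} [Field K]

/-- `V` is the valuation ring of a closed point of the curve over `k` with function field `K`. -/
def IsPlace (k : Type*) [Field k] [Algebra k K] (V : ValuationSubring K) : Prop :=
  (∀ c : k, algebraMap k K c ∈ V) ∧ V ≠ ⊤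

/-- `a` is the absolute value of the discrete valuation ring `V`, normalized so that uniformizers
have absolute value `1 / e`. -/
structure IsPlaceAbv (V : ValuationSubring K) (a : AbsoluteValue K ℝ) : Prop where
  nonarch : IsNonarchimedean a
  le_one_iff : ∀ x, a x ≤ 1 ↔ x ∈ V
  exists_uniformizer : ∃ x, a x = Real.exp (-1)
  exists_int : ∀ x, x ≠ 0 → ∃ n : ℤ, a x = Real.exp n

variable {k : Type*} [Field k] [Algebra k K]

theorem IsPlace.mem_of_isIntegral {V : ValuationSubring K} (hV : IsPlace k V) {x : K}
    (hx : IsIntegral k x) : x ∈ V := by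
  have h1 : IsIntegral V x := by
    obtain ⟨p, hp, hpx⟩ := hx
    let i : k →+* V := (algebraMap k K).codRestrict V.toSubring hV.1
    refine ⟨p.map i, hp.map i, ?_⟩
    rw [eval₂_map]
    exact hpx
  obtain ⟨y, rfl⟩ := IsIntegrallyClosed.isIntegral_iff.1 h1
  exact y.2

theorem IsPlace.transcendental_of_notMem {V : ValuationSubring K} (hV : IsPlace k V) {x : K}
    (hx : x ∉ V) : Transcendental k x := fun h => hx (hV.mem_of_isIntegral h.isIntegral)

theorem IsPlace.exists_notMem {V : ValuationSubring K} (hV : IsPlace k V) : ∃ x, x ∉ V := by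
  by_contra! h
  exact hV.2 (eq_top_iff.2 fun x _ => h x)

theorem IsPlace.mem_of_isIntegral_adjoin {V : ValuationSubring K} (hV : IsPlace k V) {x y : K}
    (hx : x ∈ V) (hy : IsIntegral (Algebra.adjoin k {x}) y) : y ∈ V := by
  have hle : ∀ z ∈ Algebra.adjoin k {x}, z ∈ V := by
    intro z hz
    induction hz using Algebra.adjoin_induction with
    | mem z hz => rwa [Set.mem_singleton_iff.1 hz]
    | algebraMap c => exact hV.1 c
    | add a b _ _ ha hb => exact V.add_mem _ _ ha hb
    | mul a b _ _ ha hb => exact V.mul_mem _ _ ha hb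
  have h1 : IsIntegral V y := by
    obtain ⟨p, hp, hpx⟩ := hy
    let i : Algebra.adjoin k {x} →+* V := (algebraMap _ K).codRestrict V.toSubring
      fun z => hle z z.2
    refine ⟨p.map i, hp.map i, ?_⟩
    rw [eval₂_map]
    exact hpx
  obtain ⟨y, rfl⟩ := IsIntegrallyClosed.isIntegral_iff.1 h1
  exact y.2

theorem inv_mem_of_notMem (V : ValuationSubring K) {x : K} (hx : x ∉ V) : x⁻¹ ∈ V :=
  (V.mem_or_inv_mem x).resolve_left hx

theorem inv_mem_nonunits_of_notMem (V : ValuationSubring K) {x : K} (hx : x ∉ V) :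
    x⁻¹ ∈ V.nonunits := (V.inv_mem_nonunits_iff).2 (Or.inr hx)

theorem Transcendental.inv' {x : K} (hx : Transcendental k x) : Transcendental k x⁻¹ := by
  intro h
  apply hx
  simpa using h.inv

open IsDedekindDomain in
theorem IsPlace.exists_heightOneSpectrum {V : ValuationSubring K} (hV : IsPlace k V) {x : K}
    (hxV : x ∈ V)
    [IsDedekindDomain (integralClosure (Algebra.adjoin k {x}) K)]
    [IsFractionRing (integralClosure (Algebra.adjoin k {x}) K) K] :
    ∃ v : HeightOneSpectrum (integralClosure (Algebra.adjoin k {x}) K),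
      (∀ a, a ∈ v.asIdeal ↔ (a : K) ∈ V.nonunits) ∧
      (v.valuation K).valuationSubring = V :=
  exists_heightOneSpectrum_of_algebraMap_mem hV.2
    fun a => hV.mem_of_isIntegral_adjoin hxV a.2

open IsDedekindDomain in
/-- A rational function on a curve has finitely many poles. -/
theorem finite_setOf_notMem [CharZero k] (hK : IsCurveField k K) (x : K) : {V : ValuationSubring K | IsPlace k V ∧ x ∉ V}.Finite := by
  by_cases hx : Transcendental k x
  swap
  · convert Set.finite_empty
    ext V
    simp only [Set.mem_ofPred_eq, Set.mem_empty_iff_false, iff_false, not_and]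
    intro hV h
    exact hx (hV.transcendental_of_notMem h)
  obtain ⟨h1, h2, h3⟩ := integralClosure_adjoin_isDedekindDomain hK (Transcendental.inv' hx)
  let A := integralClosure (Algebra.adjoin k {x⁻¹}) K
  have hxA : x⁻¹ ∈ A := isIntegral_algebraMap (R := Algebra.adjoin k {x⁻¹})
    (x := ⟨x⁻¹, Algebra.subset_adjoin rfl⟩)
  have hx0 : (⟨x⁻¹, hxA⟩ : A) ≠ 0 := by
    intro h
    have := congrArg Subtype.val h
    exact (Transcendental.inv' hx) (by simpa [show x⁻¹ = 0 from this] using isAlgebraic_zero)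
  -- Poles of `x` are zeros of `x⁻¹`, that is, primes dividing `x⁻¹` in the integral closure of
  -- `k[x⁻¹]`.
  have hfin := Ideal.finite_factors (I := Ideal.span {(⟨x⁻¹, hxA⟩ : A)})
    (by simpa using hx0)
  refine (hfin.image fun v => (v.valuation K).valuationSubring).subset ?_
  rintro V ⟨hV, hxV⟩
  obtain ⟨v, hv1, hv2⟩ := hV.exists_heightOneSpectrum
    (inv_mem_of_notMem V hxV)
  refine ⟨v, ?_, hv2⟩
  rw [Set.mem_ofPred_eq, Ideal.dvd_span_singleton, hv1]
  exact inv_mem_nonunits_of_notMem V hxV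

open IsDedekindDomain in
theorem IsPlace.exists_isPlaceAbv [CharZero k] (hK : IsCurveField k K) {V : ValuationSubring K} (hV : IsPlace k V) :
    ∃ a : AbsoluteValue K ℝ, IsPlaceAbv V a := by
  obtain ⟨x, hx⟩ := hV.exists_notMem
  have hxt := Transcendental.inv' (hV.transcendental_of_notMem hx)
  obtain ⟨h1, h2, h3⟩ := integralClosure_adjoin_isDedekindDomain hK hxt
  obtain ⟨v, hv1, hv2⟩ := hV.exists_heightOneSpectrum (inv_mem_of_notMem V hx)
  -- Base `e` makes the natural logarithm of the absolute value equal to minus the order of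
  -- vanishing.
  obtain ⟨b, hbe⟩ : ∃ b : NNReal, (b : ℝ) = Real.exp 1 :=
    ⟨Real.toNNReal (Real.exp 1), Real.coe_toNNReal _ (Real.exp_pos 1).le⟩
  have hb : 1 < b := by
    rw [← NNReal.coe_lt_coe, hbe]; simp
  have hexp : ∀ x (n : ℤ), v.valuation K x = WithZero.exp n →
      HeightOneSpectrum.adicAbv v hb x = Real.exp n := by
    intro x n hn
    change ((WithZeroMulInt.toNNReal (ne_zero_of_lt hb) (v.valuation K x) : NNReal) : ℝ) = _
    rw [hn, WithZeroMulInt.toNNReal_neg_apply _ WithZero.exp_ne_zero]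
    rw [NNReal.coe_zpow, hbe, ← Real.exp_one_rpow n, ← Real.rpow_intCast]
    rfl
  refine ⟨HeightOneSpectrum.adicAbv v hb, HeightOneSpectrum.isNonarchimedean_adicAbv v hb,
    fun x => ?_, ?_, fun x hx0 => ?_⟩
  · rw [← hv2, Valuation.mem_valuationSubring_iff]
    change ((WithZeroMulInt.toNNReal (ne_zero_of_lt hb) (v.valuation K x) : NNReal) : ℝ) ≤ 1 ↔ _
    rw [← WithZeroMulInt.toNNReal_le_one_iff hb]
    norm_cast
  · obtain ⟨π, hπ⟩ := v.valuation_exists_uniformizer K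
    exact ⟨π, by rw [hexp _ _ hπ]; simp⟩
  · refine ⟨WithZero.log (v.valuation K x), hexp _ _ ?_⟩
    rw [WithZero.exp_log]
    exact (Valuation.ne_zero_iff _).2 hx0

end Place

end PolyFamily

namespace PolyFamily

/-! ### Maximality of the local rings; integrality tested on valuation rings. -/

section PlaceAbv

variable {k K : Type*} [Field k] [Field K] [Algebra k K]

namespace IsPlaceAbv

variable {V : ValuationSubring K} {a : AbsoluteValue K ℝ} (ha : IsPlaceAbv V a)

theorem lt_one_iff {V : ValuationSubring K} {a : AbsoluteValue K ℝ} (ha : IsPlaceAbv V a) (x : K) :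
    a x < 1 ↔ x ∈ V.nonunits := by
  rw [ValuationSubring.mem_nonunits_iff_or, ← ha.le_one_iff, map_inv₀]
  by_cases hx : x = 0
  · simp [hx]
  · simp only [hx, false_or]
    rw [inv_le_one_iff₀]
    simp [hx]

theorem le_exp_neg_one {V : ValuationSubring K} {a : AbsoluteValue K ℝ} (ha : IsPlaceAbv V a)
    {x : K} (hx : a x < 1) : a x ≤ Real.exp (-1) := by
  by_cases h0 : x = 0
  · simp [h0, (Real.exp_pos _).le]
  · obtain ⟨n, hn⟩ := ha.exists_int x h0
    rw [hn, Real.exp_lt_one_iff] at hx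
    rw [hn, Real.exp_le_exp]
    have : n < 0 := by exact_mod_cast hx
    have : n ≤ -1 := by omega
    exact_mod_cast this

/-- The value group is archimedean: powers of an element outside `V` exceed every given absolute
value, so `V` together with one such element generates all of `K`. -/
theorem eq_of_le {V : ValuationSubring K} {a : AbsoluteValue K ℝ} (ha : IsPlaceAbv V a)
    {W : ValuationSubring K} (hle : V ≤ W) (hW : W ≠ ⊤) : V = W := by
  refine le_antisymm hle fun x hx => ?_
  by_contra hxV
  apply hW
  rw [eq_top_iff]
  intro z _
  rw [← ha.le_one_iff, not_le] at hxV
  have hx0 : x ≠ 0 := by rintro rfl; simp at hxV; linarith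
  obtain ⟨n, hn⟩ := pow_unbounded_of_one_lt (a z) hxV
  have h1 : z * (x ^ n)⁻¹ ∈ V := by
    rw [← ha.le_one_iff, map_mul, map_inv₀, map_pow]
    exact mul_inv_le_one_of_le₀ hn.le (by positivity)
  have h2 : z = z * (x ^ n)⁻¹ * x ^ n := by field_simp
  rw [h2]
  exact W.mul_mem _ _ (hle h1) (pow_mem hx n)

theorem algebraMap_eq_one {V : ValuationSubring K} {a : AbsoluteValue K ℝ} (ha : IsPlaceAbv V a)
    (hV : IsPlace k V) {c : k} (hc : c ≠ 0) : a (algebraMap k K c) = 1 := by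
  have h1 := (ha.le_one_iff _).2 (hV.1 c)
  have h2 := (ha.le_one_iff _).2 (hV.1 c⁻¹)
  rw [map_inv₀, map_inv₀] at h2
  have h3 : 0 < a (algebraMap k K c) := a.pos (by simpa using hc)
  exact le_antisymm h1 ((inv_le_one₀ h3).1 h2)

end IsPlaceAbv

theorem IsPlace.eq_of_le [CharZero k] (hK : IsCurveField k K) {V W : ValuationSubring K}
    (hV : IsPlace k V) (hW : IsPlace k W) (h : V ≤ W) : V = W := by
  obtain ⟨a, ha⟩ := hV.exists_isPlaceAbv hK
  exact ha.eq_of_le h hW.2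

/-- Krull's theorem: the integral closure of a subring of a field is the intersection of the
valuation rings containing it. -/
theorem isIntegral_closure_of_forall_valuationSubring {s : Set K} {y : K}
    (h : ∀ V : ValuationSubring K, s ⊆ V → y ∈ V) : IsIntegral (Subring.closure s) y := by
  have h1 := iInf_valuationSubring_superset (K := K) (s := s)
  have h2 : y ∈ (⨅ V : {V : ValuationSubring K // s ⊆ V.toSubring}, V.1.toSubring) := by
    rw [Subring.mem_iInf]
    rintro ⟨V, hV⟩
    exact h V hV
  rw [h1] at h2
  exact h2

/-- A valuation ring containing `k` and `x` is a place or all of `K`, so only closed points have to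
be tested. This turns pole-by-pole estimates into integrality over `k[x]`. -/
theorem isIntegral_adjoin_of_forall_place {x y : K}
    (h : ∀ V : ValuationSubring K, IsPlace k V → x ∈ V → y ∈ V) :
    IsIntegral (Algebra.adjoin k {x}) y := by
  have h1 : IsIntegral (Subring.closure (Set.range (algebraMap k K) ∪ {x})) y := by
    apply isIntegral_closure_of_forall_valuationSubring
    intro V hV
    by_cases hT : V = ⊤
    · rw [hT]; trivial
    · exact h V ⟨fun c => hV (Or.inl ⟨c, rfl⟩), hT⟩ (hV (Or.inr rfl))
  obtain ⟨p, hp, hpy⟩ := h1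
  have hle : ∀ z ∈ Subring.closure (Set.range (algebraMap k K) ∪ {x}),
      z ∈ Algebra.adjoin k {x} := by
    intro z hz
    have : Subring.closure (Set.range (algebraMap k K) ∪ {x}) ≤
      (Algebra.adjoin k {x}).toSubring := by
      rw [Subring.closure_le]
      rintro z (⟨c, rfl⟩ | rfl)
      · exact (Algebra.adjoin k {x}).algebraMap_mem c
      · exact Algebra.subset_adjoin rfl
    exact this hz
  let i : Subring.closure (Set.range (algebraMap k K) ∪ {x}) →+* Algebra.adjoin k {x} :=
    (Subring.subtype _).codRestrict (Algebra.adjoin k {x}).toSubring fun z => hle z z.2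
  refine ⟨p.map i, hp.map i, ?_⟩
  rw [eval₂_map]
  exact hpy

end PlaceAbv

/-! ### Points with values in a field and their local rings. -/

section Points

variable {k K L : Type*} [Field k] [Field K] [Algebra k K] [Field L] {ι : k →+* L}

namespace CurvePoint

theorem value_of_mem (t : CurvePoint K ι) {x : K} (h : x ∈ t.localRing) :
    t.value x = t.residue ⟨x, h⟩ := dif_pos h

theorem value_of_notMem (t : CurvePoint K ι) {x : K} (h : x ∉ t.localRing) : t.value x = 0 :=
  dif_neg h

theorem value_algebraMap (t : CurvePoint K ι) (c : k) : t.value (algebraMap k K c) = ι c := by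
  rw [t.value_of_mem (t.algebraMap_mem c), t.residue_algebraMap]

theorem value_add (t : CurvePoint K ι) {x y : K} (hx : x ∈ t.localRing) (hy : y ∈ t.localRing) :
    t.value (x + y) = t.value x + t.value y := by
  rw [t.value_of_mem hx, t.value_of_mem hy, t.value_of_mem (t.localRing.add_mem _ _ hx hy),
    ← map_add]
  rfl

theorem value_mul (t : CurvePoint K ι) {x y : K} (hx : x ∈ t.localRing) (hy : y ∈ t.localRing) :
    t.value (x * y) = t.value x * t.value y := by
  rw [t.value_of_mem hx, t.value_of_mem hy, t.value_of_mem (t.localRing.mul_mem _ _ hx hy),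
    ← map_mul]
  rfl

theorem value_one (t : CurvePoint K ι) : t.value 1 = 1 := by
  rw [t.value_of_mem t.localRing.one_mem, ← map_one t.residue]
  rfl

theorem value_zero (t : CurvePoint K ι) : t.value 0 = 0 := by
  rw [t.value_of_mem t.localRing.zero_mem, ← map_zero t.residue]
  rfl

theorem value_neg (t : CurvePoint K ι) (x : K) : t.value (-x) = -t.value x := by
  by_cases hx : x ∈ t.localRing
  · rw [t.value_of_mem hx, t.value_of_mem (t.localRing.neg_mem _ hx), ← map_neg]
    rfl
  · rw [t.value_of_notMem hx, t.value_of_notMem fun h => hx (by simpa using neg_mem h), neg_zero]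

theorem value_pow (t : CurvePoint K ι) {x : K} (hx : x ∈ t.localRing) (n : ℕ) :
    t.value (x ^ n) = t.value x ^ n := by
  induction n with
  | zero => simp [value_one]
  | succ n ih => rw [pow_succ, t.value_mul (pow_mem hx n) hx, ih, pow_succ]

theorem value_sum (t : CurvePoint K ι) {α : Type*} (s : Finset α) (x : α → K)
    (hx : ∀ i ∈ s, x i ∈ t.localRing) : t.value (∑ i ∈ s, x i) = ∑ i ∈ s, t.value (x i) := by
  classical
  induction s using Finset.induction_on with
  | empty => simp [value_zero]
  | insert i s his ih =>
    rw [Finset.sum_insert his, Finset.sum_insert his, t.value_add (hx i (by simp))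
      (sum_mem fun j hj => hx j (by simp [hj])), ih fun j hj => hx j (by simp [hj])]

theorem value_eq_zero_iff (t : CurvePoint K ι) {x : K} (hx : x ∈ t.localRing) :
    t.value x = 0 ↔ x ∈ t.localRing.nonunits := by
  rw [t.value_of_mem hx]
  have := t.isLocalHom_residue
  have h : x ∈ t.localRing.nonunits ↔ _ :=
    ValuationSubring.coe_mem_nonunits_iff (A := t.localRing) (a := ⟨x, hx⟩)
  rw [h, ← not_iff_not, ← ne_eq, ← isUnit_iff_ne_zero, isUnit_map_iff,
    IsLocalRing.mem_maximalIdeal, mem_nonunits_iff, not_not]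

theorem inv_mem_of_value_ne_zero (t : CurvePoint K ι) {x : K} (h : t.value x ≠ 0) :
    x⁻¹ ∈ t.localRing := by
  have hx : x ∈ t.localRing := by
    by_contra hx
    exact h (t.value_of_notMem hx)
  by_contra hxi
  exact h ((t.value_eq_zero_iff hx).2 (t.localRing.mem_nonunits_iff_or.2 (Or.inr hxi)))

theorem mem_of_value_ne_zero (t : CurvePoint K ι) {x : K} (h : t.value x ≠ 0) :
    x ∈ t.localRing := by
  by_contra hx
  exact h (t.value_of_notMem hx)

theorem value_inv (t : CurvePoint K ι) {x : K} (h : t.value x ≠ 0) :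
    t.value x⁻¹ = (t.value x)⁻¹ := by
  have hx := t.mem_of_value_ne_zero h
  have hx0 : x ≠ 0 := by rintro rfl; exact h t.value_zero
  have := t.value_mul hx (t.inv_mem_of_value_ne_zero h)
  rw [mul_inv_cancel₀ hx0, value_one] at this
  exact eq_inv_of_mul_eq_one_right this.symm

theorem map_value {L' : Type*} [Field L'] (t : CurvePoint K ι) (j : L →+* L') (ι' : k →+* L')
    (h : ∀ c, j (ι c) = ι' c) (x : K) : (t.map j ι' h).value x = j (t.value x) := by
  by_cases hx : x ∈ t.localRing
  · rw [t.value_of_mem hx, (t.map j ι' h).value_of_mem (x := x) hx]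
    rfl
  · rw [t.value_of_notMem hx, (t.map j ι' h).value_of_notMem (x := x) hx, map_zero]

/-- Multiplication by the generator of the `n`-th power of the maximal ideal scales the absolute
value by `e ^ (-n)`, so the least admissible `n` is the positive part of the logarithm. This
translates the algebraic divisor `D` into the absolute values in which the dynamics is computed. -/
theorem poleOrder_eq_posLog (t : CurvePoint K ι) {a : AbsoluteValue K ℝ}
    (ha : IsPlaceAbv t.localRing a) (x : K) : (t.poleOrder x : ℝ) = Real.posLog (a x) := by
  obtain ⟨π, hπ⟩ := ha.exists_uniformizer
  have hπlt : a π < 1 := by rw [hπ]; simp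
  have hπV : π ∈ t.localRing := (ha.le_one_iff π).1 hπlt.le
  have hπ0 : π ≠ 0 := by rintro rfl; simp at hπ; linarith [Real.exp_pos (-1)]
  have hmax : IsLocalRing.maximalIdeal t.localRing = Ideal.span {⟨π, hπV⟩} := by
    apply le_antisymm
    · intro z hz
      rw [← ValuationSubring.coe_mem_nonunits_iff, ← ha.lt_one_iff] at hz
      have h1 := ha.le_exp_neg_one hz
      rw [Ideal.mem_span_singleton]
      have h2 : (z : K) * π⁻¹ ∈ t.localRing := by
        rw [← ha.le_one_iff, map_mul, map_inv₀, hπ]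
        exact mul_inv_le_one_of_le₀ h1 (Real.exp_pos _).le
      refine ⟨⟨_, h2⟩, Subtype.ext ?_⟩
      change (z : K) = π * (z * π⁻¹)
      field_simp
    · rw [Ideal.span_singleton_le_iff_mem, ← ValuationSubring.coe_mem_nonunits_iff,
        ← ha.lt_one_iff]
      exact hπlt
  have hset : {n : ℕ | ∀ b ∈ IsLocalRing.maximalIdeal t.localRing ^ n, (b : K) * x ∈ t.localRing}
      = {n : ℕ | a x ≤ Real.exp n} := by
    ext n
    rw [Set.mem_ofPred_eq, Set.mem_ofPred_eq, hmax, Ideal.span_singleton_pow]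
    have key : π ^ n * x ∈ t.localRing ↔ a x ≤ Real.exp n := by
      rw [← ha.le_one_iff, map_mul, map_pow, hπ, ← Real.exp_nat_mul, mul_neg_one, Real.exp_neg,
        inv_mul_le_one₀ (Real.exp_pos _)]
    rw [← key]
    constructor
    · intro h
      exact h _ (Ideal.mem_span_singleton_self _)
    · intro h b hb
      obtain ⟨c, rfl⟩ := Ideal.mem_span_singleton.1 hb
      have := t.localRing.mul_mem _ _ c.2 h
      convert this using 1
      push_cast
      ring
  rw [poleOrder, hset]
  by_cases hx : x = 0
  · have : sInf {n : ℕ | a x ≤ Real.exp n} = 0 := by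
      rw [Nat.sInf_eq_zero]; left; simp [hx]
    rw [this, hx]; simp
  obtain ⟨m, hm⟩ := ha.exists_int x hx
  have h2 : {n : ℕ | a x ≤ Real.exp n} = Set.Ici m.toNat := by
    ext n
    rw [Set.mem_ofPred_eq, hm, Real.exp_le_exp, Set.mem_Ici, Int.toNat_le]
    norm_cast
  rw [h2, csInf_Ici, hm, show Real.posLog (Real.exp m) = max 0 (Real.log (Real.exp m)) from rfl,
    Real.log_exp]
  have := Int.toNat_eq_max m
  have h3 : ((m.toNat : ℤ) : ℝ) = ((max m 0 : ℤ) : ℝ) := by rw [this]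
  rw [max_comm]
  push_cast at h3
  exact h3

end CurvePoint

/-- A point with values in `k̄` is not the generic point: evaluation would embed `K` over `k` into
an algebraic extension, whereas `K` contains a transcendental element. -/
theorem GeomPoint.isPlace (hK : IsCurveField k K) (β : GeomPoint k K) :
    IsPlace k β.localRing := by
  refine ⟨β.algebraMap_mem, fun htop => ?_⟩
  obtain ⟨z, hz⟩ : ∃ z : K, Transcendental k z := by
    by_contra! h
    have : Algebra.IsAlgebraic k K := ⟨fun z => not_not.1 (h z)⟩
    have := hK.trdeg_eq_one
    rw [trdeg_eq_zero_iff.2 inferInstance] at this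
    simp at this
  have hmem : ∀ x, x ∈ β.localRing := fun x => htop ▸ ValuationSubring.mem_top x
  obtain ⟨p, hp0, hp⟩ := Algebra.IsAlgebraic.isAlgebraic (R := k) (β.value z)
  have h1 : ∀ q : k[X], β.value (aeval z q) = aeval (β.value z) q := by
    intro q
    induction q using Polynomial.induction_on' with
    | add q r hq hr => rw [map_add, map_add, β.value_add (hmem _) (hmem _), hq, hr]
    | monomial n c =>
      rw [aeval_monomial, aeval_monomial, β.value_mul (hmem _) (hmem _), β.value_pow (hmem _),
        β.value_algebraMap]
  have h2 : aeval z p ≠ 0 := fun h => hz ⟨p, hp0, h⟩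
  have h3 := h1 p
  rw [hp, β.value_eq_zero_iff (hmem _), ValuationSubring.mem_nonunits_iff_or] at h3
  rcases h3 with h3 | h3
  · exact h2 h3
  · exact h3 (hmem _)

theorem RatPoint.isPlace (hK : IsCurveField k K) (t : RatPoint k K) : IsPlace k t.localRing :=
  GeomPoint.isPlace hK t.toGeom

theorem CurvePoint.ext_value {t s : CurvePoint K ι} (h : t.localRing = s.localRing)
    (hv : ∀ x ∈ t.localRing, t.value x = s.value x) : t = s := by
  obtain ⟨V, r, h1, h2, h3⟩ := t
  obtain ⟨W, r', h1', h2', h3'⟩ := s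
  obtain rfl : V = W := h
  congr
  ext ⟨x, hx⟩
  have := hv x hx
  rwa [CurvePoint.value_of_mem _ hx, CurvePoint.value_of_mem _ hx] at this

theorem RatPoint.toGeom_value (t : RatPoint k K) (x : K) :
    t.toGeom.value x = algebraMap k (AlgebraicClosure k) (t.value x) :=
  CurvePoint.map_value t _ _ _ x

/-- At a rational point `x - x(t)` lies in the maximal ideal, so the local ring alone determines all
values and leaves no choice for the embedding of the residue field. -/
theorem RatPoint.toGeom_eq {t : RatPoint k K} {β : GeomPoint k K}
    (h : t.localRing = β.localRing) : t.toGeom = β := by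
  apply CurvePoint.ext_value h
  intro x hx
  have hx' : x ∈ t.localRing := hx
  rw [t.toGeom_value]
  have h1 : x - algebraMap k K (t.value x) ∈ t.localRing :=
    sub_mem hx' (t.algebraMap_mem _)
  have h2 : t.value (x - algebraMap k K (t.value x)) = 0 := by
    rw [sub_eq_add_neg, t.value_add hx' (neg_mem (t.algebraMap_mem _)), t.value_neg,
      t.value_algebraMap]
    simp
  rw [t.value_eq_zero_iff h1, h] at h2
  rw [h] at hx' h1
  rw [← β.value_eq_zero_iff h1, sub_eq_add_neg, β.value_add hx' (neg_mem (β.algebraMap_mem _)),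
    β.value_neg, β.value_algebraMap] at h2
  rw [← sub_eq_zero, ← neg_eq_zero]
  simpa [sub_eq_add_neg, add_comm] using h2

/-- Every place of a curve over `k` is the local ring of a point over `k̄`. -/
theorem IsPlace.exists_geomPoint [CharZero k] (hK : IsCurveField k K) {V : ValuationSubring K}
    (hV : IsPlace k V) : ∃ β : GeomPoint k K, β.localRing = V := by
  let i : k →+* V := (algebraMap k K).codRestrict V.toSubring hV.1
  let _ : Algebra k (IsLocalRing.ResidueField V) := ((IsLocalRing.residue V).comp i).toAlgebra
  -- Elements of the residue field are quotients of residues of functions integral over `k[y⁻¹]`.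
  -- The ring `k[y⁻¹]` itself reduces to `k`, because `y⁻¹` vanishes at `V`; hence these residues
  -- are algebraic over `k`.
  have halg : Algebra.IsAlgebraic k (IsLocalRing.ResidueField V) := by
    constructor
    obtain ⟨y, hy⟩ := hV.exists_notMem
    have hyt := Transcendental.inv' (hV.transcendental_of_notMem hy)
    have hyV := inv_mem_nonunits_of_notMem V hy
    have hyV' := inv_mem_of_notMem V hy
    obtain ⟨h1, h2, h3⟩ := integralClosure_adjoin_isDedekindDomain hK hyt
    obtain ⟨v, hv1, hv2⟩ := hV.exists_heightOneSpectrum hyV'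
    have hA : ∀ a : integralClosure (Algebra.adjoin k {y⁻¹}) K, (a : K) ∈ V :=
      fun a => hV.mem_of_isIntegral_adjoin hyV' a.2
    have hle : ∀ z ∈ Algebra.adjoin k {y⁻¹}, ∃ h : z ∈ V, ∃ c : k,
        IsLocalRing.residue V ⟨z, h⟩ = algebraMap k (IsLocalRing.ResidueField V) c := by
      intro z hz
      induction hz using Algebra.adjoin_induction with
      | mem z hz =>
        obtain rfl := Set.mem_singleton_iff.1 hz
        refine ⟨hyV', 0, ?_⟩
        rw [map_zero, IsLocalRing.residue_eq_zero_iff, ← ValuationSubring.coe_mem_nonunits_iff]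
        exact hyV
      | algebraMap c => exact ⟨hV.1 c, c, rfl⟩
      | add a b _ _ ha hb =>
        obtain ⟨ha, c, hc⟩ := ha
        obtain ⟨hb, d, hd⟩ := hb
        refine ⟨V.add_mem _ _ ha hb, c + d, ?_⟩
        rw [map_add, ← hc, ← hd, ← map_add]
        rfl
      | mul a b _ _ ha hb =>
        obtain ⟨ha, c, hc⟩ := ha
        obtain ⟨hb, d, hd⟩ := hb
        refine ⟨V.mul_mem _ _ ha hb, c * d, ?_⟩
        rw [map_mul, ← hc, ← hd, ← map_mul]
        rfl
    have hint : ∀ a : integralClosure (Algebra.adjoin k {y⁻¹}) K,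
        IsAlgebraic k (IsLocalRing.residue V ⟨a, hA a⟩) := by
      intro a
      obtain ⟨p, hp, hpa⟩ := a.2
      let j : Algebra.adjoin k {y⁻¹} →+* V := (algebraMap _ K).codRestrict V.toSubring
        fun z => (hle z z.2).1
      have hmon := hp.map ((IsLocalRing.residue V).comp j)
      have hlift : p.map ((IsLocalRing.residue V).comp j) ∈
          Polynomial.lifts (algebraMap k (IsLocalRing.ResidueField V)) := by
        rw [Polynomial.lifts_iff_coeff_lifts]
        intro n
        obtain ⟨h, c, hc⟩ := hle _ (p.coeff n).2
        exact ⟨c, by rw [coeff_map, ← hc]; rfl⟩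
      obtain ⟨q, hq1, -, hq2⟩ := Polynomial.lifts_and_natDegree_eq_and_monic hlift hmon
      refine IsIntegral.isAlgebraic ⟨q, hq2, ?_⟩
      rw [← eval_map, hq1, eval_map]
      have h5 : eval₂ j ⟨a, hA a⟩ p = 0 := by
        apply Subtype.ext
        have := hom_eval₂ p j V.subtype ⟨a, hA a⟩
        change V.subtype _ = 0
        rw [this]
        exact hpa
      rw [← hom_eval₂, h5, map_zero]
    intro z
    obtain ⟨x, rfl⟩ := IsLocalRing.residue_surjective z
    obtain ⟨n, d, hnd⟩ := v.exists_primeCompl_mul_eq_of_integer (x : K) (by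
      rw [← Valuation.mem_valuationSubring_iff, hv2]; exact x.2)
    have hd : IsLocalRing.residue V ⟨d, hA d⟩ ≠ 0 := by
      rw [Ne, IsLocalRing.residue_eq_zero_iff, ← ValuationSubring.coe_mem_nonunits_iff, ← hv1]
      exact d.2
    have h6 : IsLocalRing.residue V x =
        IsLocalRing.residue V ⟨n, hA n⟩ * (IsLocalRing.residue V ⟨d, hA d⟩)⁻¹ := by
      rw [eq_mul_inv_iff_mul_eq₀ hd, ← map_mul]
      congr 1
      exact Subtype.ext hnd
    rw [h6]
    exact (hint n).mul (hint d).inv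
  let σ : IsLocalRing.ResidueField V →ₐ[k] AlgebraicClosure k := IsAlgClosed.lift
  refine ⟨⟨V, (σ : IsLocalRing.ResidueField V →+* AlgebraicClosure k).comp
    (IsLocalRing.residue V), ?_, hV.1, ?_⟩, rfl⟩
  · infer_instance
  · intro c
    exact σ.commutes c

end Points

end PolyFamily

namespace PolyFamily

/-! ### Escape of orbits of polynomials -/

section Escape

theorem iter_succ {R : Type*} [CommRing R] (f : R[X]) (n : ℕ) (z : R) :
    iter f (n + 1) z = f.eval (iter f n z) := Function.iterate_succ_apply' _ _ _

theorem iter_add {R : Type*} [CommRing R] (f : R[X]) (m n : ℕ) (z : R) :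
    iter f (m + n) z = iter f m (iter f n z) := Function.iterate_add_apply _ _ _ _

/-- The relative error `∑ bⱼ y ^ (d - j)` of the leading term of a polynomial near `∞`. -/
def escapeError {R : Type*} [CommRing R] (d : ℕ) (b : ℕ → R) (y : R) : R :=
  ∑ j ∈ Finset.range d, b j * y ^ (d - j)

/-- The orbit of `y` under the polynomial in the coordinate `y = c / z` at `∞`. -/
noncomputable def escapeSeq {R : Type*} [CommRing R] [Inv R] (d : ℕ) (A : R) (b : ℕ → R) (y : R) :
    ℕ → R
  | 0 => y
  | n + 1 => A * escapeSeq d A b y n ^ d * (1 + escapeError d b (escapeSeq d A b y n))⁻¹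

/-- In the coordinate `c / z`, the polynomial `f` becomes
`y ↦ A y ^ d / (1 + ∑ bⱼ y ^ (d - j))`. -/
structure EscapeData {E : Type*} [Field E] (f : E[X]) (c A : E) (b : ℕ → E) : Prop where
  ne_zero : c ≠ 0
  leading : A * f.leadingCoeff * c ^ (f.natDegree - 1) = 1
  coeff : ∀ j < f.natDegree, b j * (f.leadingCoeff * c ^ (f.natDegree - j)) = f.coeff j

namespace EscapeData

variable {E : Type*} [Field E] {f : E[X]} {c A : E} {b : ℕ → E}

theorem eval_eq (h : EscapeData f c A b) {z y : E} (hzy : z * y = c) :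
    f.eval z = f.leadingCoeff * z ^ f.natDegree * (1 + escapeError f.natDegree b y) := by
  rw [eval_eq_sum_range, Finset.sum_range_succ, escapeError, mul_add, mul_one, add_comm,
    Finset.mul_sum]
  congr 1
  refine Finset.sum_congr rfl fun j hj => ?_
  have hj' := Finset.mem_range.1 hj
  rw [← h.coeff j hj', ← hzy, mul_pow]
  have : z ^ f.natDegree = z ^ (f.natDegree - j) * z ^ j := by
    rw [← pow_add, Nat.sub_add_cancel hj'.le]
  rw [this]
  ring

theorem eval_mul (h : EscapeData f c A b) (hd : 1 ≤ f.natDegree) {z y : E} (hzy : z * y = c)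
    (hy : 1 + escapeError f.natDegree b y ≠ 0) :
    f.eval z * (A * y ^ f.natDegree * (1 + escapeError f.natDegree b y)⁻¹) = c := by
  rw [h.eval_eq hzy]
  have h1 : z ^ f.natDegree * y ^ f.natDegree = c ^ (f.natDegree - 1) * c := by
    rw [← mul_pow, hzy, ← pow_succ, Nat.sub_add_cancel hd]
  calc _ = A * f.leadingCoeff * (z ^ f.natDegree * y ^ f.natDegree) *
        ((1 + escapeError f.natDegree b y) * (1 + escapeError f.natDegree b y)⁻¹) := by ring
    _ = c := by
      rw [h1, mul_inv_cancel₀ hy, mul_one]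
      calc _ = A * f.leadingCoeff * c ^ (f.natDegree - 1) * c := by ring
        _ = c := by rw [h.leading, one_mul]

theorem iter_mul (h : EscapeData f c A b) (hd : 1 ≤ f.natDegree) {z y : E} (hzy : z * y = c)
    (hne : ∀ n, 1 + escapeError f.natDegree b (escapeSeq f.natDegree A b y n) ≠ 0) (n : ℕ) :
    iter f n z * escapeSeq f.natDegree A b y n = c := by
  induction n with
  | zero => exact hzy
  | succ n ih => rw [iter_succ]; exact h.eval_mul hd ih (hne n)

end EscapeData

/-- Division by `d ^ n` telescopes the recurrence: the constant `α` contributes a geometric series,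
the bounded errors an absolutely convergent one. -/
theorem tendsto_of_recurrence {d : ℕ} (hd : 2 ≤ d) {x η : ℕ → ℝ} {α B : ℝ}
    (hx : ∀ n, x (n + 1) = d * x n + α + η n) (hη : ∀ n, |η n| ≤ B) :
    Tendsto (fun n => x n / (d : ℝ) ^ n) atTop
      (𝓝 (x 0 + α / (d - 1) + ∑' n, η n / (d : ℝ) ^ (n + 1))) := by
  have hd1 : (1 : ℝ) < d := by exact_mod_cast (by omega : 1 < d)
  have hd0 : (0 : ℝ) < d := by linarith
  have hgeo : Summable fun n : ℕ => B / (d : ℝ) ^ (n + 1) := by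
    have := (summable_geometric_of_lt_one (inv_nonneg.2 hd0.le) (inv_lt_one_of_one_lt₀ hd1)).mul_left
      (B * (d : ℝ)⁻¹)
    refine this.congr fun n => ?_
    rw [pow_succ, inv_pow]
    field_simp
  have hsum : Summable fun n => η n / (d : ℝ) ^ (n + 1) := by
    refine Summable.of_norm_bounded hgeo fun n => ?_
    rw [norm_div, Real.norm_eq_abs, norm_pow, Real.norm_of_nonneg hd0.le]
    gcongr
    exact hη n
  have key : ∀ n, x n / (d : ℝ) ^ n =
      x 0 + α / (d - 1) * (1 - ((d : ℝ) ^ n)⁻¹) + ∑ i ∈ Finset.range n, η i / (d : ℝ) ^ (i + 1) := by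
    intro n
    induction n with
    | zero => simp
    | succ n ih =>
      rw [Finset.sum_range_succ, hx]
      have h1 : ((d : ℝ) * x n + α + η n) / (d : ℝ) ^ (n + 1) =
          x n / (d : ℝ) ^ n + α / (d : ℝ) ^ (n + 1) + η n / (d : ℝ) ^ (n + 1) := by
        rw [pow_succ]; field_simp
      rw [h1, ih]
      have h2 : α / (d : ℝ) ^ (n + 1) =
          α / (d - 1) * (((d : ℝ) ^ n)⁻¹ - ((d : ℝ) ^ (n + 1))⁻¹) := by
        have : (d : ℝ) - 1 ≠ 0 := by linarith
        rw [pow_succ]; field_simp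
      rw [h2]; ring
  simp_rw [key]
  have h3 : Tendsto (fun n : ℕ => ((d : ℝ) ^ n)⁻¹) atTop (𝓝 0) :=
    (tendsto_pow_atTop_atTop_of_one_lt hd1).inv_tendsto_atTop
  have h4 := ((h3.const_sub 1).const_mul (α / (d - 1 : ℝ))).const_add (x 0)
  have h5 := h4.add hsum.hasSum.tendsto_sum_nat
  simpa using h5

variable {E : Type*} [Field E] {f : E[X]} {c A : E} {b : ℕ → E}

/-- Logarithms turn `Y (n + 1) = A * Y n ^ d / (1 + error)` into the recurrence of
`tendsto_of_recurrence` for `-log |Y n|`, and `log |c|` disappears after division by `d ^ n`. The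
bound on the orbit of `y` only serves to replace the logarithm by its positive part. -/
theorem EscapeData.tendsto (h : EscapeData f c A b) (hd : 2 ≤ f.natDegree)
    (a : AbsoluteValue E ℝ) {z y : E} (hzy : z * y = c)
    (hne : ∀ n, 1 + escapeError f.natDegree b (escapeSeq f.natDegree A b y n) ≠ 0)
    {B : ℝ} (hB : ∀ n,
      |Real.log (a (1 + escapeError f.natDegree b (escapeSeq f.natDegree A b y n)))| ≤ B)
    (hY : ∀ n, a (escapeSeq f.natDegree A b y n) ≤ 1) :
    Tendsto (fun n => Real.posLog (a (iter f n z)) / (f.natDegree : ℝ) ^ n) atTop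
      (𝓝 (-Real.log (a y) - Real.log (a A) / ((f.natDegree : ℝ) - 1) + ∑' n,
        Real.log (a (1 + escapeError f.natDegree b (escapeSeq f.natDegree A b y n))) /
          (f.natDegree : ℝ) ^ (n + 1))) := by
  set d := f.natDegree with hd'
  set Y := escapeSeq d A b y with hYdef
  have hmul := h.iter_mul (by omega) hzy hne
  have hY0 : ∀ n, Y n ≠ 0 := fun n h0 => h.ne_zero (by
    rw [← hmul n]; change _ * Y n = 0; rw [h0, mul_zero])
  have hz0 : ∀ n, iter f n z ≠ 0 := fun n h0 => h.ne_zero (by rw [← hmul n, h0, zero_mul])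
  have hA0 : A ≠ 0 := by
    rintro rfl
    have := h.leading
    simp at this
  have hd1 : (1 : ℝ) < d := by exact_mod_cast (by omega : 1 < d)
  have hrec : ∀ n, -Real.log (a (Y (n + 1))) = d * (-Real.log (a (Y n))) + -Real.log (a A) +
      Real.log (a (1 + escapeError d b (Y n))) := by
    intro n
    have : Y (n + 1) = A * Y n ^ d * (1 + escapeError d b (Y n))⁻¹ := rfl
    rw [this, map_mul, map_mul, map_pow, map_inv₀, Real.log_mul, Real.log_mul, Real.log_pow,
      Real.log_inv]
    · ring
    · exact (a.pos hA0).ne'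
    · exact pow_ne_zero _ (a.pos (hY0 n)).ne'
    · exact mul_ne_zero (a.pos hA0).ne' (pow_ne_zero _ (a.pos (hY0 n)).ne')
    · exact inv_ne_zero (a.pos (hne n)).ne'
  have ht := tendsto_of_recurrence hd (x := fun n => -Real.log (a (Y n))) hrec hB
  have hlog : ∀ n, Real.log (a (iter f n z)) = Real.log (a c) + -Real.log (a (Y n)) := by
    intro n
    have h1 : Real.log (a c) = Real.log (a (iter f n z)) + Real.log (a (Y n)) := by
      rw [← hmul n, map_mul, Real.log_mul (a.pos (hz0 n)).ne' (a.pos (hY0 n)).ne']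
    linarith
  have hc : Tendsto (fun n : ℕ => Real.log (a c) / (d : ℝ) ^ n) atTop (𝓝 0) :=
    tendsto_const_nhds.div_atTop (tendsto_pow_atTop_atTop_of_one_lt hd1)
  have ht2 := hc.add ht
  rw [zero_add] at ht2
  -- All `Y n` have absolute value at most `1`, so the limit is nonnegative and taking the maximum
  -- with `0` does not change it.
  have hnonneg : 0 ≤ -Real.log (a (Y 0)) + -Real.log (a A) / ((d : ℝ) - 1) +
      ∑' n, Real.log (a (1 + escapeError d b (Y n))) / (d : ℝ) ^ (n + 1) := by
    refine ge_of_tendsto' ht fun n => ?_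
    have := Real.log_nonpos (a.nonneg _) (hY n)
    exact div_nonneg (by simpa using this) (by positivity)
  have ht3 := (tendsto_const_nhds (x := (0 : ℝ)) (f := atTop)).max ht2
  rw [max_eq_right hnonneg] at ht3
  refine (ht3.congr fun n => ?_).trans_eq ?_
  · change _ = max 0 (Real.log (a (iter f n z))) / _
    rw [hlog, ← add_div]
    have := max_div_div_right (pow_pos (show (0 : ℝ) < d by linarith) n).le (0 : ℝ)
      (Real.log (a c) + -Real.log (a (Y n)))
    rwa [zero_div] at this
  · change 𝓝 (-Real.log (a y) + _ + _) = _
    rw [neg_div, ← sub_eq_add_neg]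

theorem sum_le_of_nonarch {a : AbsoluteValue E ℝ} (hna : IsNonarchimedean a) {α : Type*}
    {s : Finset α} {x : α → E} {C : ℝ} (hC : 0 ≤ C) (h : ∀ i ∈ s, a (x i) ≤ C) :
    a (∑ i ∈ s, x i) ≤ C := by
  classical
  induction s using Finset.induction_on with
  | empty => simpa using hC
  | insert i s his ih =>
    rw [Finset.sum_insert his]
    exact (hna _ _).trans (max_le (h i (by simp)) (ih fun j hj => h j (by simp [hj])))

/-- Every term of the error contains a positive power of `y`, since `j < d`; hence the error is
smaller than `1` and the ultrametric inequality is an equality. -/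
theorem EscapeData.one_add_error_of_nonarch {a : AbsoluteValue E ℝ} (hna : IsNonarchimedean a)
    {d : ℕ} (hb : ∀ j < d, a (b j) ≤ 1) {y : E} (hy : a y < 1) :
    a (1 + escapeError d b y) = 1 := by
  have h1 : a (escapeError d b y) < 1 := by
    rw [escapeError]
    apply lt_of_le_of_lt (b := a y) _ hy
    refine sum_le_of_nonarch hna (a.nonneg _) fun j hj => ?_
    have hj' := Finset.mem_range.1 hj
    rw [map_mul, map_pow]
    calc a (b j) * a y ^ (d - j) ≤ 1 * a y := by
          apply mul_le_mul (hb j hj') _ (by positivity) zero_le_one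
          exact pow_le_of_le_one (a.nonneg _) hy.le (by omega)
      _ = a y := one_mul _
  have := hna.add_eq_max_of_ne (x := 1) (y := escapeError d b y) (by rw [map_one]; exact h1.ne')
  rw [this, map_one, max_eq_left h1.le]

theorem EscapeData.seq_lt_one_of_nonarch {a : AbsoluteValue E ℝ} (hna : IsNonarchimedean a)
    {d : ℕ} (hd : 1 ≤ d) (hA : a A ≤ 1) (hb : ∀ j < d, a (b j) ≤ 1) {y : E} (hy : a y < 1)
    (n : ℕ) : a (escapeSeq d A b y n) < 1 := by
  induction n with
  | zero => exact hy
  | succ n ih =>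
    rw [escapeSeq, map_mul, map_mul, map_pow, map_inv₀,
      EscapeData.one_add_error_of_nonarch hna hb ih, inv_one, mul_one]
    calc a A * a (escapeSeq d A b y n) ^ d ≤ 1 * a (escapeSeq d A b y n) ^ d := by gcongr
      _ < 1 := by rw [one_mul]; exact pow_lt_one₀ (a.nonneg _) ih (by omega)

/-- Ultrametrically each error contributes `log 1`, so the escape rate is exact and no series
remains. -/
theorem EscapeData.tendsto_of_nonarch (h : EscapeData f c A b) (hd : 2 ≤ f.natDegree)
    {a : AbsoluteValue E ℝ} (hna : IsNonarchimedean a) (hA : a A ≤ 1)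
    (hb : ∀ j < f.natDegree, a (b j) ≤ 1) {z y : E} (hzy : z * y = c) (hy : a y < 1) :
    Tendsto (fun n => Real.posLog (a (iter f n z)) / (f.natDegree : ℝ) ^ n) atTop
      (𝓝 (-Real.log (a y) - Real.log (a A) / ((f.natDegree : ℝ) - 1))) := by
  have h1 : ∀ n, a (1 + escapeError f.natDegree b (escapeSeq f.natDegree A b y n)) = 1 :=
    fun n => EscapeData.one_add_error_of_nonarch hna hb
      (EscapeData.seq_lt_one_of_nonarch hna (by omega) hA hb hy n)
  have := h.tendsto hd a hzy (B := 0) (fun n h0 => by have := h1 n; rw [h0] at this; simp at this)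
    (fun n => by rw [h1]; simp)
    (fun n => (EscapeData.seq_lt_one_of_nonarch hna (by omega) hA hb hy n).le)
  simpa [h1] using this

theorem tendsto_of_bounded (a : AbsoluteValue E ℝ) (hd : 2 ≤ f.natDegree) {z : E} {C : ℝ}
    (h : ∀ n, a (iter f n z) ≤ C) :
    Tendsto (fun n => Real.posLog (a (iter f n z)) / (f.natDegree : ℝ) ^ n) atTop (𝓝 0) := by
  have hd1 : (1 : ℝ) < f.natDegree := by exact_mod_cast (by omega : 1 < f.natDegree)
  have hc : Tendsto (fun n : ℕ => Real.posLog C / (f.natDegree : ℝ) ^ n) atTop (𝓝 0) :=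
    tendsto_const_nhds.div_atTop (tendsto_pow_atTop_atTop_of_one_lt hd1)
  refine squeeze_zero 
    (fun n => div_nonneg Real.posLog_nonneg (by positivity)) (fun n => ?_) hc
  exact div_le_div_of_nonneg_right (Real.posLog_le_posLog (a.nonneg _) (h n)) (by positivity)

theorem tendsto_shift {u : ℕ → ℝ} {d : ℕ} {l : ℝ} (N : ℕ)
    (h : Tendsto (fun n => u (n + N) / (d : ℝ) ^ n) atTop (𝓝 l)) :
    Tendsto (fun n => u n / (d : ℝ) ^ n) atTop (𝓝 (l / (d : ℝ) ^ N)) := by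
  rw [← tendsto_add_atTop_iff_nat N]
  refine (h.div_const _).congr fun n => ?_
  rw [pow_add, div_div]

end Escape

end PolyFamily

namespace PolyFamily

/-! ### Functions with prescribed poles -/

section Functions

variable {k K : Type*} [Field k] [Field K] [Algebra k K]

open Classical in
/-- The normalized absolute value of a place. -/
noncomputable def placeAbv (V : ValuationSubring K) : AbsoluteValue K ℝ :=
  if h : ∃ a, IsPlaceAbv V a then h.choose else AbsoluteValue.trivial

theorem IsPlace.isPlaceAbv [CharZero k] (hK : IsCurveField k K) {V : ValuationSubring K}
    (hV : IsPlace k V) : IsPlaceAbv V (placeAbv V) := by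
  have h := hV.exists_isPlaceAbv hK
  rw [placeAbv, dif_pos h]
  exact h.choose_spec

theorem add_eq_of_lt_of_nonarch {E : Type*} [Field E] {a : AbsoluteValue E ℝ}
    (hna : IsNonarchimedean a) {x y : E} (h : a x < a y) : a (x + y) = a y := by
  rw [hna.add_eq_max_of_ne h.ne, max_eq_right h.le]

/-- If two different constants both produced cancellation at `V`, then `u` and `w`, being
combinations of the two sums with constant coefficients, would both be smaller than their maximum.
So each place forbids at most one constant, and `k` is infinite. -/
theorem exists_add_smul_eq_max [CharZero k] (hK : IsCurveField k K)
    {T : Set (ValuationSubring K)} (hT : T.Finite) (hTp : ∀ V ∈ T, IsPlace k V) (u w : K) :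
    ∃ c : k, ∀ V ∈ T, placeAbv V (u + algebraMap k K c * w) =
      max (placeAbv V u) (placeAbv V w) := by
  have hsub : ∀ V ∈ T, {c : k | placeAbv V (u + algebraMap k K c * w) ≠
      max (placeAbv V u) (placeAbv V w)}.Subsingleton := by
    intro V hV c hc c' hc'
    by_contra hne
    have ha := (hTp V hV).isPlaceAbv hK
    have h1 : ∀ c : k, placeAbv V (algebraMap k K c) ≤ 1 :=
      fun c => (ha.le_one_iff _).2 ((hTp V hV).1 c)
    have hlt : ∀ c : k, placeAbv V (u + algebraMap k K c * w) ≠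
        max (placeAbv V u) (placeAbv V w) → placeAbv V (u + algebraMap k K c * w) <
        max (placeAbv V u) (placeAbv V w) := by
      intro c hc
      refine lt_of_le_of_ne ((ha.nonarch _ _).trans (max_le_max le_rfl ?_)) hc
      rw [map_mul]
      exact mul_le_of_le_one_left (AbsoluteValue.nonneg _ _) (h1 c)
    have e1 := hlt c hc
    have e2 := hlt c' hc'
    have hone : placeAbv V (algebraMap k K (c - c')) = 1 :=
      ha.algebraMap_eq_one (hTp V hV) (sub_ne_zero.2 hne)
    have hw : placeAbv V w < max (placeAbv V u) (placeAbv V w) := by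
      have : algebraMap k K (c - c') * w =
          (u + algebraMap k K c * w) + -(u + algebraMap k K c' * w) := by
        rw [map_sub]; ring
      calc placeAbv V w = placeAbv V (algebraMap k K (c - c') * w) := by
            rw [map_mul, hone, one_mul]
        _ ≤ max (placeAbv V _) (placeAbv V _) := (congrArg _ this).trans_le (ha.nonarch _ _)
        _ < _ := max_lt e1 (by rw [AbsoluteValue.map_neg]; exact e2)
    have hu : placeAbv V u < max (placeAbv V u) (placeAbv V w) := by
      have : algebraMap k K (c - c') * u =
          algebraMap k K c * (u + algebraMap k K c' * w) +
            -(algebraMap k K c' * (u + algebraMap k K c * w)) := by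
        rw [map_sub]; ring
      calc placeAbv V u = placeAbv V (algebraMap k K (c - c') * u) := by
            rw [map_mul, hone, one_mul]
        _ ≤ max (placeAbv V _) (placeAbv V _) := (congrArg _ this).trans_le (ha.nonarch _ _)
        _ < _ := by
          refine max_lt ?_ ?_
          · rw [map_mul]
            exact (mul_le_of_le_one_left (AbsoluteValue.nonneg _ _) (h1 _)).trans_lt e2
          · rw [AbsoluteValue.map_neg, map_mul]
            exact (mul_le_of_le_one_left (AbsoluteValue.nonneg _ _) (h1 _)).trans_lt e1
    exact lt_irrefl _ (max_lt hu hw)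
  have hfin : (⋃ V ∈ T, {c : k | placeAbv V (u + algebraMap k K c * w) ≠
      max (placeAbv V u) (placeAbv V w)}).Finite :=
    hT.biUnion fun V hV => (hsub V hV).finite
  obtain ⟨c, hc⟩ := hfin.exists_notMem
  refine ⟨c, fun V hV => ?_⟩
  by_contra h
  exact hc (Set.mem_biUnion hV h)

/-- Weak approximation: there is a function with a pole at a given place and regular at finitely
many others. -/
theorem exists_notMem_and_forall_mem [CharZero k] (hK : IsCurveField k K) {W : ValuationSubring K}
    (hW : IsPlace k W) {T : Set (ValuationSubring K)} (hT : T.Finite)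
    (hTp : ∀ V ∈ T, IsPlace k V ∧ V ≠ W) : ∃ z, z ∉ W ∧ ∀ V ∈ T, z ∈ V := by
  induction T, hT using Set.Finite.induction_on with
  | empty => exact ⟨_, hW.exists_notMem.choose_spec, by simp⟩
  | @insert γ T hγ hT ih =>
    obtain ⟨z, hzW, hz⟩ := ih fun V hV => hTp V (Or.inr hV)
    obtain ⟨hγp, hγW⟩ := hTp γ (Or.inl rfl)
    obtain ⟨x, hxγ, hxW⟩ : ∃ x, x ∈ γ ∧ x ∉ W := by
      by_contra! h
      exact hγW (hγp.eq_of_le hK hW h)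
    have haW := hW.isPlaceAbv hK
    -- Inverses are combined: without cancellation the sum has absolute value at least `1` where `z`
    -- or `x` is regular, and it is small at `W`, where both have poles.
    obtain ⟨c, hc⟩ := exists_add_smul_eq_max hK (hT.insert γ) (fun V hV => (hTp V hV).1) z⁻¹ x⁻¹
    have hge : ∀ V ∈ insert γ T, 1 ≤ placeAbv V (z⁻¹ + algebraMap k K c * x⁻¹) := by
      intro V hV
      have haV := (hTp V hV).1.isPlaceAbv hK
      rw [hc V hV, le_max_iff, map_inv₀, map_inv₀]
      have aux : ∀ y : K, y ∉ W → y ∈ V → 1 ≤ (placeAbv V y)⁻¹ := by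
        intro y hyW hyV
        have hy0 : y ≠ 0 := by rintro rfl; exact hyW W.zero_mem
        exact (one_le_inv₀ (AbsoluteValue.pos _ hy0)).2 ((haV.le_one_iff y).2 hyV)
      rcases hV with rfl | hV
      · exact Or.inr (aux x hxW hxγ)
      · exact Or.inl (aux z hzW (hz V hV))
    have hlt : placeAbv W (z⁻¹ + algebraMap k K c * x⁻¹) < 1 := by
      refine (haW.nonarch _ _).trans_lt (max_lt ?_ ?_)
      · exact (haW.lt_one_iff _).2 (inv_mem_nonunits_of_notMem W hzW)
      · rw [map_mul]
        refine (mul_le_of_le_one_left (AbsoluteValue.nonneg _ _) ?_).trans_lt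
          ((haW.lt_one_iff _).2 (inv_mem_nonunits_of_notMem W hxW))
        exact (haW.le_one_iff _).2 (hW.1 c)
    have hne : z⁻¹ + algebraMap k K c * x⁻¹ ≠ 0 := by
      intro h0
      have := hge γ (Or.inl rfl)
      rw [h0, map_zero] at this
      linarith
    refine ⟨(z⁻¹ + algebraMap k K c * x⁻¹)⁻¹, ?_, fun V hV => ?_⟩
    · rw [← haW.le_one_iff, not_le, map_inv₀]
      exact (one_lt_inv₀ (AbsoluteValue.pos _ hne)).2 hlt
    · rw [← ((hTp V hV).1.isPlaceAbv hK).le_one_iff, map_inv₀]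
      exact inv_le_one_of_one_le₀ (hge V hV)

/-- At a pole of `x` the leading monomial strictly dominates, because nonzero constants have
absolute value `1`. -/
theorem IsPlaceAbv.aeval_eq {V : ValuationSubring K} {a : AbsoluteValue K ℝ} (ha : IsPlaceAbv V a)
    (hV : IsPlace k V) {x : K} (hx : x ∉ V) {p : k[X]} (hp : p ≠ 0) :
    a (aeval x p) = a x ^ p.natDegree := by
  have hx1 : 1 < a x := by rw [← not_le, ha.le_one_iff]; exact hx
  rw [aeval_eq_sum_range, Finset.sum_range_succ]
  have hlead : a (p.coeff p.natDegree • x ^ p.natDegree) = a x ^ p.natDegree := by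
    rw [Algebra.smul_def, map_mul, map_pow,
      ha.algebraMap_eq_one hV (by simpa using hp), one_mul]
  rw [← hlead]
  by_cases h0 : p.natDegree = 0
  · simp [h0]
  apply add_eq_of_lt_of_nonarch ha.nonarch
  rw [hlead]
  refine lt_of_le_of_lt (sum_le_of_nonarch ha.nonarch (C := a x ^ (p.natDegree - 1))
    (by positivity) fun i hi => ?_) (pow_lt_pow_right₀ hx1 (by omega))
  have hi' := Finset.mem_range.1 hi
  rw [Algebra.smul_def, map_mul, map_pow]
  refine (mul_le_of_le_one_left (by positivity) ((ha.le_one_iff _).2 (hV.1 _))).trans ?_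
  exact pow_le_pow_right₀ hx1.le (by omega)

theorem IsPlaceAbv.aeval_div_le_one {V : ValuationSubring K} {a : AbsoluteValue K ℝ}
    (ha : IsPlaceAbv V a) (hV : IsPlace k V) {x : K} (hx : x ∉ V) {p q : k[X]} (hq : q ≠ 0)
    (hpq : p.degree < q.degree) : aeval x p / aeval x q ∈ V := by
  have hx1 : 1 < a x := by rw [← not_le, ha.le_one_iff]; exact hx
  by_cases hp : p = 0
  · simp [hp, V.zero_mem]
  rw [← ha.le_one_iff, map_div₀, ha.aeval_eq hV hx hp, ha.aeval_eq hV hx hq]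
  refine div_le_one_of_le₀ (pow_le_pow_right₀ hx1.le ?_) (by positivity)
  exact (natDegree_lt_natDegree hp hpq).le

/-- The function field is generated over `k(x)` by finitely many functions integral over `k[x]`. -/
theorem exists_finset_integral_generators [CharZero k] (hK : IsCurveField k K) {x : K}
    (hx : Transcendental k x) : ∃ B : Finset K, (∀ b ∈ B, IsIntegral (Algebra.adjoin k {x}) b) ∧
      ∀ y : K, ∃ q : k[X], q ≠ 0 ∧ ∃ p : K → k[X],
        y = ∑ b ∈ B, aeval x (p b) / aeval x q * b := by
  classical
  obtain ⟨h1, h2, h3⟩ := integralClosure_adjoin_isDedekindDomain hK hx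
  have halg := isAlgebraic_of_trdeg_eq_one hK.trdeg_eq_one hx
  obtain ⟨s, hs⟩ := h2.fg_top
  have hpoly : ∀ r : Algebra.adjoin k {x}, ∃ p : k[X], aeval x p = (r : K) := by
    intro r
    have : (r : K) ∈ (aeval x : k[X] →ₐ[k] K).range :=
      (Algebra.adjoin_singleton_eq_range_aeval k x) ▸ r.2
    exact this
  refine ⟨s.image (fun z : integralClosure (Algebra.adjoin k {x}) K => (z : K)), ?_, fun y => ?_⟩
  · intro b hb
    obtain ⟨z, -, rfl⟩ := Finset.mem_image.1 hb
    exact z.2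
  · obtain ⟨r, hr0, hr⟩ := (halg.isAlgebraic y).exists_integral_multiple
    have hmem : (⟨r • y, hr⟩ : integralClosure (Algebra.adjoin k {x}) K) ∈
        Submodule.span (Algebra.adjoin k {x}) (s : Set _) := by rw [hs]; trivial
    rw [Submodule.mem_span_finset] at hmem
    obtain ⟨m, -, hm⟩ := hmem
    obtain ⟨q, hq⟩ := hpoly r
    choose pp hpp using hpoly
    have hr0' : (r : K) ≠ 0 := fun h => hr0 (Subtype.ext h)
    refine ⟨q, ?_, fun b => if h : b ∈ integralClosure (Algebra.adjoin k {x}) K then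
      pp (m ⟨b, h⟩) else 0, ?_⟩
    · rintro rfl
      rw [map_zero] at hq
      exact hr0' hq.symm
    · rw [Finset.sum_image (fun a _ b _ h => Subtype.ext h)]
      have h5 : (r : K) * y = ∑ a ∈ s, (m a : K) * (a : K) := by
        have e : ((⟨r • y, hr⟩ : integralClosure (Algebra.adjoin k {x}) K) : K) = (r : K) * y := rfl
        rw [← e, ← hm]
        rw [AddSubmonoidClass.coe_finsetSum]
        rfl
      rw [eq_comm, ← mul_right_inj' hr0', h5, Finset.mul_sum]
      refine Finset.sum_congr rfl fun a _ => ?_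
      beta_reduce
      rw [dif_pos a.2, hpp, hq]
      field_simp

/-- The functions regular at all places in `T`. -/
def regularAt (k : Type*) {K : Type*} [Field k] [Field K] [Algebra k K]
    (T : Set (ValuationSubring K)) (hT : ∀ V ∈ T, IsPlace k V) : Submodule k K where
  carrier := {y | ∀ V ∈ T, y ∈ V}
  add_mem' hx hy V hV := V.add_mem _ _ (hx V hV) (hy V hV)
  zero_mem' V _ := V.zero_mem
  smul_mem' c x hx V hV := by
    rw [Algebra.smul_def]
    exact V.mul_mem _ _ ((hT V hV).1 c) (hx V hV)

/-- There are finitely many poles of `y`, and at each of them some power of `y` outgrows each `b`;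
the sum of all these exponents works simultaneously. -/
theorem exists_pow_inv_mul_mem [CharZero k] (hK : IsCurveField k K) (B : Finset K) (y : K) :
    ∃ s : ℕ, ∀ b ∈ B, ∀ V, IsPlace k V → y ∉ V → (y ^ s)⁻¹ * b ∈ V := by
  have hfin := finite_setOf_notMem hK y
  have h1 : ∀ b : K, ∀ V : ValuationSubring K, ∃ s : ℕ, IsPlace k V → y ∉ V →
      placeAbv V b ≤ placeAbv V y ^ s := by
    intro b V
    by_cases hV : IsPlace k V
    · by_cases hy : y ∈ V
      · exact ⟨0, fun _ h => absurd hy h⟩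
      · have hy1 : 1 < placeAbv V y := by
          rw [← not_le, (hV.isPlaceAbv hK).le_one_iff]; exact hy
        obtain ⟨s, hs⟩ := pow_unbounded_of_one_lt (placeAbv V b) hy1
        exact ⟨s, fun _ _ => hs.le⟩
    · exact ⟨0, fun h => absurd h hV⟩
  choose s hs using h1
  refine ⟨∑ b ∈ B, ∑ V ∈ hfin.toFinset, s b V, fun b hb V hV hy => ?_⟩
  have ha := hV.isPlaceAbv hK
  have hy1 : 1 < placeAbv V y := by rw [← not_le, ha.le_one_iff]; exact hy
  rw [← ha.le_one_iff, map_mul, map_inv₀, map_pow]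
  refine inv_mul_le_one_of_le₀ ((hs b V hV hy).trans (pow_le_pow_right₀ hy1.le ?_)) (by positivity)
  have e1 : s b V ≤ ∑ V ∈ hfin.toFinset, s b V :=
    Finset.single_le_sum (f := fun V => s b V) (fun _ _ => Nat.zero_le _)
      (hfin.mem_toFinset.2 ⟨hV, hy⟩)
  exact e1.trans (Finset.single_le_sum (f := fun b => ∑ V ∈ hfin.toFinset, s b V)
    (fun _ _ => Nat.zero_le _) hb)

/-- Cohomology of the structure sheaf is finite-dimensional: up to finitely many classes, every
function is a sum of one regular where `y` is and one regular where `y` has poles. -/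
theorem finite_quotient_regularAt [CharZero k] (hK : IsCurveField k K) {y : K}
    (hy : Transcendental k y) :
    Module.Finite k (K ⧸ (regularAt k {V | IsPlace k V ∧ y ∈ V} (fun _ h => h.1) ⊔
      regularAt k {V | IsPlace k V ∧ y ∉ V} (fun _ h => h.1))) := by
  classical
  set W := regularAt k {V : ValuationSubring K | IsPlace k V ∧ y ∈ V} (fun _ h => h.1) ⊔
    regularAt k {V | IsPlace k V ∧ y ∉ V} (fun _ h => h.1) with hW
  obtain ⟨B, hB, hgen⟩ := exists_finset_integral_generators hK hy
  obtain ⟨s, hs⟩ := exists_pow_inv_mul_mem hK B y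
  have hy0 : y ≠ 0 := by rintro rfl; exact hy isAlgebraic_zero
  let F : Finset (K ⧸ W) := (B ×ˢ Finset.range s).image
    fun bj => W.mkQ (y ^ bj.2 * (y ^ s)⁻¹ * bj.1)
  refine ⟨⟨F, ?_⟩⟩
  rw [eq_top_iff]
  rintro z -
  obtain ⟨u, rfl⟩ := W.mkQ_surjective z
  obtain ⟨q, hq, p, rfl⟩ := hgen u
  rw [map_sum]
  refine Submodule.sum_mem _ fun b hb => ?_
  have hqy : aeval y q ≠ 0 := fun h => hy ⟨q, hq, h⟩
  -- Euclidean division of `p b * X ^ s` by `q`. The remainder over `q` is regular at the poles of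
  -- `y`, and the factor `(y ^ s)⁻¹` makes `b` regular there too; only the polynomial part survives
  -- in the quotient.
  have hdiv : aeval y (p b) / aeval y q * b =
      aeval y (p b * X ^ s / q) * (y ^ s)⁻¹ * b +
        aeval y (p b * X ^ s % q) / aeval y q * ((y ^ s)⁻¹ * b) := by
    have h1 := congrArg (aeval y) (EuclideanDomain.div_add_mod (p b * X ^ s) q)
    simp only [map_add, map_mul, map_pow, aeval_X] at h1
    have h2 : aeval y (p b) = (aeval y q * aeval y (p b * X ^ s / q) +
        aeval y (p b * X ^ s % q)) * (y ^ s)⁻¹ := by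
      rw [h1]; field_simp
    rw [h2]; field_simp
  rw [hdiv, map_add]
  have hΛ : W.mkQ (aeval y (p b * X ^ s % q) / aeval y q * ((y ^ s)⁻¹ * b)) = 0 := by
    rw [Submodule.mkQ_apply, Submodule.Quotient.mk_eq_zero, hW]
    refine Submodule.mem_sup_right fun V hV => V.mul_mem _ _ ?_ (hs b hb V hV.1 hV.2)
    exact (hV.1.isPlaceAbv hK).aeval_div_le_one hV.1 hV.2 hq (EuclideanDomain.mod_lt _ hq)
  rw [hΛ, add_zero, aeval_eq_sum_range, Finset.sum_mul, Finset.sum_mul, map_sum]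
  refine Submodule.sum_mem _ fun m _ => ?_
  rw [Algebra.smul_def, mul_assoc, mul_assoc, ← Algebra.smul_def, map_smul]
  refine Submodule.smul_mem _ _ ?_
  rw [← mul_assoc]
  -- For `m ≥ s` the monomial is a nonnegative power of `y` times an integral element, hence regular
  -- where `y` is. Only the finitely many `m < s` yield generators.
  by_cases hm : m < s
  · refine Submodule.subset_span ?_
    rw [Finset.mem_coe, Finset.mem_image]
    exact ⟨(b, m), by simp [hb, hm], rfl⟩
  · have h0 : W.mkQ (y ^ m * (y ^ s)⁻¹ * b) = 0 := by
      rw [Submodule.mkQ_apply, Submodule.Quotient.mk_eq_zero, hW]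
      refine Submodule.mem_sup_left fun V hV => V.mul_mem _ _ ?_
        (hV.1.mem_of_isIntegral_adjoin hV.2 (hB b hb))
      have : y ^ m * (y ^ s)⁻¹ = y ^ (m - s) := by
        rw [mul_inv_eq_iff_eq_mul₀ (by positivity), ← pow_add, Nat.sub_add_cancel (by omega)]
      rw [this]
      exact pow_mem hV.2 _
    rw [h0]
    exact Submodule.zero_mem _

/-- There is a function with a pole at a single given place. -/
theorem exists_single_pole [CharZero k] (hK : IsCurveField k K) {W : ValuationSubring K}
    (hW : IsPlace k W) : ∃ x, x ∉ W ∧ ∀ V, IsPlace k V → V ≠ W → x ∈ V := by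
  obtain ⟨y, hy⟩ := hW.exists_notMem
  have hyt := hW.transcendental_of_notMem hy
  have hfin := finite_setOf_notMem hK y
  obtain ⟨z, hzW, hz⟩ := exists_notMem_and_forall_mem hK hW
    (T := {V | IsPlace k V ∧ y ∉ V} \ {W}) (hfin.subset Set.sdiff_subset)
    (fun V hV => ⟨hV.1.1, hV.2⟩)
  have hfd := finite_quotient_regularAt hK hyt
  set Wq := regularAt k {V : ValuationSubring K | IsPlace k V ∧ y ∈ V} (fun _ h => h.1) ⊔
    regularAt k {V | IsPlace k V ∧ y ∉ V} (fun _ h => h.1) with hWq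
  -- The source is infinite-dimensional and the target is not, so some `z * p(z)` splits as `u + l`
  -- with `u` regular where `y` is and `l` regular at the poles of `y`. The extra factor `X` keeps
  -- the degree positive, so `z * p(z)` has a pole at `W`, which must come from `u`.
  let φ : k[X] →ₗ[k] (K ⧸ Wq) :=
    Wq.mkQ ∘ₗ (aeval z : k[X] →ₐ[k] K).toLinearMap ∘ₗ LinearMap.mulLeft k X
  have hninj : ¬ Function.Injective φ := by
    intro hinj
    have := Module.Finite.of_injective φ hinj
    exact Polynomial.not_finite this
  rw [← LinearMap.ker_eq_bot, Submodule.eq_bot_iff] at hninj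
  push Not at hninj
  obtain ⟨p, hp, hp0⟩ := hninj
  have hmem : aeval z (X * p) ∈ Wq := by
    rw [← Submodule.Quotient.mk_eq_zero]
    exact hp
  rw [hWq, Submodule.mem_sup] at hmem
  obtain ⟨u, hu, l, hl, hul⟩ := hmem
  have hXp : X * p ≠ 0 := mul_ne_zero X_ne_zero hp0
  have haW := hW.isPlaceAbv hK
  have hzW1 : 1 < placeAbv W z := by rw [← not_le, haW.le_one_iff]; exact hzW
  refine ⟨u, fun huW => ?_, fun V hV hVW => ?_⟩
  · have h1 : aeval z (X * p) ∈ W := by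
      rw [← hul]
      exact W.add_mem _ _ huW (hl W ⟨hW, hy⟩)
    rw [← haW.le_one_iff, haW.aeval_eq hW hzW hXp] at h1
    refine absurd h1 (not_le.2 (one_lt_pow₀ hzW1 ?_))
    rw [natDegree_X_mul hp0]
    omega
  · by_cases hyV : y ∈ V
    · exact hu V ⟨hV, hyV⟩
    · have h1 : aeval z (X * p) ∈ V := by
        have hzV := hz V ⟨⟨hV, hyV⟩, hVW⟩
        rw [aeval_eq_sum_range]
        refine sum_mem fun i _ => ?_
        rw [Algebra.smul_def]
        exact V.mul_mem _ _ (hV.1 _) (pow_mem hzV _)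
      have h2 : u = aeval z (X * p) - l := by rw [← hul]; ring
      rw [h2]
      exact sub_mem h1 (hl V ⟨hV, hyV⟩)

/-- There is a function with a given nonempty finite set of poles. -/
theorem exists_poles_eq [CharZero k] (hK : IsCurveField k K) {T : Set (ValuationSubring K)}
    (hT : T.Finite) (hTp : ∀ V ∈ T, IsPlace k V) :
    ∃ x : K, ∀ V, IsPlace k V → (x ∉ V ↔ V ∈ T) := by
  have h : ∀ W : ValuationSubring K, ∃ x, IsPlace k W → x ∉ W ∧
      ∀ V, IsPlace k V → V ≠ W → x ∈ V := by
    intro W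
    by_cases hW : IsPlace k W
    · obtain ⟨x, hx⟩ := exists_single_pole hK hW
      exact ⟨x, fun _ => hx⟩
    · exact ⟨0, fun h => absurd h hW⟩
  choose x hx using h
  refine ⟨∑ W ∈ hT.toFinset, x W, fun V hV => ⟨fun hn => ?_, fun hVT hmem => ?_⟩⟩
  · by_contra hVT
    refine hn (sum_mem fun W hW => ?_)
    have hWT := hT.mem_toFinset.1 hW
    exact (hx W (hTp W hWT)).2 V hV (by rintro rfl; exact hVT hWT)
  · classical
    rw [← Finset.add_sum_erase _ _ (hT.mem_toFinset.2 hVT)] at hmem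
    have h2 : ∑ W ∈ hT.toFinset.erase V, x W ∈ V := by
      refine sum_mem fun W hW => ?_
      rw [Finset.mem_erase] at hW
      exact (hx W (hTp W (hT.mem_toFinset.1 hW.2))).2 V hV hW.1.symm
    refine (hx V hV).1 ?_
    have := sub_mem hmem h2
    rwa [add_sub_cancel_right] at this

/-- Strong approximation: up to functions with bounded poles in `T`, every function is regular
outside of `T`. -/
theorem exists_regular_approx [CharZero k] (hK : IsCurveField k K) {T : Set (ValuationSubring K)}
    (hT : T.Finite) (hTp : ∀ V ∈ T, IsPlace k V) (hne : T.Nonempty) :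
    ∃ C : ℝ, ∀ h : K, ∃ g : K, (∀ V, IsPlace k V → V ∉ T → g ∈ V) ∧
      ∀ V ∈ T, placeAbv V (h - g) ≤ C := by
  obtain ⟨x, hx⟩ := exists_poles_eq hK hT hTp
  obtain ⟨W, hW⟩ := hne
  have hxt := (hTp W hW).transcendental_of_notMem ((hx W (hTp W hW)).2 hW)
  obtain ⟨B, hB, hgen⟩ := exists_finset_integral_generators hK hxt
  refine ⟨∑ b ∈ B, ∑ V ∈ hT.toFinset, placeAbv V b, fun h => ?_⟩
  obtain ⟨q, hq, p, rfl⟩ := hgen h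
  have hqx : aeval x q ≠ 0 := fun h => hxt ⟨q, hq, h⟩
  -- The polynomial parts are regular off `T`. The discarded proper fractions are regular on `T`,
  -- where `x` has poles, so the error is bounded by the generators alone, independently of `h`.
  refine ⟨∑ b ∈ B, aeval x (p b / q) * b, fun V hV hVT => ?_, fun V hV => ?_⟩
  · have hxV : x ∈ V := by by_contra h; exact hVT ((hx V hV).1 h)
    refine sum_mem fun b hb => V.mul_mem _ _ ?_ (hV.mem_of_isIntegral_adjoin hxV (hB b hb))
    exact hV.mem_of_isIntegral_adjoin hxV (isIntegral_algebraMap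
      (x := (⟨_, aeval_mem_adjoin_singleton k x⟩ : Algebra.adjoin k {x})))
  · have ha := (hTp V hV).isPlaceAbv hK
    have hxV := (hx V (hTp V hV)).2 hV
    have hB0 : ∀ b : K, 0 ≤ ∑ V ∈ hT.toFinset, placeAbv V b :=
      fun b => Finset.sum_nonneg fun _ _ => AbsoluteValue.nonneg _ _
    rw [← Finset.sum_sub_distrib]
    refine sum_le_of_nonarch ha.nonarch (Finset.sum_nonneg fun b _ => hB0 b) fun b hb => ?_
    have h1 := congrArg (aeval x) (EuclideanDomain.div_add_mod (p b) q)
    simp only [map_add, map_mul] at h1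
    have h2 : aeval x (p b) / aeval x q * b - aeval x (p b / q) * b =
        aeval x (p b % q) / aeval x q * b := by
      rw [← h1]; field_simp; ring
    rw [h2, map_mul]
    have h3 := (ha.le_one_iff _).2
      (ha.aeval_div_le_one (hTp V hV) hxV hq (EuclideanDomain.mod_lt (p b) hq))
    refine (mul_le_of_le_one_left (AbsoluteValue.nonneg _ _) h3).trans ?_
    have e1 : placeAbv V b ≤ ∑ V ∈ hT.toFinset, placeAbv V b :=
      Finset.single_le_sum (f := fun V => placeAbv V b) (fun _ _ => AbsoluteValue.nonneg _ _)
        (hT.mem_toFinset.2 hV)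
    exact e1.trans (Finset.single_le_sum (f := fun b => ∑ V ∈ hT.toFinset, placeAbv V b)
      (fun b _ => hB0 b) hb)

end Functions

end PolyFamily

namespace PolyFamily

/-! ### The divisor `D(f, P)` -/

section Divisor

/-- Once `c` is chosen, `A` and `b` are forced; enlarging `c` is what makes them small. -/
theorem escapeData_of_ne_zero {E : Type*} [Field E] {f : E[X]} (hf : f ≠ 0) {c : E} (hc : c ≠ 0) :
    EscapeData f c (f.leadingCoeff * c ^ (f.natDegree - 1))⁻¹
      (fun j => f.coeff j * (f.leadingCoeff * c ^ (f.natDegree - j))⁻¹) where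
  ne_zero := hc
  leading := by
    have : f.leadingCoeff * c ^ (f.natDegree - 1) ≠ 0 :=
      mul_ne_zero (leadingCoeff_ne_zero.2 hf) (pow_ne_zero _ hc)
    rw [mul_assoc, inv_mul_cancel₀ this]
  coeff j _ := by
    have : f.leadingCoeff * c ^ (f.natDegree - j) ≠ 0 :=
      mul_ne_zero (leadingCoeff_ne_zero.2 hf) (pow_ne_zero _ hc)
    rw [mul_assoc, inv_mul_cancel₀ this, mul_one]

variable {k K : Type*} [Field k] [Field K] [Algebra k K] {f : K[X]} {P : K}

/-- The multiplicity of a place in `D(f, P)`. -/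
noncomputable def placeCoeff (f : K[X]) (P : K) (V : ValuationSubring K) : ℝ :=
  limUnder atTop fun n : ℕ => Real.posLog (placeAbv V (iter f n P)) / (f.natDegree : ℝ) ^ n

theorem divisorCoeff_eq_placeCoeff [CharZero k] (hK : IsCurveField k K) (β : GeomPoint k K) :
    divisorCoeff f P β = placeCoeff f P β.localRing := by
  unfold divisorCoeff placeCoeff
  congr 1
  ext n
  rw [β.poleOrder_eq_posLog ((β.isPlace hK).isPlaceAbv hK)]

section Coeff

variable [CharZero k] (hK : IsCurveField k K) {V : ValuationSubring K} (hV : IsPlace k V)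
  {c A : K} {b : ℕ → K}

/-- An orbit that has exceeded `c` once is in the basin of infinity, so its escape rate is given
exactly by `EscapeData.tendsto_of_nonarch`. The identity for the leading coefficient then eliminates
`A` and `c`. The resulting function is the model for the function `g` of a height datum. -/
theorem EscapeData.placeCoeff_of_escape (h : EscapeData f c A b) (hd : 2 ≤ f.natDegree)
    {a : AbsoluteValue K ℝ} (haV : a = placeAbv V) (ha : IsPlaceAbv V a) (hA : a A ≤ 1)
    (hb : ∀ j < f.natDegree, a (b j) ≤ 1) {N : ℕ} (hN : a c < a (iter f N P)) :
    (f.natDegree : ℝ) ^ N * ((f.natDegree : ℝ) - 1) * placeCoeff f P V =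
      Real.log (a (f.leadingCoeff * iter f N P ^ (f.natDegree - 1))) ∧ 0 < placeCoeff f P V := by
  subst haV
  set a := placeAbv V
  have hz0 : iter f N P ≠ 0 := by
    intro h0
    rw [h0, map_zero] at hN
    exact absurd hN (not_lt.2 (a.nonneg _))
  have hy : a (c / iter f N P) < 1 := by
    rw [map_div₀, div_lt_one (a.pos hz0)]; exact hN
  have hzy : iter f N P * (c / iter f N P) = c := by field_simp
  have ht := h.tendsto_of_nonarch hd ha.nonarch hA hb hzy hy
  simp_rw [← iter_add] at ht
  have ht2 := (tendsto_shift (u := fun n => Real.posLog (a (iter f n P))) N ht).limUnder_eq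
  have hcoeff : placeCoeff f P V = _ := ht2
  have hd1 : (1 : ℝ) < f.natDegree := by exact_mod_cast (by omega : 1 < f.natDegree)
  have hl0 : f.leadingCoeff ≠ 0 := by
    intro h0
    have := h.leading
    rw [h0] at this
    simp at this
  have hA0 : A ≠ 0 := by
    rintro rfl
    have := h.leading
    simp at this
  have hcast : ((f.natDegree - 1 : ℕ) : ℝ) = (f.natDegree : ℝ) - 1 := by
    rw [Nat.cast_sub (by omega)]; simp
  have hlead : Real.log (a A) + Real.log (a f.leadingCoeff) +
      ((f.natDegree : ℝ) - 1) * Real.log (a c) = 0 := by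
    have h1 := congrArg (fun x => Real.log (a x)) h.leading
    simp only [map_mul, map_pow, map_one, Real.log_one] at h1
    rw [Real.log_mul (mul_ne_zero (a.pos hA0).ne' (a.pos hl0).ne')
      (pow_ne_zero _ (a.pos h.ne_zero).ne'), Real.log_mul (a.pos hA0).ne' (a.pos hl0).ne',
      Real.log_pow, hcast] at h1
    exact h1
  rw [hcoeff]
  constructor
  · rw [map_mul, map_pow, map_div₀, Real.log_mul (a.pos hl0).ne' (pow_ne_zero _ (a.pos hz0).ne'),
      Real.log_pow, Real.log_div (a.pos h.ne_zero).ne' (a.pos hz0).ne', hcast]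
    have : (f.natDegree : ℝ) - 1 ≠ 0 := by linarith
    field_simp
    linear_combination -hlead
  · apply div_pos _ (by positivity)
    have h1 : Real.log (a (c / iter f N P)) < 0 :=
      Real.log_neg (a.pos (div_ne_zero h.ne_zero hz0)) hy
    have h2 : Real.log (a A) / ((f.natDegree : ℝ) - 1) ≤ 0 :=
      div_nonpos_of_nonpos_of_nonneg (Real.log_nonpos (a.nonneg _) hA) (by linarith)
    linarith

/-- An orbit that exceeds `c` has positive escape rate. The resulting bound off the support is
uniform in `n`, which is the source of integrality of all iterates with one denominator. -/
theorem EscapeData.abv_iter_le_of_placeCoeff_eq_zero (h : EscapeData f c A b)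
    (hd : 2 ≤ f.natDegree) (ha : IsPlaceAbv V (placeAbv V)) (hA : placeAbv V A ≤ 1)
    (hb : ∀ j < f.natDegree, placeAbv V (b j) ≤ 1) (h0 : placeCoeff f P V = 0) (n : ℕ) :
    placeAbv V (iter f n P) ≤ placeAbv V c := by
  by_contra! hn
  exact (h.placeCoeff_of_escape hd rfl ha hA hb hn).2.ne' h0

theorem placeCoeff_eq_zero_of_bounded (hd : 2 ≤ f.natDegree) {C : ℝ}
    (h : ∀ n, placeAbv V (iter f n P) ≤ C) : placeCoeff f P V = 0 :=
  (tendsto_of_bounded _ hd h).limUnder_eq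

theorem EscapeData.exists_escape (hd : 2 ≤ f.natDegree) (h0 : placeCoeff f P V ≠ 0) :
    ∃ n, placeAbv V c < placeAbv V (iter f n P) := by
  by_contra! hn
  exact h0 (placeCoeff_eq_zero_of_bounded hd hn)

theorem EscapeData.escape_of_le (h : EscapeData f c A b) (hd : 2 ≤ f.natDegree)
    (ha : IsPlaceAbv V (placeAbv V)) (hA : placeAbv V A ≤ 1)
    (hb : ∀ j < f.natDegree, placeAbv V (b j) ≤ 1) {N : ℕ}
    (hN : placeAbv V c < placeAbv V (iter f N P)) {n : ℕ} (hn : N ≤ n) :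
    placeAbv V c < placeAbv V (iter f n P) := by
  have hz0 : iter f N P ≠ 0 := by
    intro h0
    rw [h0, map_zero] at hN
    exact absurd hN (not_lt.2 (AbsoluteValue.nonneg _ _))
  have hy : placeAbv V (c / iter f N P) < 1 := by
    rw [map_div₀, div_lt_one (AbsoluteValue.pos _ hz0)]; exact hN
  have hzy : iter f N P * (c / iter f N P) = c := by field_simp
  obtain ⟨m, rfl⟩ := Nat.exists_eq_add_of_le' hn
  have h1 := EscapeData.seq_lt_one_of_nonarch ha.nonarch (by omega) hA hb hy
  have h2 := h.iter_mul (by omega) hzy (fun n h0 => by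
    have := EscapeData.one_add_error_of_nonarch ha.nonarch hb (h1 n)
    rw [h0] at this; simp at this) m
  rw [← iter_add] at h2
  have hmz : iter f (m + N) P ≠ 0 := fun h0 => h.ne_zero (by rw [← h2, h0, zero_mul])
  rw [← h2, map_mul]
  exact mul_lt_of_lt_one_right (AbsoluteValue.pos _ hmz) (h1 m)

/-- Take for `c` a high power of the inverse of a uniformizer. -/
theorem IsPlaceAbv.exists_escapeData (ha : IsPlaceAbv V (placeAbv V)) (hd : 2 ≤ f.natDegree) :
    ∃ c A b, EscapeData f c A b ∧ placeAbv V A ≤ 1 ∧ ∀ j < f.natDegree, placeAbv V (b j) ≤ 1 := by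
  have hf : f ≠ 0 := by rintro rfl; simp at hd
  have hl : 0 < placeAbv V f.leadingCoeff := AbsoluteValue.pos _ (leadingCoeff_ne_zero.2 hf)
  obtain ⟨π, hπ⟩ := ha.exists_uniformizer
  have hπ0 : π ≠ 0 := by rintro rfl; simp at hπ; linarith [Real.exp_pos (-1)]
  have hπ1 : 1 < placeAbv V π⁻¹ := by rw [map_inv₀, hπ, Real.exp_neg, inv_inv]; simp
  obtain ⟨m, hm⟩ := pow_unbounded_of_one_lt ((placeAbv V f.leadingCoeff)⁻¹ +
    ∑ j ∈ Finset.range f.natDegree, placeAbv V (f.coeff j) * (placeAbv V f.leadingCoeff)⁻¹) hπ1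
  have hsum : 0 ≤ ∑ j ∈ Finset.range f.natDegree,
      placeAbv V (f.coeff j) * (placeAbv V f.leadingCoeff)⁻¹ :=
    Finset.sum_nonneg fun _ _ => mul_nonneg (AbsoluteValue.nonneg _ _) (by positivity)
  have hpow : ∀ n, n ≠ 0 → placeAbv V π⁻¹ ^ m ≤ placeAbv V (π⁻¹ ^ m) ^ n := by
    intro n hn
    rw [map_pow]
    exact le_self_pow₀ (one_le_pow₀ hπ1.le) hn
  refine ⟨π⁻¹ ^ m, _, _, escapeData_of_ne_zero hf (pow_ne_zero _ (inv_ne_zero hπ0)), ?_, ?_⟩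
  · rw [map_inv₀, map_mul, map_pow]
    refine inv_le_one_of_one_le₀ ?_
    rw [← inv_mul_le_iff₀ hl, mul_one]
    refine le_trans ?_ (hpow (f.natDegree - 1) (by omega))
    linarith
  · intro j hj
    rw [map_mul, map_inv₀, map_mul, map_pow, mul_inv, ← mul_assoc]
    refine mul_inv_le_one_of_le₀ ?_ (by positivity)
    refine le_trans ?_ (hpow (f.natDegree - j) (by omega))
    have : placeAbv V (f.coeff j) * (placeAbv V f.leadingCoeff)⁻¹ ≤ ∑ j ∈ Finset.range f.natDegree,
      placeAbv V (f.coeff j) * (placeAbv V f.leadingCoeff)⁻¹ :=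
      Finset.single_le_sum (f := fun j => placeAbv V (f.coeff j) * (placeAbv V f.leadingCoeff)⁻¹)
        (fun _ _ => mul_nonneg (AbsoluteValue.nonneg _ _) (by positivity)) (Finset.mem_range.2 hj)
    have := inv_pos.2 hl
    linarith

end Coeff

theorem iter_mem {R : Type*} [CommRing R] {f : R[X]} {P : R} (S : Subring R)
    (hf : ∀ i, f.coeff i ∈ S) (hP : P ∈ S) (n : ℕ) : iter f n P ∈ S := by
  induction n with
  | zero => exact hP
  | succ n ih =>
    rw [iter_succ, eval_eq_sum_range]
    exact sum_mem fun i _ => mul_mem (hf i) (pow_mem ih i)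

/-- The places in the support of `D(f, P)`. -/
def supportPlaces (k : Type*) {K : Type*} [Field k] [Field K] [Algebra k K] (f : K[X]) (P : K) :
    Set (ValuationSubring K) := {V | IsPlace k V ∧ placeCoeff f P V ≠ 0}

theorem mem_divisorSupport_iff [CharZero k] (hK : IsCurveField k K) (β : GeomPoint k K) :
    β ∈ divisorSupport k f P ↔ β.localRing ∈ supportPlaces k f P := by
  rw [divisorSupport, Set.mem_ofPred_eq, divisorCoeff_eq_placeCoeff hK]
  exact ⟨fun h => ⟨β.isPlace hK, h⟩, fun h => h.2⟩

theorem exists_notMem_of_mem_supportPlaces [CharZero k] (hK : IsCurveField k K)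
    (hd : 2 ≤ f.natDegree) {V : ValuationSubring K} (hV : V ∈ supportPlaces k f P)
    (hf : ∀ i, f.coeff i ∈ V) : P ∉ V := by
  intro hP
  refine hV.2 (placeCoeff_eq_zero_of_bounded hd (C := 1) fun n => ?_)
  exact ((hV.1.isPlaceAbv hK).le_one_iff _).2 (iter_mem V.toSubring hf hP n)

/-- Where `P` and all coefficients of `f` are regular, the whole orbit is regular and the
multiplicity vanishes. -/
theorem finite_supportPlaces [CharZero k] (hK : IsCurveField k K) (hd : 2 ≤ f.natDegree) :
    (supportPlaces k f P).Finite := by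
  have h1 : (⋃ i ∈ Finset.range (f.natDegree + 1), {V | IsPlace k V ∧ f.coeff i ∉ V}).Finite :=
    (Finset.finite_toSet _).biUnion fun i _ => finite_setOf_notMem hK _
  refine (h1.union (finite_setOf_notMem hK P)).subset fun V hV => ?_
  by_contra hn
  rw [Set.mem_union, not_or] at hn
  obtain ⟨hn1, hn2⟩ := hn
  have hP : P ∈ V := by by_contra h; exact hn2 ⟨hV.1, h⟩
  refine exists_notMem_of_mem_supportPlaces hK hd hV (fun i => ?_) hP
  by_cases hi : i < f.natDegree + 1
  · by_contra h
    exact hn1 (Set.mem_biUnion (Finset.mem_coe.2 (Finset.mem_range.2 hi)) ⟨hV.1, h⟩)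
  · rw [coeff_eq_zero_of_natDegree_lt (by omega)]; exact V.zero_mem

/-- For large `N` the function `f.leadingCoeff * iter f N P ^ (f.natDegree - 1)` has poles of the
prescribed order along the support, but possibly others elsewhere. Strong approximation replaces it
by a function regular off the support, at the cost of an error on the support whose pole order is
bounded independently of `N`. -/
theorem exists_isHeightDatum [CharZero k] (hK : IsCurveField k K) (hd : 2 ≤ f.natDegree)
    (hD : (divisorSupport k f P).Nonempty) : ∃ (N : ℕ) (g : K), IsHeightDatum k f P N g := by
  have hfin := finite_supportPlaces hK hd (P := P)
  obtain ⟨β₀, hβ₀⟩ := hD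
  rw [mem_divisorSupport_iff hK] at hβ₀
  obtain ⟨C, hC⟩ := exists_regular_approx hK hfin (fun V hV => hV.1) ⟨_, hβ₀⟩
  have hd1 : (1 : ℝ) < f.natDegree := by exact_mod_cast (by omega : 1 < f.natDegree)
  -- Exceeding `C` preserves the pole order under the approximation; exceeding `1` identifies the
  -- logarithm with its positive part.
  have hN : ∀ V ∈ supportPlaces k f P, ∀ᶠ N : ℕ in atTop,
      (f.natDegree : ℝ) ^ N * ((f.natDegree : ℝ) - 1) * placeCoeff f P V =
        Real.log (placeAbv V (f.leadingCoeff * iter f N P ^ (f.natDegree - 1))) ∧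
      max 1 C < placeAbv V (f.leadingCoeff * iter f N P ^ (f.natDegree - 1)) := by
    intro V hV
    have ha := hV.1.isPlaceAbv hK
    obtain ⟨c, A, b, h, hA, hb⟩ := ha.exists_escapeData hd
    obtain ⟨N₀, hN₀⟩ := EscapeData.exists_escape (c := c) hd hV.2
    have hpos := (h.placeCoeff_of_escape hd rfl ha hA hb hN₀).2
    have ht : Tendsto (fun N : ℕ => (f.natDegree : ℝ) ^ N * (((f.natDegree : ℝ) - 1) *
        placeCoeff f P V)) atTop atTop :=
      (tendsto_pow_atTop_atTop_of_one_lt hd1).atTop_mul_const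
        (mul_pos (by linarith) hpos)
    filter_upwards [eventually_ge_atTop N₀, ht.eventually_gt_atTop (Real.log (max 1 C))]
      with N hN h2
    have h3 := (h.placeCoeff_of_escape hd rfl ha hA hb (h.escape_of_le hd ha hA hb hN₀ hN)).1
    refine ⟨h3, ?_⟩
    rw [← mul_assoc, h3] at h2
    by_contra! hle
    by_cases h0 : placeAbv V (f.leadingCoeff * iter f N P ^ (f.natDegree - 1)) = 0
    · rw [h0, Real.log_zero] at h2
      exact absurd h2 (not_lt.2 (Real.log_nonneg (le_max_left _ _)))
    · exact absurd h2 (not_lt.2 (Real.log_le_log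
        (lt_of_le_of_ne (AbsoluteValue.nonneg _ _) (Ne.symm h0)) hle))
  obtain ⟨N, hN⟩ := ((hfin.eventually_all).2 hN).exists
  obtain ⟨g, hg1, hg2⟩ := hC (f.leadingCoeff * iter f N P ^ (f.natDegree - 1))
  refine ⟨N, g, fun β => ?_⟩
  have hβ := β.isPlace hK
  have ha := hβ.isPlaceAbv hK
  rw [divisorCoeff_eq_placeCoeff hK, β.poleOrder_eq_posLog ha]
  by_cases hβs : β.localRing ∈ supportPlaces k f P
  · obtain ⟨h1, h2⟩ := hN _ hβs
    rw [h1]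
    have h3 := hg2 _ hβs
    set h := f.leadingCoeff * iter f N P ^ (f.natDegree - 1)
    have h4 : placeAbv β.localRing g = placeAbv β.localRing h := by
      have e : g = -(h - g) + h := by ring
      conv_lhs => rw [e]
      apply add_eq_of_lt_of_nonarch ha.nonarch
      rw [AbsoluteValue.map_neg]
      exact h3.trans_lt ((le_max_right _ _).trans_lt h2)
    rw [h4, Real.posLog_eq_log]
    rw [abs_of_nonneg (AbsoluteValue.nonneg _ _)]
    exact ((le_max_left _ _).trans_lt h2).le
  · have h0 : placeCoeff f P β.localRing = 0 := by
      by_contra h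
      exact hβs ⟨hβ, h⟩
    rw [h0, mul_zero, Real.posLog_eq_zero_iff, abs_of_nonneg (AbsoluteValue.nonneg _ _),
      ha.le_one_iff]
    exact hg1 _ hβ hβs

end Divisor

end PolyFamily

namespace PolyFamily

/-! ### Integrality at almost all places -/

section GaussLemma

variable {k K : Type*} [Field k] [Field K] [Algebra k K]

theorem isIntegralElem_of_isIntegral {S R : Type*} [CommRing S] [CommRing R] [Algebra S K]
    (φ : R →+* K) (h : ∀ s : S, algebraMap S K s ∈ φ.range) {u : K} (hu : IsIntegral S u) :
    φ.IsIntegralElem u := by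
  obtain ⟨p, hp, hpu⟩ := hu
  have hl : p.map (algebraMap S K) ∈ Polynomial.lifts φ := by
    rw [Polynomial.lifts_iff_coeff_lifts]
    intro n
    rw [coeff_map]
    exact h _
  obtain ⟨q, hq1, -, hq2⟩ := Polynomial.lifts_and_natDegree_eq_and_monic hl (hp.map _)
  refine ⟨q, hq2, ?_⟩
  rw [← eval_map, hq1, eval_map]
  exact hpu

attribute [local instance] Polynomial.algebra in
-- Integrality of a polynomial over `o[X]` is integrality of its coefficients over `o`, and
-- valuation rings are integrally closed.
theorem coeff_mem_of_isIntegralElem (o : ValuationSubring k) {p : k[X]}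
    (h : (mapRingHom o.subtype).IsIntegralElem p) (n : ℕ) : p.coeff n ∈ o := by
  have h1 : IsIntegral o[X] p := h
  obtain ⟨y, hy⟩ := IsIntegrallyClosed.isIntegral_iff.1
    ((Polynomial.isIntegral_iff_isIntegral_coeff (R := o)).1 h1 n)
  rw [← hy]
  exact y.2

/-- Division by a monic polynomial over `o` never leaves `o[X]`, and over `k` it is the same
division. -/
theorem coeff_mem_of_monic_mul (o : ValuationSubring k) {Q p : k[X]} (hQ : Q.Monic)
    (hQo : ∀ i, Q.coeff i ∈ o) (h : ∀ i, (Q * p).coeff i ∈ o) (i : ℕ) : p.coeff i ∈ o := by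
  have hlift : ∀ r : k[X], (∀ i, r.coeff i ∈ o) → r ∈ Polynomial.lifts o.subtype := by
    intro r hr
    rw [Polynomial.lifts_iff_coeff_lifts]
    exact fun n => ⟨⟨_, hr n⟩, rfl⟩
  obtain ⟨Q', hQ', -, hQ'm⟩ := Polynomial.lifts_and_natDegree_eq_and_monic (hlift Q hQo) hQ
  obtain ⟨r, hr⟩ := (Polynomial.mem_lifts _).1 (hlift _ h)
  have : p = (r /ₘ Q').map o.subtype := by
    rw [map_divByMonic _ hQ'm, hr, hQ', mul_divByMonic_cancel_left _ hQ]
  rw [this, coeff_map]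
  exact Subtype.prop _

/-- A Gauss lemma that removes a monic denominator. Since `Q(g) u` lies in all valuation rings over
`o` containing `g`, it is integral over `o[g]`, so its minimal polynomial over `k[g]` has
coefficients in `o[g]`. This polynomial arises from that of `u` by scaling the roots by `Q`, so its
coefficients are those of `u` times powers of `Q`, and these powers can be divided out inside `o[X]`
because `Q` is monic. Hence `u` is itself integral over `o[g]`. -/
theorem mem_of_forall_monic_mul_mem {g : K} (hg : Transcendental k g) (o : ValuationSubring k)
    {Q : k[X]} (hQ : Q.Monic) (hQo : ∀ i, Q.coeff i ∈ o) {u : K}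
    (hu : IsIntegral (Algebra.adjoin k {g}) u)
    (hz : ∀ R : ValuationSubring K, (∀ c ∈ o, algebraMap k K c ∈ R) → g ∈ R → aeval g Q * u ∈ R)
    {R : ValuationSubring K} (hR : ∀ c ∈ o, algebraMap k K c ∈ R) (hgR : g ∈ R) : u ∈ R := by
  let φ : o[X] →+* K := (aeval g : k[X] →ₐ[k] K).toRingHom.comp (mapRingHom o.subtype)
  let _ : Algebra k[X] K := (aeval g : k[X] →ₐ[k] K).toRingHom.toAlgebra
  have hinj : Function.Injective (algebraMap k[X] K) :=
    transcendental_iff_injective.1 hg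
  have : FaithfulSMul k[X] K := (faithfulSMul_iff_algebraMap_injective _ _).2 hinj
  have hu' : IsIntegral k[X] u := by
    refine isIntegralElem_of_isIntegral (algebraMap k[X] K) (fun s => ?_) hu
    have h1 : ∀ z ∈ Algebra.adjoin k {g}, z ∈ (aeval g : k[X] →ₐ[k] K).range := by
      rw [Algebra.adjoin_singleton_eq_range_aeval]
      exact fun z hz => hz
    exact h1 s s.2
  have hφR : ∀ x, φ x ∈ R := by
    intro x
    change aeval g (x.map o.subtype) ∈ R
    rw [aeval_eq_sum_range]
    refine sum_mem fun i _ => ?_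
    rw [Algebra.smul_def, coeff_map]
    exact R.mul_mem _ _ (hR _ (Subtype.prop _)) (pow_mem hgR _)
  have hz' : φ.IsIntegralElem (aeval g Q * u) := by
    have h1 : IsIntegral (Subring.closure (algebraMap k K '' o ∪ {g})) (aeval g Q * u) := by
      apply isIntegral_closure_of_forall_valuationSubring
      intro V hV
      exact hz V (fun c hc => hV (Or.inl ⟨c, hc, rfl⟩)) (hV (Or.inr rfl))
    refine isIntegralElem_of_isIntegral φ (fun s => ?_) h1
    have hle : Subring.closure (algebraMap k K '' o ∪ {g}) ≤ φ.range := by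
      rw [Subring.closure_le]
      rintro z (⟨c, hc, rfl⟩ | rfl)
      · refine ⟨C ⟨c, hc⟩, ?_⟩
        change aeval g ((C (⟨c, hc⟩ : o)).map o.subtype) = _
        rw [map_C, aeval_C]
        rfl
      · refine ⟨X, ?_⟩
        change aeval z ((X : o[X]).map o.subtype) = _
        rw [map_X, aeval_X]
    exact hle s.2
  have hQ0 := hQ.ne_zero
  have hmin : minpoly k[X] (aeval g Q * u) = scaleRoots (minpoly k[X] u) Q :=
    IsIntegrallyClosed.minpoly_smul hQ0 hu'
  have hzint : IsIntegral k[X] (aeval g Q * u) :=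
    (isIntegral_algebraMap (R := k[X]) (x := Q)).mul hu'
  have hcoeff : ∀ j i, ((minpoly k[X] (aeval g Q * u)).coeff j).coeff i ∈ o := by
    intro j
    apply coeff_mem_of_isIntegralElem
    obtain ⟨p, hp, hpz⟩ := hz'
    let _ : Algebra o[X] k[X] := (mapRingHom o.subtype).toAlgebra
    refine isIntegral_coeff_of_dvd p _ hp (minpoly.monic hzint) ?_ j
    apply minpoly.isIntegrallyClosed_dvd hzint
    rw [aeval_def, eval₂_map]
    exact hpz
  have hcoeff' : ∀ j i, ((minpoly k[X] u).coeff j).coeff i ∈ o := by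
    intro j
    refine coeff_mem_of_monic_mul o (hQ.pow ((minpoly k[X] u).natDegree - j)) ?_ ?_
    · intro i
      have hlift : Q ∈ Polynomial.lifts o.subtype := by
        rw [Polynomial.lifts_iff_coeff_lifts]
        exact fun n => ⟨⟨_, hQo n⟩, rfl⟩
      have h2 := pow_mem hlift ((minpoly k[X] u).natDegree - j)
      rw [Polynomial.lifts_iff_coeff_lifts] at h2
      obtain ⟨y, hy⟩ := h2 i
      rw [← hy]
      exact y.2
    · intro i
      have := hcoeff j i
      rwa [hmin, coeff_scaleRoots, mul_comm] at this
  have hint : IsIntegral R u := by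
    have hlift : (minpoly k[X] u).map (algebraMap k[X] K) ∈ Polynomial.lifts (algebraMap R K) := by
      rw [Polynomial.lifts_iff_coeff_lifts]
      intro j
      rw [coeff_map]
      have hl : (minpoly k[X] u).coeff j ∈ Polynomial.lifts o.subtype := by
        rw [Polynomial.lifts_iff_coeff_lifts]
        exact fun n => ⟨⟨_, hcoeff' j n⟩, rfl⟩
      obtain ⟨r, hr⟩ := (Polynomial.mem_lifts _).1 hl
      have h3 := hφR r
      refine ⟨⟨_, h3⟩, ?_⟩
      change aeval g (r.map o.subtype) = aeval g ((minpoly k[X] u).coeff j)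
      rw [hr]
    obtain ⟨q, hq1, -, hq2⟩ := Polynomial.lifts_and_natDegree_eq_and_monic hlift
      ((minpoly.monic hu').map _)
    refine ⟨q, hq2, ?_⟩
    rw [← eval_map, hq1, eval_map]
    exact minpoly.aeval k[X] u
  obtain ⟨y, rfl⟩ := IsIntegrallyClosed.isIntegral_iff.1 hint
  exact y.2

end GaussLemma

end PolyFamily

namespace PolyFamily

/-! ### Functions integral above almost all finite places. -/

section AlmostRegular

variable {k K : Type*} [Field k] [NumberField k] [Field K] [Algebra k K]

/-- The valuation ring of a finite place of a number field. -/
def finiteRing (v : FinitePlace k) : ValuationSubring k where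
  carrier := {x | v x ≤ 1}
  mul_mem' {x y} hx hy := by
    change v (x * y) ≤ 1
    rw [map_mul]
    exact mul_le_one₀ hx (apply_nonneg v _) hy
  one_mem' := (map_one v).le
  add_mem' {x y} hx hy := (v.add_le x y).trans (max_le hx hy)
  zero_mem' := by change v 0 ≤ 1; rw [map_zero]; exact zero_le_one
  neg_mem' {x} hx := by change v (-x) ≤ 1; rw [map_neg_eq_map]; exact hx
  mem_or_inv_mem' x := by
    change v x ≤ 1 ∨ v x⁻¹ ≤ 1
    rw [map_inv₀]
    rcases le_or_gt (v x) 1 with h | h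
    · exact Or.inl h
    · exact Or.inr (inv_le_one_of_one_le₀ h.le)

theorem mem_finiteRing {v : FinitePlace k} {x : k} : x ∈ finiteRing v ↔ v x ≤ 1 := Iff.rfl

theorem eventually_mem_finiteRing (x : k) :
    ∀ᶠ v : FinitePlace k in cofinite, x ∈ finiteRing v := by
  by_cases hx : x = 0
  · exact Eventually.of_forall fun v => hx ▸ (finiteRing v).zero_mem
  · have h := FinitePlace.hasFiniteMulSupport hx
    have h2 : ∀ᶠ v : FinitePlace k in cofinite, v x = 1 := by
      rw [eventually_cofinite]
      exact h
    filter_upwards [h2] with v hv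
    exact mem_finiteRing.2 hv.le

/-- `R` is a valuation ring over the finite place `v`. -/
def LiesOver (v : FinitePlace k) (R : ValuationSubring K) : Prop :=
  ∀ c ∈ finiteRing v, algebraMap k K c ∈ R

/-- The elements which for almost all finite places `v` of `k` lie in all valuation rings over `v`
that satisfy `C`. -/
def almostRegular (k : Type*) {K : Type*} [Field k] [NumberField k] [Field K] [Algebra k K]
    (C : ValuationSubring K → Prop) : Subring K where
  carrier := {y | ∀ᶠ v : FinitePlace k in cofinite, ∀ R : ValuationSubring K,
    LiesOver v R → C R → y ∈ R}
  mul_mem' {x y} hx hy := by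
    rw [Set.mem_ofPred_eq] at hx hy ⊢
    filter_upwards [hx, hy] with v h1 h2 R hR hC
    exact R.mul_mem _ _ (h1 R hR hC) (h2 R hR hC)
  one_mem' := by
    rw [Set.mem_ofPred_eq]
    exact Eventually.of_forall fun v R _ _ => R.one_mem
  add_mem' {x y} hx hy := by
    rw [Set.mem_ofPred_eq] at hx hy ⊢
    filter_upwards [hx, hy] with v h1 h2 R hR hC
    exact R.add_mem _ _ (h1 R hR hC) (h2 R hR hC)
  zero_mem' := by
    rw [Set.mem_ofPred_eq]
    exact Eventually.of_forall fun v R _ _ => R.zero_mem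
  neg_mem' {x} hx := by
    rw [Set.mem_ofPred_eq] at hx ⊢
    filter_upwards [hx] with v h1 R hR hC
    exact R.neg_mem _ (h1 R hR hC)

variable {C : ValuationSubring K → Prop}

theorem mem_almostRegular {y : K} : y ∈ almostRegular k C ↔
    ∀ᶠ v : FinitePlace k in cofinite, ∀ R : ValuationSubring K, LiesOver v R → C R → y ∈ R :=
  Set.mem_ofPred_eq ▸ Iff.rfl

theorem mem_almostRegular_of_forall {y : K} (h : ∀ R, C R → y ∈ R) : y ∈ almostRegular k C :=
  mem_almostRegular.2 (Eventually.of_forall fun _ R _ hC => h R hC)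

theorem algebraMap_mem_almostRegular (c : k) : algebraMap k K c ∈ almostRegular k C := by
  rw [mem_almostRegular]
  filter_upwards [eventually_mem_finiteRing c] with v hv R hR _
  exact hR c hv

/-- An integral equation has finitely many coefficients, hence finitely many exceptional places, and
valuation rings are integrally closed. -/
theorem mem_almostRegular_of_isIntegral {S : Subring K} (hS : S ≤ almostRegular k C) {y : K}
    (hy : IsIntegral S y) : y ∈ almostRegular k C := by
  obtain ⟨p, hp, hpy⟩ := hy
  rw [mem_almostRegular]
  have h1 : ∀ᶠ v : FinitePlace k in cofinite, ∀ i ∈ Finset.range (p.natDegree + 1),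
      ∀ R : ValuationSubring K, LiesOver v R → C R → (p.coeff i : K) ∈ R := by
    rw [Filter.eventually_all_finset]
    intro i _
    exact mem_almostRegular.1 (hS (p.coeff i).2)
  filter_upwards [h1] with v hv R hR hC
  have hint : IsIntegral R y := by
    have hlift : p.map (algebraMap S K) ∈ Polynomial.lifts (algebraMap R K) := by
      rw [Polynomial.lifts_iff_coeff_lifts]
      intro j
      rw [coeff_map]
      by_cases hj : j < p.natDegree + 1
      · exact ⟨⟨_, hv j (Finset.mem_range.2 hj) R hR hC⟩, rfl⟩
      · exact ⟨0, by rw [coeff_eq_zero_of_natDegree_lt (by omega)]; simp⟩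
    obtain ⟨q, hq1, -, hq2⟩ := Polynomial.lifts_and_natDegree_eq_and_monic hlift (hp.map _)
    refine ⟨q, hq2, ?_⟩
    rw [← eval_map, hq1, eval_map]
    exact hpy
  obtain ⟨z, rfl⟩ := IsIntegrallyClosed.isIntegral_iff.1 hint
  exact z.2

theorem mem_almostRegular_of_isIntegral_adjoin {g y : K}
    (hy : IsIntegral (Algebra.adjoin k {g}) y) : y ∈ almostRegular k (fun R => g ∈ R) := by
  refine mem_almostRegular_of_isIntegral (S := (Algebra.adjoin k {g}).toSubring) ?_ hy
  intro z hz
  change z ∈ Algebra.adjoin k {g} at hz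
  induction hz using Algebra.adjoin_induction with
  | mem z hz =>
    rw [Set.mem_singleton_iff.1 hz]
    exact mem_almostRegular_of_forall fun R hC => hC
  | algebraMap c => exact algebraMap_mem_almostRegular c
  | add a b _ _ ha hb => exact add_mem ha hb
  | mul a b _ _ ha hb => exact mul_mem ha hb

theorem aeval_mem_of_coeff_mem {v : FinitePlace k} {R : ValuationSubring K} (hR : LiesOver v R)
    {h : K} (hh : h ∈ R) {s : k[X]} (hs : ∀ i, s.coeff i ∈ finiteRing v) : aeval h s ∈ R := by
  rw [aeval_eq_sum_range]
  refine sum_mem fun i _ => ?_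
  rw [Algebra.smul_def]
  exact R.mul_mem _ _ (hR _ (hs i)) (pow_mem hh _)

theorem eventually_coeff_mem (s : k[X]) :
    ∀ᶠ v : FinitePlace k in cofinite, ∀ i, s.coeff i ∈ finiteRing v := by
  have h1 : ∀ᶠ v : FinitePlace k in cofinite, ∀ i ∈ Finset.range (s.natDegree + 1),
      s.coeff i ∈ finiteRing v := by
    rw [Filter.eventually_all_finset]
    exact fun i _ => eventually_mem_finiteRing _
  filter_upwards [h1] with v hv i
  by_cases hi : i < s.natDegree + 1
  · exact hv i (Finset.mem_range.2 hi)
  · rw [coeff_eq_zero_of_natDegree_lt (by omega)]; exact (finiteRing v).zero_mem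

/-- Once the coefficients of `s` are `v`-integral, `s(h)` reduces to its constant term `1` modulo
the maximal ideal of `R`, hence is a unit. -/
theorem inv_aeval_mem_almostRegular {h : K} {s : k[X]} (hs : s.coeff 0 = 1) :
    (aeval h s)⁻¹ ∈ almostRegular k (fun R => h ∈ R.nonunits) := by
  rw [mem_almostRegular]
  filter_upwards [eventually_coeff_mem s] with v hv R hR hC
  have hhR : h ∈ R := R.nonunits_subset hC
  have h1 : aeval h s = 1 + aeval h s.divX * h := by
    conv_lhs => rw [← divX_mul_X_add s, hs]
    simp [add_comm]
  have h2 : aeval h s.divX ∈ R :=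
    aeval_mem_of_coeff_mem hR hhR fun i => by rw [coeff_divX]; exact hv _
  have h3 : R.valuation (aeval h s.divX * h) < 1 := by
    rw [map_mul]
    exact mul_lt_one_of_nonneg_of_lt_one_right ((R.valuation_le_one_iff _).2 h2) zero_le hC
  have h4 : R.valuation (aeval h s) = 1 := by
    rw [h1, Valuation.map_one_add_of_lt _ h3]
  rw [← R.valuation_le_one_iff, map_inv₀, h4, inv_one]

/-- A place containing `k[g⁻¹]` and the inverses of all `s(g⁻¹)` with `s(0) = 1` has to be a pole of
`g`. So `x` is integral over the ring generated by these elements, and each generator is integral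
above almost all `v` where `g⁻¹` is a nonunit. -/
theorem mem_almostRegular_of_forall_pole (hK : IsCurveField k K) {g : K} (hg : Transcendental k g)
    {x : K} (hx : ∀ V, IsPlace k V → g ∉ V → x ∈ V) :
    x ∈ almostRegular k (fun R => g⁻¹ ∈ R.nonunits) := by
  have hint : IsIntegral (Subring.closure (Set.range (algebraMap k K) ∪ {g⁻¹} ∪
      {y | ∃ s : k[X], s.coeff 0 = 1 ∧ y = (aeval g⁻¹ s)⁻¹})) x := by
    apply isIntegral_closure_of_forall_valuationSubring
    intro V hV
    by_cases hT : V = ⊤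
    · rw [hT]; trivial
    have hVp : IsPlace k V := ⟨fun c => hV (Or.inl (Or.inl ⟨c, rfl⟩)), hT⟩
    by_contra hxV
    have hgV : g ∈ V := by
      by_contra h
      exact hxV (hx V hVp h)
    have hgi : g⁻¹ ∈ V := hV (Or.inl (Or.inr rfl))
    have hg0 : g ≠ 0 := by rintro rfl; exact hg isAlgebraic_zero
    obtain ⟨β, rfl⟩ := hVp.exists_geomPoint hK
    have hval : β.value g⁻¹ ≠ 0 := by
      rw [Ne, β.value_eq_zero_iff hgi, ValuationSubring.mem_nonunits_iff_or, inv_inv, not_or,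
        not_not]
      exact ⟨inv_ne_zero hg0, hgV⟩
    have halg : IsIntegral k (β.value g⁻¹) := Algebra.IsIntegral.isIntegral _
    have hc0 := minpoly.coeff_zero_ne_zero halg hval
    -- The minimal polynomial of the nonzero value of `g⁻¹`, scaled to constant term `1`: it gives
    -- an element vanishing at `β` whose inverse is regular there, a contradiction.
    set s : k[X] := C ((minpoly k (β.value g⁻¹)).coeff 0)⁻¹ * minpoly k (β.value g⁻¹)
    have hs : s.coeff 0 = 1 := by simp [s, hc0]
    have hs0 : s ≠ 0 := by rintro h; rw [h] at hs; simp at hs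
    have h1 : ∀ q : k[X], aeval g⁻¹ q ∈ β.localRing ∧
        β.value (aeval g⁻¹ q) = aeval (β.value g⁻¹) q := by
      intro q
      have hm : ∀ i ∈ Finset.range (q.natDegree + 1), q.coeff i • g⁻¹ ^ i ∈ β.localRing := by
        intro i _
        rw [Algebra.smul_def]
        exact β.localRing.mul_mem _ _ (β.algebraMap_mem _) (pow_mem hgi _)
      rw [aeval_eq_sum_range, aeval_eq_sum_range]
      refine ⟨sum_mem hm, ?_⟩
      rw [β.value_sum _ _ hm]
      refine Finset.sum_congr rfl fun i _ => ?_
      rw [Algebra.smul_def, Algebra.smul_def, β.value_mul (β.algebraMap_mem _) (pow_mem hgi _),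
        β.value_pow hgi, β.value_algebraMap]
    have h2 := (h1 s).2
    have h3 : aeval (β.value g⁻¹) s = 0 := by simp [s]
    rw [h3, β.value_eq_zero_iff (h1 s).1, ValuationSubring.mem_nonunits_iff_or] at h2
    rcases h2 with h2 | h2
    · exact (Transcendental.inv' hg) ⟨s, hs0, h2⟩
    · exact h2 (hV (Or.inr ⟨s, hs, rfl⟩))
  refine mem_almostRegular_of_isIntegral ?_ hint
  rw [Subring.closure_le]
  rintro z ((⟨c, rfl⟩ | rfl) | ⟨s, hs, rfl⟩)
  · exact algebraMap_mem_almostRegular c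
  · exact mem_almostRegular_of_forall fun R hC => R.nonunits_subset hC
  · exact inv_aeval_mem_almostRegular hs

end AlmostRegular

/-! ### Common monic denominators over `k[g]`. -/

section MonicDenominator

variable {k K : Type*} [Field k] [Field K] [Algebra k K]

/-- Each `y` is algebraic over `k[g]`, so it has a denominator there, and leading coefficients are
units of `k`. Monicity matters twice: `Q` can be divided out over the `v`-integers, and `Q(g)` does
not vanish close to a pole of `g`. -/
theorem exists_monic_isIntegral (hK : IsCurveField k K) {g : K} (hg : Transcendental k g)
    (s : Finset K) : ∃ Q : k[X], Q.Monic ∧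
      ∀ y ∈ s, IsIntegral (Algebra.adjoin k {g}) (aeval g Q * y) := by
  classical
  have halg := isAlgebraic_of_trdeg_eq_one hK.trdeg_eq_one hg
  have hpol : ∀ q : k[X], IsIntegral (Algebra.adjoin k {g}) (aeval g q) := fun q =>
    isIntegral_algebraMap (R := Algebra.adjoin k {g})
      (x := ⟨aeval g q, aeval_mem_adjoin_singleton k g⟩)
  induction s using Finset.induction_on with
  | empty => exact ⟨1, monic_one, by simp⟩
  | insert y s hys ih =>
    obtain ⟨Q, hQ, hQs⟩ := ih
    obtain ⟨r, hr0, hr⟩ := (halg.isAlgebraic y).exists_integral_multiple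
    obtain ⟨q, hq⟩ : ∃ q : k[X], aeval g q = (r : K) := by
      have h1 : ∀ z ∈ Algebra.adjoin k {g}, z ∈ (aeval g : k[X] →ₐ[k] K).range := by
        rw [Algebra.adjoin_singleton_eq_range_aeval]
        exact fun z hz => hz
      exact h1 r r.2
    have hq0 : q ≠ 0 := by
      rintro rfl
      rw [map_zero] at hq
      exact hr0 (Subtype.ext hq.symm)
    refine ⟨q * C q.leadingCoeff⁻¹ * Q, (monic_mul_leadingCoeff_inv hq0).mul hQ, ?_⟩
    intro x hx
    rw [map_mul, map_mul]
    rcases Finset.mem_insert.1 hx with rfl | hx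
    · have h2 : IsIntegral (Algebra.adjoin k {g}) (aeval g q * x) := by
        rw [hq]; exact hr
      have := ((hpol (C q.leadingCoeff⁻¹)).mul (hpol Q)).mul h2
      rwa [show aeval g q * aeval g (C q.leadingCoeff⁻¹) * aeval g Q * x =
        aeval g (C q.leadingCoeff⁻¹) * aeval g Q * (aeval g q * x) by ring]
    · have := ((hpol q).mul (hpol (C q.leadingCoeff⁻¹))).mul (hQs x hx)
      rwa [show aeval g q * aeval g (C q.leadingCoeff⁻¹) * aeval g Q * x =
        aeval g q * aeval g (C q.leadingCoeff⁻¹) * (aeval g Q * x) by ring]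

end MonicDenominator

end PolyFamily

namespace PolyFamily

/-! ### Specialization -/

section Specialize

variable {k K L : Type*} [Field k] [Field K] [Algebra k K] [Field L] {ι : k →+* L}
  {f : K[X]} {P : K}

namespace CurvePoint

theorem coeff_specialize (t : CurvePoint K ι) (i : ℕ) :
    (t.specialize f).coeff i = t.value (f.coeff i) := by
  rw [specialize, finsetSum_coeff]
  simp_rw [coeff_monomial]
  rw [Finset.sum_ite_eq' f.support i]
  split_ifs with h
  · rfl
  · rw [notMem_support_iff.1 h, value_zero]

theorem natDegree_specialize (t : CurvePoint K ι) (h : t.GoodReduction f) :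
    (t.specialize f).natDegree = f.natDegree := by
  refine natDegree_eq_of_le_of_coeff_ne_zero ?_ ?_
  · rw [natDegree_le_iff_coeff_eq_zero]
    intro n hn
    rw [coeff_specialize, coeff_eq_zero_of_natDegree_lt hn, value_zero]
  · rw [coeff_specialize]
    exact h.2

theorem leadingCoeff_specialize (t : CurvePoint K ι) (h : t.GoodReduction f) :
    (t.specialize f).leadingCoeff = t.value f.leadingCoeff := by
  rw [leadingCoeff, natDegree_specialize t h, coeff_specialize]
  rfl

theorem value_iter (t : CurvePoint K ι) (h : t.GoodReduction f) (hP : P ∈ t.localRing) (n : ℕ) :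
    t.value (iter f n P) = iter (t.specialize f) n (t.value P) := by
  induction n with
  | zero => rfl
  | succ n ih =>
    have hm := iter_mem t.localRing.toSubring h.1 hP n
    rw [iter_succ, iter_succ, ← ih, eval_eq_sum_range, eval_eq_sum_range,
      natDegree_specialize t h, t.value_sum]
    · refine Finset.sum_congr rfl fun i _ => ?_
      rw [t.value_mul (h.1 i) (pow_mem hm i), t.value_pow hm, coeff_specialize]
    · intro i _
      exact t.localRing.mul_mem _ _ (h.1 i) (pow_mem hm i)

theorem escapeData_specialize (t : CurvePoint K ι) (h : t.GoodReduction f) {c A : K} {b : ℕ → K}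
    (hd : EscapeData f c A b) (hc : t.value c ≠ 0) (hA : A ∈ t.localRing)
    (hb : ∀ j < f.natDegree, b j ∈ t.localRing) :
    EscapeData (t.specialize f) (t.value c) (t.value A) (fun j => t.value (b j)) where
  ne_zero := hc
  leading := by
    have hl := t.mem_of_value_ne_zero h.2
    have hcm := t.mem_of_value_ne_zero hc
    rw [leadingCoeff_specialize t h, natDegree_specialize t h, ← t.value_mul hA hl,
      ← t.value_pow hcm, ← t.value_mul (t.localRing.mul_mem _ _ hA hl) (pow_mem hcm _),
      hd.leading, value_one]
  coeff j hj := by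
    rw [natDegree_specialize t h] at hj ⊢
    have hl := t.mem_of_value_ne_zero h.2
    have hcm := t.mem_of_value_ne_zero hc
    rw [leadingCoeff_specialize t h, coeff_specialize, ← t.value_pow hcm,
      ← t.value_mul hl (pow_mem hcm _),
      ← t.value_mul (hb j hj) (t.localRing.mul_mem _ _ hl (pow_mem hcm _)), hd.coeff j hj]

end CurvePoint

end Specialize

/-! ### The composite valuation ring of a rational point and a finite place. -/

section PointRing

variable {k K : Type*} [Field k] [NumberField k] [Field K] [Algebra k K]

/-- The functions that are regular at the rational point `t`, with a `v`-integral value there. -/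
def RatPoint.integerRing (t : RatPoint k K) (v : FinitePlace k) : ValuationSubring K where
  carrier := {x | x ∈ t.localRing ∧ v (t.value x) ≤ 1}
  mul_mem' {x y} hx hy := by
    rw [Set.mem_ofPred_eq] at hx hy ⊢
    refine ⟨t.localRing.mul_mem _ _ hx.1 hy.1, ?_⟩
    rw [t.value_mul hx.1 hy.1]
    exact (finiteRing v).mul_mem _ _ hx.2 hy.2
  one_mem' := by
    rw [Set.mem_ofPred_eq, t.value_one, map_one]
    exact ⟨t.localRing.one_mem, le_rfl⟩
  add_mem' {x y} hx hy := by
    rw [Set.mem_ofPred_eq] at hx hy ⊢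
    refine ⟨t.localRing.add_mem _ _ hx.1 hy.1, ?_⟩
    rw [t.value_add hx.1 hy.1]
    exact (finiteRing v).add_mem _ _ hx.2 hy.2
  zero_mem' := by
    rw [Set.mem_ofPred_eq, t.value_zero]
    exact ⟨t.localRing.zero_mem, (finiteRing v).zero_mem⟩
  neg_mem' {x} hx := by
    rw [Set.mem_ofPred_eq] at hx ⊢
    rw [t.value_neg]
    exact ⟨t.localRing.neg_mem _ hx.1, (finiteRing v).neg_mem _ hx.2⟩
  mem_or_inv_mem' x := by
    change (x ∈ t.localRing ∧ v (t.value x) ≤ 1) ∨ (x⁻¹ ∈ t.localRing ∧ v (t.value x⁻¹) ≤ 1)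
    by_cases hx : x ∈ t.localRing
    · rcases le_or_gt (v (t.value x)) 1 with h | h
      · exact Or.inl ⟨hx, h⟩
      · have h0 : t.value x ≠ 0 := by
          intro h0
          rw [h0, map_zero] at h
          linarith
        refine Or.inr ⟨t.inv_mem_of_value_ne_zero h0, ?_⟩
        rw [t.value_inv h0, map_inv₀]
        exact inv_le_one_of_one_le₀ h.le
    · have h1 := inv_mem_of_notMem _ hx
      refine Or.inr ⟨h1, ?_⟩
      rw [(t.value_eq_zero_iff h1).2 (inv_mem_nonunits_of_notMem _ hx), map_zero]
      exact zero_le_one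

theorem RatPoint.integerRing_liesOver (t : RatPoint k K) (v : FinitePlace k) :
    LiesOver v (t.integerRing v) := fun c hc =>
  ⟨t.algebraMap_mem c, by rw [t.value_algebraMap]; exact hc⟩

theorem RatPoint.mem_nonunits_integerRing {t : RatPoint k K} {v : FinitePlace k} {x : K} :
    x ∈ (t.integerRing v).nonunits ↔ x ∈ t.localRing ∧ v (t.value x) < 1 := by
  rw [ValuationSubring.mem_nonunits_iff_or]
  constructor
  · rintro (rfl | h)
    · rw [t.value_zero, map_zero]
      exact ⟨t.localRing.zero_mem, zero_lt_one⟩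
    · have hx : x ∈ t.integerRing v := by simpa using inv_mem_of_notMem _ h
      refine ⟨hx.1, lt_of_le_of_ne hx.2 fun h1 => h ?_⟩
      have h0 : t.value x ≠ 0 := by
        intro h0
        rw [h0, map_zero] at h1
        exact zero_ne_one h1
      refine ⟨t.inv_mem_of_value_ne_zero h0, ?_⟩
      rw [t.value_inv h0, map_inv₀, h1, inv_one]
  · rintro ⟨hx, h⟩
    by_cases h0 : x = 0
    · exact Or.inl h0
    · refine Or.inr fun h1 => ?_
      have h2 := t.value_mul hx h1.1
      rw [mul_inv_cancel₀ h0, t.value_one] at h2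
      have h3 := congrArg v h2
      rw [map_one, map_mul] at h3
      have : v (t.value x) * v (t.value x⁻¹) < 1 :=
        mul_lt_one_of_nonneg_of_lt_one_left (apply_nonneg v _) h h1.2
      linarith

end PointRing

/-! ### Functions describing the escape near the support of `D(f, P)` -/

section Datum

variable {k K : Type*} [Field k] [Field K] [Algebra k K] {f : K[X]} {P : K}

/-- Functions which describe the escape of the orbit of `P` near the support of `D(f, P)`. The
function `g` has poles there of the order prescribed by the height datum `(M, g)`. -/
structure EscapeFunctions (k : Type*) {K : Type*} [Field k] [Field K] [Algebra k K] (f : K[X])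
    (P : K) (M : ℕ) (g : K) where
  N : ℕ
  e : ℕ
  A : K
  b : ℕ → K
  Y : K
  u : K
  le : M ≤ N
  data : EscapeData f (g ^ e) A b
  iter_mul : iter f N P * Y = g ^ e
  u_eq : u = g ^ f.natDegree ^ (N - M) * A * Y ^ (f.natDegree - 1)
  A_mem : ∀ V ∈ supportPlaces k f P, A ∈ V.nonunits
  b_mem : ∀ V ∈ supportPlaces k f P, ∀ j < f.natDegree, b j ∈ V.nonunits
  Y_mem : ∀ V ∈ supportPlaces k f P, Y ∈ V.nonunits
  u_mem : ∀ V ∈ supportPlaces k f P, u ∈ V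
  u_inv_mem : ∀ V ∈ supportPlaces k f P, u⁻¹ ∈ V

variable [CharZero k] (hK : IsCurveField k K) (hd : 2 ≤ f.natDegree) {M : ℕ} {g : K}

theorem IsHeightDatum.posLog_eq (hK : IsCurveField k K) (hg : IsHeightDatum k f P M g)
    {V : ValuationSubring K} (hV : IsPlace k V) :
    Real.posLog (placeAbv V g) =
      (f.natDegree : ℝ) ^ M * ((f.natDegree : ℝ) - 1) * placeCoeff f P V := by
  obtain ⟨β, rfl⟩ := hV.exists_geomPoint hK
  rw [← β.poleOrder_eq_posLog (hV.isPlaceAbv hK), hg β, divisorCoeff_eq_placeCoeff hK]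

theorem IsHeightDatum.notMem_iff (hK : IsCurveField k K) (hd : 2 ≤ f.natDegree)
    (hg : IsHeightDatum k f P M g) {V : ValuationSubring K} (hV : IsPlace k V) :
    g ∉ V ↔ V ∈ supportPlaces k f P := by
  have h1 := hg.posLog_eq hK hV
  have hd1 : (1 : ℝ) < f.natDegree := by exact_mod_cast (by omega : 1 < f.natDegree)
  have h2 : (f.natDegree : ℝ) ^ M * ((f.natDegree : ℝ) - 1) ≠ 0 :=
    (mul_pos (by positivity) (by linarith)).ne'
  rw [← (hV.isPlaceAbv hK).le_one_iff, ← abs_of_nonneg (AbsoluteValue.nonneg (placeAbv V) g),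
    ← Real.posLog_eq_zero_iff, h1]
  simp only [mul_eq_zero, h2, false_or]
  exact ⟨fun h => ⟨hV, h⟩, fun h => h.2⟩

theorem IsHeightDatum.log_eq (hK : IsCurveField k K) (hd : 2 ≤ f.natDegree)
    (hg : IsHeightDatum k f P M g) {V : ValuationSubring K} (hV : V ∈ supportPlaces k f P) :
    1 < placeAbv V g ∧ Real.log (placeAbv V g) =
      (f.natDegree : ℝ) ^ M * ((f.natDegree : ℝ) - 1) * placeCoeff f P V := by
  have h1 : 1 < placeAbv V g := by
    rw [← not_le, (hV.1.isPlaceAbv hK).le_one_iff]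
    exact (hg.notMem_iff hK hd hV.1).2 hV
  refine ⟨h1, ?_⟩
  rw [← hg.posLog_eq hK hV.1, Real.posLog_eq_log]
  rw [abs_of_nonneg (AbsoluteValue.nonneg _ _)]
  exact h1.le

theorem IsHeightDatum.transcendental (hK : IsCurveField k K) (hd : 2 ≤ f.natDegree)
    (hg : IsHeightDatum k f P M g) (hD : (divisorSupport k f P).Nonempty) :
    Transcendental k g := by
  obtain ⟨β, hβ⟩ := hD
  rw [mem_divisorSupport_iff hK] at hβ
  exact hβ.1.transcendental_of_notMem ((hg.notMem_iff hK hd hβ.1).2 hβ)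

/-- For `c = g ^ e` with `e` large, `A` and all `b j` vanish on the support, and for large `N` the
orbit of `P` exceeds `c` there. That `u` is a unit on the support follows from two computations of
the same multiplicity: one from `iter f N P` through `EscapeData.placeCoeff_of_escape`, the other
from `g` through the height datum. -/
theorem IsHeightDatum.exists_escapeFunctions (hK : IsCurveField k K) (hd : 2 ≤ f.natDegree)
    (hg : IsHeightDatum k f P M g) (hD : (divisorSupport k f P).Nonempty) :
    Nonempty (EscapeFunctions k f P M g) := by
  have hfin := finite_supportPlaces hK hd (P := P)
  have hf : f ≠ 0 := by rintro rfl; simp at hd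
  have hg0 : g ≠ 0 := by
    rintro rfl
    exact hg.transcendental hK hd hD isAlgebraic_zero
  have hd1 : (1 : ℝ) < f.natDegree := by exact_mod_cast (by omega : 1 < f.natDegree)
  have hl0 : f.leadingCoeff ≠ 0 := leadingCoeff_ne_zero.2 hf
  have hpow : ∀ V ∈ supportPlaces k f P, Tendsto (fun e : ℕ => placeAbv V g ^ e) atTop atTop :=
    fun V hV => tendsto_pow_atTop_atTop_of_one_lt (hg.log_eq hK hd hV).1
  have hle : ∀ V ∈ supportPlaces k f P, ∀ e n : ℕ, n ≠ 0 →
      placeAbv V g ^ e ≤ (placeAbv V g ^ e) ^ n := fun V hV e n hn =>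
    le_self_pow₀ (one_le_pow₀ (hg.log_eq hK hd hV).1.le) hn
  have he : ∀ V ∈ supportPlaces k f P, ∀ᶠ e : ℕ in atTop,
      placeAbv V (f.leadingCoeff * (g ^ e) ^ (f.natDegree - 1))⁻¹ < 1 ∧
      ∀ j ∈ Finset.range f.natDegree,
        placeAbv V (f.coeff j * (f.leadingCoeff * (g ^ e) ^ (f.natDegree - j))⁻¹) < 1 := by
    intro V hV
    have hl : 0 < placeAbv V f.leadingCoeff := AbsoluteValue.pos _ hl0
    refine Eventually.and ?_ ?_
    · filter_upwards [(hpow V hV).eventually_gt_atTop (placeAbv V f.leadingCoeff)⁻¹] with e h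
      rw [map_inv₀, map_mul, map_pow, map_pow]
      refine inv_lt_one_of_one_lt₀ ?_
      rw [← inv_mul_lt_iff₀ hl, mul_one]
      exact h.trans_le (hle V hV e _ (by omega))
    · rw [Filter.eventually_all_finset]
      intro j hj
      have hj' := Finset.mem_range.1 hj
      filter_upwards [(hpow V hV).eventually_gt_atTop
        (placeAbv V (f.coeff j) * (placeAbv V f.leadingCoeff)⁻¹)] with e h
      rw [map_mul, map_inv₀, map_mul, map_pow, map_pow, mul_inv, ← mul_assoc]
      have h2 := h.trans_le (hle V hV e (f.natDegree - j) (by omega))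
      rw [← div_eq_mul_inv, div_lt_one (lt_of_le_of_lt (by positivity) h2)]
      exact h2
  obtain ⟨e, he⟩ := ((hfin.eventually_all).2 he).exists
  have hdata := escapeData_of_ne_zero hf (pow_ne_zero e hg0)
  set A := (f.leadingCoeff * (g ^ e) ^ (f.natDegree - 1))⁻¹
  set b : ℕ → K := fun j => f.coeff j * (f.leadingCoeff * (g ^ e) ^ (f.natDegree - j))⁻¹
  have hA : ∀ V ∈ supportPlaces k f P, placeAbv V A < 1 := fun V hV => (he V hV).1
  have hb : ∀ V ∈ supportPlaces k f P, ∀ j < f.natDegree, placeAbv V (b j) < 1 :=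
    fun V hV j hj => (he V hV).2 j (Finset.mem_range.2 hj)
  have hN : ∀ V ∈ supportPlaces k f P, ∀ᶠ N : ℕ in atTop,
      placeAbv V (g ^ e) < placeAbv V (iter f N P) := by
    intro V hV
    obtain ⟨N₀, hN₀⟩ := EscapeData.exists_escape (c := g ^ e) hd hV.2
    filter_upwards [eventually_ge_atTop N₀] with N hN
    exact hdata.escape_of_le hd (hV.1.isPlaceAbv hK) (hA V hV).le
      (fun j hj => (hb V hV j hj).le) hN₀ hN
  obtain ⟨N, hN, hMN⟩ := (((hfin.eventually_all).2 hN).and (eventually_ge_atTop M)).exists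
  obtain ⟨β, hβ⟩ := hD
  rw [mem_divisorSupport_iff hK] at hβ
  have hz0 : iter f N P ≠ 0 := by
    intro h0
    have := hN _ hβ
    rw [h0, map_zero] at this
    exact absurd this (not_lt.2 (AbsoluteValue.nonneg _ _))
  have hiter : iter f N P * (g ^ e / iter f N P) = g ^ e := by field_simp
  have hu : ∀ V ∈ supportPlaces k f P, placeAbv V
      (g ^ f.natDegree ^ (N - M) * A * (g ^ e / iter f N P) ^ (f.natDegree - 1)) = 1 := by
    intro V hV
    have h1 := (hdata.placeCoeff_of_escape hd rfl (hV.1.isPlaceAbv hK) (hA V hV).le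
      (fun j hj => (hb V hV j hj).le) (hN V hV)).1
    have h2 := (hg.log_eq hK hd hV).2
    -- So `u` is the quotient of `g ^ d ^ (N - M)` by `f.leadingCoeff * iter f N P ^ (d - 1)`, two
    -- functions with the same pole order at `V`.
    have h3 : g ^ f.natDegree ^ (N - M) * A * (g ^ e / iter f N P) ^ (f.natDegree - 1) *
        (f.leadingCoeff * iter f N P ^ (f.natDegree - 1)) = g ^ f.natDegree ^ (N - M) := by
      have hc : (g ^ e / iter f N P) ^ (f.natDegree - 1) * iter f N P ^ (f.natDegree - 1) =
          (g ^ e) ^ (f.natDegree - 1) := by rw [← mul_pow, mul_comm, hiter]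
      calc _ = g ^ f.natDegree ^ (N - M) * (A * f.leadingCoeff *
            ((g ^ e / iter f N P) ^ (f.natDegree - 1) * iter f N P ^ (f.natDegree - 1))) := by ring
        _ = _ := by rw [hc, hdata.leading, mul_one]
    have hlz : f.leadingCoeff * iter f N P ^ (f.natDegree - 1) ≠ 0 :=
      mul_ne_zero hl0 (pow_ne_zero _ hz0)
    have h4 : Real.log (placeAbv V (f.leadingCoeff * iter f N P ^ (f.natDegree - 1))) =
        Real.log (placeAbv V (g ^ f.natDegree ^ (N - M))) := by
      rw [← h1, map_pow, Real.log_pow, h2]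
      push_cast
      rw [← mul_assoc, ← mul_assoc, ← pow_add, Nat.sub_add_cancel hMN]
    have h5 := Real.log_injOn_pos (Set.mem_Ioi.2 (AbsoluteValue.pos _ hlz))
      (Set.mem_Ioi.2 (AbsoluteValue.pos _ (pow_ne_zero _ hg0))) h4
    have h6 := congrArg (placeAbv V) h3
    rw [map_mul, h5] at h6
    exact mul_eq_right₀ (AbsoluteValue.pos _ (pow_ne_zero _ hg0)).ne' |>.1 h6
  refine ⟨⟨N, e, A, b, g ^ e / iter f N P, _, hMN, hdata, hiter, rfl, ?_, ?_, ?_, ?_, ?_⟩⟩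
  · intro V hV
    exact ((hV.1.isPlaceAbv hK).lt_one_iff _).1 (hA V hV)
  · intro V hV j hj
    exact ((hV.1.isPlaceAbv hK).lt_one_iff _).1 (hb V hV j hj)
  · intro V hV
    rw [← (hV.1.isPlaceAbv hK).lt_one_iff, map_div₀, div_lt_one (AbsoluteValue.pos _ hz0)]
    exact hN V hV
  · intro V hV
    exact ((hV.1.isPlaceAbv hK).le_one_iff _).1 (hu V hV).le
  · intro V hV
    rw [← (hV.1.isPlaceAbv hK).le_one_iff, map_inv₀, hu V hV, inv_one]

end Datum

end PolyFamily

namespace PolyFamily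

/-! ### The local height in terms of `g`, `u` and the error series. -/

section LocalHeight

variable {k K : Type*} [Field k] [Field K] [Algebra k K] {f : K[X]} {P : K} {M : ℕ} {g : K}

/-- The limit of `EscapeData.tendsto`, started at the `N`-th iterate and divided by `d ^ N`.
Expressing `log |Y|` and `log |A|` through `u` isolates `log |g(t)|` with the weight it has in
`h_D`. -/
theorem EscapeFunctions.tendsto (E : EscapeFunctions k f P M g) (hd : 2 ≤ f.natDegree)
    {t : RatPoint k K} (ht : t.GoodReduction f) (hP : P ∈ t.localRing) (hg : t.value g ≠ 0)
    (hA : E.A ∈ t.localRing) (hb : ∀ j < f.natDegree, E.b j ∈ t.localRing)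
    (hY : E.Y ∈ t.localRing) (a : AbsoluteValue k ℝ)
    (hne : ∀ n, 1 + escapeError f.natDegree (fun j => t.value (E.b j))
      (escapeSeq f.natDegree (t.value E.A) (fun j => t.value (E.b j)) (t.value E.Y) n) ≠ 0)
    {B : ℝ} (hB : ∀ n, |Real.log (a (1 + escapeError f.natDegree (fun j => t.value (E.b j))
      (escapeSeq f.natDegree (t.value E.A) (fun j => t.value (E.b j)) (t.value E.Y) n)))| ≤ B)
    (hY1 : ∀ n, a (escapeSeq f.natDegree (t.value E.A) (fun j => t.value (E.b j))
      (t.value E.Y) n) ≤ 1) :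
    t.value E.u ≠ 0 ∧
    Tendsto (fun n => Real.posLog (a (iter (t.specialize f) n (t.value P))) /
      ((t.specialize f).natDegree : ℝ) ^ n) atTop
      (𝓝 (Real.log (a (t.value g)) / ((f.natDegree : ℝ) ^ M * ((f.natDegree : ℝ) - 1)) +
        (-(Real.log (a (t.value E.u)) / ((f.natDegree : ℝ) ^ E.N * ((f.natDegree : ℝ) - 1))) +
        (∑' n, Real.log (a (1 + escapeError f.natDegree (fun j => t.value (E.b j))
          (escapeSeq f.natDegree (t.value E.A) (fun j => t.value (E.b j)) (t.value E.Y) n))) /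
          (f.natDegree : ℝ) ^ (n + 1)) / (f.natDegree : ℝ) ^ E.N))) := by
  have hgm := t.mem_of_value_ne_zero hg
  have hc : t.value (g ^ E.e) ≠ 0 := by rw [t.value_pow hgm]; exact pow_ne_zero _ hg
  have hdata := t.escapeData_specialize ht E.data hc hA hb
  have hdeg := t.natDegree_specialize ht
  have hiter : iter (t.specialize f) E.N (t.value P) * t.value E.Y = t.value (g ^ E.e) := by
    rw [← t.value_iter ht hP, ← t.value_mul (iter_mem t.localRing.toSubring ht.1 hP _) hY,
      E.iter_mul]
  have hA0 : t.value E.A ≠ 0 := by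
    intro h0
    have := hdata.leading
    rw [h0] at this
    simp at this
  have hY0 : t.value E.Y ≠ 0 := by
    intro h0
    rw [h0, mul_zero] at hiter
    exact hc hiter.symm
  have hu : t.value E.u = t.value g ^ f.natDegree ^ (E.N - M) * t.value E.A *
      t.value E.Y ^ (f.natDegree - 1) := by
    rw [E.u_eq, t.value_mul (t.localRing.mul_mem _ _ (pow_mem hgm _) hA) (pow_mem hY _),
      t.value_mul (pow_mem hgm _) hA, t.value_pow hgm, t.value_pow hY]
  have hu0 : t.value E.u ≠ 0 := by
    rw [hu]
    exact mul_ne_zero (mul_ne_zero (pow_ne_zero _ hg) hA0) (pow_ne_zero _ hY0)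
  refine ⟨hu0, ?_⟩
  have h1 := hdata.tendsto (by rw [hdeg]; exact hd) a hiter (B := B) (by rwa [hdeg])
    (by rwa [hdeg]) (by rwa [hdeg])
  simp_rw [← iter_add] at h1
  have h2 := tendsto_shift (u := fun n => Real.posLog (a (iter (t.specialize f) n (t.value P))))
    E.N h1
  rw [hdeg] at h2 ⊢
  refine h2.trans_eq ?_
  congr 1
  have hcast : ((f.natDegree - 1 : ℕ) : ℝ) = (f.natDegree : ℝ) - 1 := by
    rw [Nat.cast_sub (by omega)]; simp
  have hlu : Real.log (a (t.value E.u)) = (f.natDegree : ℝ) ^ (E.N - M) *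
      Real.log (a (t.value g)) + Real.log (a (t.value E.A)) +
      ((f.natDegree : ℝ) - 1) * Real.log (a (t.value E.Y)) := by
    rw [hu, map_mul, map_mul, map_pow, map_pow, Real.log_mul, Real.log_mul, Real.log_pow,
      Real.log_pow, hcast, Nat.cast_pow]
    · exact pow_ne_zero _ (a.pos hg).ne'
    · exact (a.pos hA0).ne'
    · exact mul_ne_zero (pow_ne_zero _ (a.pos hg).ne') (a.pos hA0).ne'
    · exact pow_ne_zero _ (a.pos hY0).ne'
  have hd1 : (1 : ℝ) < f.natDegree := by exact_mod_cast (by omega : 1 < f.natDegree)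
  have hd2 : (f.natDegree : ℝ) - 1 ≠ 0 := by linarith
  have hNM : (f.natDegree : ℝ) ^ E.N =
      (f.natDegree : ℝ) ^ (E.N - M) * (f.natDegree : ℝ) ^ M := by
    rw [← pow_add, Nat.sub_add_cancel E.le]
  rw [hlu, add_div, ← add_assoc]
  congr 1
  rw [hNM]
  have hd0 : (f.natDegree : ℝ) ≠ 0 := by linarith
  field_simp
  ring

end LocalHeight

/-! ### No deviation at almost all finite places. -/

section GoodPlaces

variable {k K : Type*} [Field k] [NumberField k] [Field K] [Algebra k K] {f : K[X]} {P : K}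
  {M : ℕ} {g : K}

/-- A place where `g` is regular lies off the support, so there the orbit never exceeds the constant
`c` of any admissible normal form. The choice `c = (Q(g) ^ 2)⁻¹` is admissible: in each `b j` one
factor `Q(g)` clears the coefficient of `f` and the other the inverse of the leading coefficient.
The denominator is the same for all `n`. -/
theorem isIntegral_mul_iter (hK : IsCurveField k K) (hd : 2 ≤ f.natDegree)
    (hg : IsHeightDatum k f P M g) {Q : k[X]} (hQ0 : aeval g Q ≠ 0)
    (hQ : ∀ i, IsIntegral (Algebra.adjoin k {g}) (aeval g Q * f.coeff i))
    (hQl : IsIntegral (Algebra.adjoin k {g}) (aeval g Q * f.leadingCoeff⁻¹)) (n : ℕ) :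
    IsIntegral (Algebra.adjoin k {g}) (aeval g Q ^ 2 * iter f n P) := by
  apply isIntegral_adjoin_of_forall_place
  intro V hV hgV
  have hf : f ≠ 0 := by rintro rfl; simp at hd
  have ha := hV.isPlaceAbv hK
  have hl0 : f.leadingCoeff ≠ 0 := leadingCoeff_ne_zero.2 hf
  have hQV : aeval g Q ∈ V := hV.mem_of_isIntegral_adjoin hgV
    (isIntegral_algebraMap (R := Algebra.adjoin k {g})
      (x := ⟨aeval g Q, aeval_mem_adjoin_singleton k g⟩))
  have hQlV := hV.mem_of_isIntegral_adjoin hgV hQl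
  have h0 : placeCoeff f P V = 0 := by
    by_contra h
    exact (hg.notMem_iff hK hd hV).2 ⟨hV, h⟩ hgV
  have hc0 : (aeval g Q ^ 2)⁻¹ ≠ 0 := inv_ne_zero (pow_ne_zero _ hQ0)
  have h1 := (escapeData_of_ne_zero hf hc0).abv_iter_le_of_placeCoeff_eq_zero hd ha
    (by
      rw [ha.le_one_iff]
      have : (f.leadingCoeff * ((aeval g Q ^ 2)⁻¹) ^ (f.natDegree - 1))⁻¹ =
          (aeval g Q * f.leadingCoeff⁻¹) * (aeval g Q * (aeval g Q ^ 2) ^ (f.natDegree - 2)) := by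
        rw [mul_inv, inv_pow, inv_inv, show f.natDegree - 1 = f.natDegree - 2 + 1 by omega,
          pow_succ]
        ring
      rw [this]
      exact V.mul_mem _ _ hQlV (V.mul_mem _ _ hQV (pow_mem (pow_mem hQV _) _)))
    (by
      intro j hj
      rw [ha.le_one_iff]
      have : f.coeff j * (f.leadingCoeff * ((aeval g Q ^ 2)⁻¹) ^ (f.natDegree - j))⁻¹ =
          (aeval g Q * f.coeff j) * ((aeval g Q * f.leadingCoeff⁻¹) *
            (aeval g Q ^ 2) ^ (f.natDegree - j - 1)) := by
        rw [mul_inv, inv_pow, inv_inv]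
        conv_lhs => rw [show f.natDegree - j = f.natDegree - j - 1 + 1 by omega, pow_succ]
        ring
      rw [this]
      exact V.mul_mem _ _ (hV.mem_of_isIntegral_adjoin hgV (hQ j))
        (V.mul_mem _ _ hQlV (pow_mem (pow_mem hQV _) _))) h0 n
  rw [← ha.le_one_iff, map_mul]
  rw [map_inv₀] at h1
  have hpos : 0 < placeAbv V (aeval g Q ^ 2) := AbsoluteValue.pos _ (pow_ne_zero _ hQ0)
  calc _ ≤ placeAbv V (aeval g Q ^ 2) * (placeAbv V (aeval g Q ^ 2))⁻¹ := by gcongr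
    _ = 1 := mul_inv_cancel₀ hpos.ne'

/-- Applying `f` replaces the exponent `m` of the denominator by `1 + m * d`. This growth is
harmless, since `mem_of_forall_monic_mul_mem` is insensitive to the power of the monic denominator.
-/
theorem exists_pow_mul_iter_mem {R : Subring K} {q : K} (hq : q ∈ R)
    (hf : ∀ i, q * f.coeff i ∈ R) (hP : q * P ∈ R) (n : ℕ) : ∃ m, q ^ m * iter f n P ∈ R := by
  induction n with
  | zero => exact ⟨1, by rwa [pow_one]⟩
  | succ n ih =>
    obtain ⟨m, hm⟩ := ih
    refine ⟨1 + m * f.natDegree, ?_⟩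
    rw [iter_succ, eval_eq_sum_range, Finset.mul_sum]
    refine sum_mem fun i hi => ?_
    have hi' : i ≤ f.natDegree := by have := Finset.mem_range.1 hi; omega
    have : q ^ (1 + m * f.natDegree) * (f.coeff i * iter f n P ^ i) =
        (q * f.coeff i) * (q ^ m * iter f n P) ^ i * q ^ (m * (f.natDegree - i)) := by
      obtain ⟨j, hj⟩ := Nat.exists_eq_add_of_le hi'
      rw [hj, Nat.add_sub_cancel_left]
      ring
    rw [this]
    exact mul_mem (mul_mem (hf i) (pow_mem hm i)) (pow_mem hq _)

/-- The exceptional places depend only on `Q`, `P` and the coefficients of `f`, not on `n`. Above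
all other `v` a power of `Q(g)` growing with `n` clears denominators, over `k` the square suffices,
and the Gauss lemma shows that the square suffices above `v` as well. -/
theorem eventually_forall_mul_iter_mem (hK : IsCurveField k K) (hd : 2 ≤ f.natDegree)
    (hg : IsHeightDatum k f P M g) (hgt : Transcendental k g) {Q : k[X]} (hQm : Q.Monic)
    (hQ : ∀ i, IsIntegral (Algebra.adjoin k {g}) (aeval g Q * f.coeff i))
    (hQl : IsIntegral (Algebra.adjoin k {g}) (aeval g Q * f.leadingCoeff⁻¹))
    (hQP : IsIntegral (Algebra.adjoin k {g}) (aeval g Q * P)) :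
    ∀ᶠ v : FinitePlace k in cofinite, ∀ R : ValuationSubring K, LiesOver v R → g ∈ R →
      ∀ n, aeval g Q ^ 2 * iter f n P ∈ R := by
  have hQ0 : aeval g Q ≠ 0 := fun h => hgt ⟨Q, hQm.ne_zero, h⟩
  have h1 : ∀ᶠ v : FinitePlace k in cofinite, ∀ i ∈ Finset.range (f.natDegree + 1),
      ∀ R : ValuationSubring K, LiesOver v R → g ∈ R → aeval g Q * f.coeff i ∈ R := by
    rw [Filter.eventually_all_finset]
    exact fun i _ => mem_almostRegular.1 (mem_almostRegular_of_isIntegral_adjoin (hQ i))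
  filter_upwards [h1, mem_almostRegular.1 (mem_almostRegular_of_isIntegral_adjoin hQP),
    eventually_coeff_mem Q] with v hf hP hQv R hR hgR n
  have hQR : ∀ R : ValuationSubring K, LiesOver v R → g ∈ R → aeval g Q ∈ R :=
    fun R hR hgR => aeval_mem_of_coeff_mem hR hgR hQv
  obtain ⟨m, hm⟩ : ∃ m, ∀ R : ValuationSubring K, LiesOver v R → g ∈ R →
      aeval g Q ^ m * iter f n P ∈ R := by
    have hinf : ∀ x : K, x ∈ (⨅ R : {R : ValuationSubring K // LiesOver v R ∧ g ∈ R},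
        R.1.toSubring) ↔ ∀ R : ValuationSubring K, LiesOver v R → g ∈ R → x ∈ R := by
      intro x
      rw [Subring.mem_iInf]
      exact ⟨fun h R h1 h2 => h ⟨R, h1, h2⟩, fun h R => h R.1 R.2.1 R.2.2⟩
    obtain ⟨m, hm⟩ := exists_pow_mul_iter_mem (f := f) (P := P) ((hinf (aeval g Q)).2 hQR)
      (fun i => (hinf _).2 fun R hR hgR => by
        by_cases hi : i < f.natDegree + 1
        · exact hf i (Finset.mem_range.2 hi) R hR hgR
        · rw [coeff_eq_zero_of_natDegree_lt (by omega), mul_zero]; exact R.zero_mem)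
      ((hinf _).2 hP) n
    exact ⟨m, (hinf _).1 hm⟩
  refine mem_of_forall_monic_mul_mem hgt (finiteRing v) (hQm.pow m) ?_
    (isIntegral_mul_iter hK hd hg hQ0 hQ hQl n) ?_ hR hgR
  · intro i
    have hlift : Q ∈ Polynomial.lifts (finiteRing v).subtype := by
      rw [Polynomial.lifts_iff_coeff_lifts]
      exact fun n => ⟨⟨_, hQv n⟩, rfl⟩
    have h2 := pow_mem hlift m
    rw [Polynomial.lifts_iff_coeff_lifts] at h2
    obtain ⟨y, hy⟩ := h2 i
    rw [← hy]
    exact y.2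
  · intro R hR hgR
    have := R.mul_mem _ _ (pow_mem (hQR R hR hgR) 2) (hm R hR hgR)
    rw [map_pow]
    convert this using 1
    ring

theorem FinitePlace.isNonarchimedean (v : FinitePlace k) : IsNonarchimedean v.1 := v.add_le

/-- If `|g(t)|_v ≤ 1`, the orbit of `P_t` is bounded by `|Q(g(t))|_v ^ (-2)` and both sides vanish.
If `|g(t)|_v > 1`, the normal form specializes to a `v`-integral one with `|u(t)|_v = 1`, and the
nonarchimedean limit has no correction term. The point `t` need not be `v`-adically close to the
support. -/
theorem IsHeightDatum.eventually_localCanonicalHeight_eq (hK : IsCurveField k K)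
    (hd : 2 ≤ f.natDegree) (hg : IsHeightDatum k f P M g)
    (hD : (divisorSupport k f P).Nonempty) (E : EscapeFunctions k f P M g) :
    ∃ Q : k[X], Q.Monic ∧
      (∀ i, IsIntegral (Algebra.adjoin k {g}) (aeval g Q * f.coeff i)) ∧
      IsIntegral (Algebra.adjoin k {g}) (aeval g Q * f.leadingCoeff⁻¹) ∧
      IsIntegral (Algebra.adjoin k {g}) (aeval g Q * P) ∧
      ∀ᶠ v : FinitePlace k in cofinite, ∀ t : RatPoint k K,
        (g⁻¹ ∈ (t.integerRing v).nonunits → v (t.value E.u) = 1) ∧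
        (t.GoodReduction f → P ∈ t.localRing → g ∈ t.localRing → t.value (aeval g Q) ≠ 0 →
          localCanonicalHeight (.inr v) (t.specialize f) (t.value P) =
            Real.posLog (v (t.value g)) /
              ((f.natDegree : ℝ) ^ M * ((f.natDegree : ℝ) - 1))) := by
  classical
  have hgt := hg.transcendental hK hd hD
  have hg0 : g ≠ 0 := by rintro rfl; exact hgt isAlgebraic_zero
  obtain ⟨Q, hQm, hQs⟩ := exists_monic_isIntegral hK hgt
    ((Finset.range (f.natDegree + 1)).image f.coeff ∪ {f.leadingCoeff⁻¹, P})
  have hQ : ∀ i, IsIntegral (Algebra.adjoin k {g}) (aeval g Q * f.coeff i) := by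
    intro i
    by_cases hi : i < f.natDegree + 1
    · exact hQs _ (Finset.mem_union_left _ (Finset.mem_image_of_mem _ (Finset.mem_range.2 hi)))
    · rw [coeff_eq_zero_of_natDegree_lt (by omega), mul_zero]; exact isIntegral_zero
  have hQl := hQs f.leadingCoeff⁻¹ (by simp)
  have hQP := hQs P (by simp)
  refine ⟨Q, hQm, hQ, hQl, hQP, ?_⟩
  have hpole : ∀ x : K, (∀ V ∈ supportPlaces k f P, x ∈ V) →
      ∀ᶠ v : FinitePlace k in cofinite, ∀ R : ValuationSubring K, LiesOver v R →
        g⁻¹ ∈ R.nonunits → x ∈ R := fun x hx =>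
    mem_almostRegular.1 (mem_almostRegular_of_forall_pole hK hgt
      fun V hV hgV => hx V ((hg.notMem_iff hK hd hV).1 hgV))
  -- Integrality of `Y` alone would give only `|Y(t)|_v ≤ 1`. Integrality of `Y ^ m * g` forces the
  -- strict inequality wherever `|g(t)|_v > 1`.
  have hY : ∀ V ∈ supportPlaces k f P, ∀ᶠ m : ℕ in atTop, E.Y ^ m * g ∈ V := by
    intro V hV
    have ha := hV.1.isPlaceAbv hK
    have h1 := (ha.lt_one_iff _).2 (E.Y_mem V hV)
    have h2 := (tendsto_pow_atTop_nhds_zero_of_lt_one (AbsoluteValue.nonneg _ _) h1).mul_const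
      (placeAbv V g)
    rw [zero_mul] at h2
    filter_upwards [h2.eventually_le_const zero_lt_one] with m hm
    rw [← ha.le_one_iff, map_mul, map_pow]
    exact hm
  obtain ⟨m, hm⟩ := (((finite_supportPlaces hK hd).eventually_all).2 hY).exists
  have hb : ∀ᶠ v : FinitePlace k in cofinite, ∀ j ∈ Finset.range f.natDegree,
      ∀ R : ValuationSubring K, LiesOver v R → g⁻¹ ∈ R.nonunits → E.b j ∈ R := by
    rw [Filter.eventually_all_finset]
    exact fun j hj => hpole _ fun V hV =>
      V.nonunits_subset (E.b_mem V hV j (Finset.mem_range.1 hj))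
  filter_upwards [eventually_forall_mul_iter_mem hK hd hg hgt hQm hQ hQl hQP, hb,
    hpole _ fun V hV => V.nonunits_subset (E.A_mem V hV),
    hpole _ fun V hV => V.nonunits_subset (E.Y_mem V hV),
    hpole _ hm, hpole _ E.u_mem, hpole _ E.u_inv_mem] with v hiter hb hA hY hYg hu hui t
  have hR := t.integerRing_liesOver v
  have hunit : g⁻¹ ∈ (t.integerRing v).nonunits → v (t.value E.u) = 1 := by
    intro hgi
    have h1 := hu _ hR hgi
    have h2 := hui _ hR hgi
    have hu0 : E.u ≠ 0 := by
      obtain ⟨β, hβ⟩ := hD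
      rw [mem_divisorSupport_iff hK] at hβ
      have hA0 : E.A ≠ 0 := by
        intro h0
        have := E.data.leading
        rw [h0] at this
        simp at this
      have hY0 : E.Y ≠ 0 := by
        intro h0
        have := E.iter_mul
        rw [h0, mul_zero] at this
        exact pow_ne_zero _ hg0 this.symm
      rw [E.u_eq]
      exact mul_ne_zero (mul_ne_zero (pow_ne_zero _ hg0) hA0) (pow_ne_zero _ hY0)
    refine le_antisymm h1.2 ?_
    by_contra! hlt
    have h3 : E.u ∈ (t.integerRing v).nonunits := RatPoint.mem_nonunits_integerRing.2 ⟨h1.1, hlt⟩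
    rw [ValuationSubring.mem_nonunits_iff_or] at h3
    exact h3.elim hu0 fun h => h h2
  refine ⟨hunit, ?_⟩
  intro hgood hP hgm hQt
  have hdeg := t.natDegree_specialize hgood
  change limUnder atTop (fun n => Real.posLog (v.1 _) / _) = _
  rcases le_or_gt (v (t.value g)) 1 with hle | hlt
  · have hbd : ∀ n, v.1 (iter (t.specialize f) n (t.value P)) ≤
        (v (t.value (aeval g Q) ^ 2))⁻¹ := by
      intro n
      have h1 := (hiter _ hR ⟨hgm, hle⟩ n).2
      have hQm' := t.mem_of_value_ne_zero hQt
      rw [t.value_mul (pow_mem hQm' 2) (iter_mem t.localRing.toSubring hgood.1 hP n),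
        t.value_pow hQm', t.value_iter hgood hP, map_mul] at h1
      have hpos : 0 < v (t.value (aeval g Q) ^ 2) :=
        FinitePlace.pos_iff.2 (pow_ne_zero _ hQt)
      rw [← one_div, le_div_iff₀' hpos]
      exact h1
    rw [(tendsto_of_bounded v.1 (by rw [hdeg]; exact hd) hbd).limUnder_eq]
    have : Real.posLog (v (t.value g)) = 0 := by
      rw [Real.posLog_eq_zero_iff, abs_of_nonneg (apply_nonneg v _)]
      exact hle
    rw [this, zero_div]
  · have hgt0 : t.value g ≠ 0 := by
      intro h0
      rw [h0, map_zero] at hlt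
      linarith
    have hgi : g⁻¹ ∈ (t.integerRing v).nonunits := by
      rw [RatPoint.mem_nonunits_integerRing, t.value_inv hgt0, map_inv₀]
      exact ⟨t.inv_mem_of_value_ne_zero hgt0, inv_lt_one_of_one_lt₀ hlt⟩
    have hA' := hA _ hR hgi
    have hb' : ∀ j < f.natDegree, E.b j ∈ t.integerRing v :=
      fun j hj => hb j (Finset.mem_range.2 hj) _ hR hgi
    have hY1 : v.1 (t.value E.Y) < 1 := by
      have h1 := hY _ hR hgi
      by_contra! hge
      have h2 : E.Y ∉ (t.integerRing v).nonunits := fun h =>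
        absurd (RatPoint.mem_nonunits_integerRing.1 h).2 (not_lt.2 hge)
      have h3 := (hYg _ hR hgi).2
      rw [t.value_mul (pow_mem h1.1 _) hgm, t.value_pow h1.1, map_mul, map_pow] at h3
      have h4 : (1 : ℝ) < v (t.value E.Y) ^ m * v (t.value g) :=
        one_lt_mul_of_le_of_lt (one_le_pow₀ hge) hlt
      linarith
    have hna := FinitePlace.isNonarchimedean v
    have hbv : ∀ j < f.natDegree, v.1 (t.value (E.b j)) ≤ 1 := fun j hj => (hb' j hj).2
    have hseq := EscapeData.seq_lt_one_of_nonarch hna (d := f.natDegree) (by omega) hA'.2 hbv hY1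
    have h1 := fun n => EscapeData.one_add_error_of_nonarch hna hbv (hseq n)
    have key := (E.tendsto hd hgood hP hgt0 hA'.1 (fun j hj => (hb' j hj).1) (hY _ hR hgi).1 v.1
      (B := 0) (fun n h0 => by have := h1 n; rw [h0] at this; simp at this)
      (fun n => by rw [h1]; simp) (fun n => (hseq n).le)).2
    rw [key.limUnder_eq]
    have hlu : Real.log (v.1 (t.value E.u)) = 0 := by
      rw [show v.1 (t.value E.u) = 1 from hunit hgi, Real.log_one]
    simp only [h1, hlu, Real.log_one, zero_div, tsum_zero, neg_zero, add_zero]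
    congr 1
    rw [Real.posLog_eq_log]
    · rfl
    · rw [abs_of_nonneg (apply_nonneg v _)]; exact hlt.le

end GoodPlaces

end PolyFamily

namespace PolyFamily

/-! ### Convergent power series -/

section PartialNorm

variable {κ L : Type*} [Field κ] [NormedField L] (j : κ →+* L) {r : ℝ}

/-- The `ℓ¹` norm on the polydisc of radius `r` of the truncation of a power series. -/
noncomputable def partialNorm (r : ℝ) (N : ℕ) (G : PowerSeries κ) : ℝ :=
  ∑ n ∈ Finset.range N, ‖j (PowerSeries.coeff n G)‖ * r ^ n

variable {j}

theorem partialNorm_nonneg (hr : 0 ≤ r) (N : ℕ) (G : PowerSeries κ) :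
    0 ≤ partialNorm j r N G := Finset.sum_nonneg fun _ _ => by positivity

theorem partialNorm_mono (hr : 0 ≤ r) {M N : ℕ} (h : M ≤ N) (G : PowerSeries κ) :
    partialNorm j r M G ≤ partialNorm j r N G :=
  Finset.sum_le_sum_of_subset_of_nonneg (Finset.range_mono h) fun _ _ _ => by positivity

theorem partialNorm_add_le (hr : 0 ≤ r) (N : ℕ) (G H : PowerSeries κ) :
    partialNorm j r N (G + H) ≤ partialNorm j r N G + partialNorm j r N H := by
  rw [partialNorm, partialNorm, partialNorm, ← Finset.sum_add_distrib]
  refine Finset.sum_le_sum fun n _ => ?_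
  rw [map_add, map_add, ← add_mul]
  gcongr
  exact norm_add_le _ _

theorem partialNorm_neg (N : ℕ) (G : PowerSeries κ) :
    partialNorm j r N (-G) = partialNorm j r N G := by
  simp [partialNorm]

theorem partialNorm_sum_le (hr : 0 ≤ r) (N : ℕ) {α : Type*} (s : Finset α)
    (G : α → PowerSeries κ) :
    partialNorm j r N (∑ i ∈ s, G i) ≤ ∑ i ∈ s, partialNorm j r N (G i) := by
  classical
  induction s using Finset.induction_on with
  | empty => simp [partialNorm]
  | insert i s his ih =>
    rw [Finset.sum_insert his, Finset.sum_insert his]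
    exact (partialNorm_add_le hr _ _ _).trans (by gcongr)

theorem sum_antidiagonal_le {x y : ℕ → ℝ} (hx : ∀ n, 0 ≤ x n) (hy : ∀ n, 0 ≤ y n) (N : ℕ) :
    ∑ n ∈ Finset.range N, ∑ p ∈ Finset.HasAntidiagonal.antidiagonal n, x p.1 * y p.2 ≤
      (∑ n ∈ Finset.range N, x n) * ∑ n ∈ Finset.range N, y n := by
  rw [Finset.sum_mul_sum, ← Finset.sum_product', ← Finset.sum_biUnion]
  · refine Finset.sum_le_sum_of_subset_of_nonneg ?_ fun p _ _ => mul_nonneg (hx _) (hy _)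
    intro p hp
    simp only [Finset.mem_biUnion, Finset.mem_range, Finset.HasAntidiagonal.mem_antidiagonal,
      Finset.mem_product] at hp ⊢
    obtain ⟨n, hn, hp⟩ := hp
    omega
  · intro a _ b _ hab
    rw [Function.onFun, Finset.disjoint_left]
    intro p hp hq
    rw [Finset.HasAntidiagonal.mem_antidiagonal] at hp hq
    exact hab (hp.symm.trans hq)

theorem partialNorm_mul_le (hr : 0 ≤ r) (N : ℕ) (G H : PowerSeries κ) :
    partialNorm j r N (G * H) ≤ partialNorm j r N G * partialNorm j r N H := by
  refine le_trans ?_ (sum_antidiagonal_le (x := fun n => ‖j (PowerSeries.coeff n G)‖ * r ^ n)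
    (y := fun n => ‖j (PowerSeries.coeff n H)‖ * r ^ n) (fun _ => by positivity)
    (fun _ => by positivity) N)
  refine Finset.sum_le_sum fun n _ => ?_
  rw [PowerSeries.coeff_mul, map_sum]
  calc _ ≤ (∑ p ∈ Finset.HasAntidiagonal.antidiagonal n,
        ‖j (PowerSeries.coeff p.1 G * PowerSeries.coeff p.2 H)‖) * r ^ n := by
        gcongr
        exact norm_sum_le _ _
    _ = _ := by
        rw [Finset.sum_mul]
        refine Finset.sum_congr rfl fun p hp => ?_
        rw [map_mul, norm_mul, ← Finset.HasAntidiagonal.mem_antidiagonal.1 hp, pow_add]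
        ring

theorem partialNorm_C_le (N : ℕ) (c : κ) :
    partialNorm j r N (PowerSeries.C c) ≤ ‖j c‖ := by
  rw [partialNorm]
  cases N with
  | zero => simp
  | succ N =>
    rw [Finset.sum_range_succ']
    simp [PowerSeries.coeff_C]

theorem partialNorm_one_le (N : ℕ) : partialNorm j r N 1 ≤ 1 := by
  simpa using partialNorm_C_le (j := j) (r := r) N 1

theorem partialNorm_pow_le (hr : 0 ≤ r) (N : ℕ) (G : PowerSeries κ) (m : ℕ) :
    partialNorm j r N (G ^ m) ≤ partialNorm j r N G ^ m := by
  induction m with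
  | zero => simpa using partialNorm_one_le N
  | succ m ih =>
    rw [pow_succ, pow_succ]
    exact (partialNorm_mul_le hr _ _ _).trans
      (mul_le_mul_of_nonneg_right ih (partialNorm_nonneg hr _ _))

theorem partialNorm_succ_X_mul (N : ℕ) (G : PowerSeries κ) :
    partialNorm j r (N + 1) (PowerSeries.X * G) = r * partialNorm j r N G := by
  rw [partialNorm, Finset.sum_range_succ', partialNorm, Finset.mul_sum]
  simp only [PowerSeries.coeff_succ_X_mul, PowerSeries.coeff_zero_X_mul, map_zero, norm_zero,
    zero_mul, add_zero]
  exact Finset.sum_congr rfl fun n _ => by ring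

/-- Without constant terms, coefficients of index at most `N` of the product involve only
coefficients of index below `N` of the factors. This gain of one index drives the inductive bounds
for implicitly defined series. -/
theorem partialNorm_succ_mul_le (hr : 0 ≤ r) (N : ℕ) {G H : PowerSeries κ}
    (hG : PowerSeries.constantCoeff G = 0) (hH : PowerSeries.constantCoeff H = 0) :
    partialNorm j r (N + 1) (G * H) ≤ partialNorm j r N G * partialNorm j r N H := by
  obtain ⟨G, rfl⟩ := PowerSeries.X_dvd_iff.2 hG
  obtain ⟨H, rfl⟩ := PowerSeries.X_dvd_iff.2 hH
  cases N with
  | zero => simp [partialNorm]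
  | succ N =>
    rw [partialNorm_succ_X_mul, partialNorm_succ_X_mul,
      show PowerSeries.X * G * (PowerSeries.X * H) = PowerSeries.X * (PowerSeries.X * (G * H)) by
        ring, partialNorm_succ_X_mul, partialNorm_succ_X_mul]
    calc r * (r * partialNorm j r N (G * H)) ≤
          r * (r * (partialNorm j r N G * partialNorm j r N H)) := by
          gcongr; exact partialNorm_mul_le hr _ _ _
      _ = _ := by ring

/-- Without a constant term every monomial keeps at least one factor of the radius, so such series
become arbitrarily small on small discs. -/
theorem partialNorm_shrink {s : ℝ} (hs : 0 ≤ s) (hsr : s ≤ r) (hr : 0 < r) (N : ℕ)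
    {G : PowerSeries κ} (hG : PowerSeries.constantCoeff G = 0) :
    partialNorm j s N G ≤ s / r * partialNorm j r N G := by
  rw [partialNorm, partialNorm, Finset.mul_sum]
  refine Finset.sum_le_sum fun n _ => ?_
  cases n with
  | zero => simp [hG]
  | succ n =>
    rw [pow_succ, pow_succ]
    have : s / r * (‖j (PowerSeries.coeff (n + 1) G)‖ * (r ^ n * r)) =
        ‖j (PowerSeries.coeff (n + 1) G)‖ * (r ^ n * s) := by field_simp
    rw [this]
    gcongr

theorem partialNorm_mono_radius {s : ℝ} (hs : 0 ≤ s) (hsr : s ≤ r) (N : ℕ) (G : PowerSeries κ) :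
    partialNorm j s N G ≤ partialNorm j r N G :=
  Finset.sum_le_sum fun n _ => by gcongr

variable (j) in
/-- The power series `G` has `ℓ¹` norm at most `B` on the disc of radius `r`. -/
def NormBound (r : ℝ) (G : PowerSeries κ) (B : ℝ) : Prop := ∀ N, partialNorm j r N G ≤ B

namespace NormBound

variable {G H : PowerSeries κ} {B B' : ℝ}

theorem nonneg (h : NormBound j r G B) : 0 ≤ B := by simpa [partialNorm] using h 0

theorem mono (h : NormBound j r G B) (hB : B ≤ B') : NormBound j r G B' := fun N => (h N).trans hB

theorem mono_radius {s : ℝ} (hs : 0 ≤ s) (hsr : s ≤ r) (h : NormBound j r G B) :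
    NormBound j s G B := fun N => (partialNorm_mono_radius hs hsr N G).trans (h N)

theorem add (hr : 0 ≤ r) (h : NormBound j r G B) (h' : NormBound j r H B') :
    NormBound j r (G + H) (B + B') := fun N =>
  (partialNorm_add_le hr N G H).trans (add_le_add (h N) (h' N))

theorem neg (h : NormBound j r G B) : NormBound j r (-G) B := fun N => by
  rw [partialNorm_neg]; exact h N

theorem mul (hr : 0 ≤ r) (h : NormBound j r G B) (h' : NormBound j r H B') :
    NormBound j r (G * H) (B * B') := fun N =>
  (partialNorm_mul_le hr N G H).trans
    (mul_le_mul (h N) (h' N) (partialNorm_nonneg hr _ _) h.nonneg)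

theorem C (c : κ) : NormBound j r (PowerSeries.C c) ‖j c‖ := fun N => partialNorm_C_le N c

theorem one : NormBound j r 1 1 := fun N => partialNorm_one_le N

theorem zero : NormBound j r 0 0 := fun N => by simp [partialNorm]

theorem pow (hr : 0 ≤ r) (h : NormBound j r G B) (m : ℕ) : NormBound j r (G ^ m) (B ^ m) :=
  fun N => (partialNorm_pow_le hr N G m).trans
    (pow_le_pow_left₀ (partialNorm_nonneg hr _ _) (h N) m)

theorem sum (hr : 0 ≤ r) {α : Type*} {s : Finset α} {G : α → PowerSeries κ} {B : α → ℝ}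
    (h : ∀ i ∈ s, NormBound j r (G i) (B i)) : NormBound j r (∑ i ∈ s, G i) (∑ i ∈ s, B i) :=
  fun N => (partialNorm_sum_le hr N s G).trans (Finset.sum_le_sum fun i hi => h i hi N)

theorem shrink {s : ℝ} (hs : 0 ≤ s) (hsr : s ≤ r) (hr : 0 < r) (h : NormBound j r G B)
    (hG : PowerSeries.constantCoeff G = 0) : NormBound j s G (s / r * B) := fun N =>
  (partialNorm_shrink hs hsr hr N hG).trans (by gcongr; exact h N)

end NormBound

variable (j) in
/-- The ring of power series which converge on some disc of positive radius. -/
def convergentSeries : Subring (PowerSeries κ) where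
  carrier := {G | ∃ r > 0, ∃ B, NormBound j r G B}
  mul_mem' {G H} hG hH := by
    rw [Set.mem_ofPred_eq] at hG hH ⊢
    obtain ⟨r, hr, B, hB⟩ := hG
    obtain ⟨s, hs, B', hB'⟩ := hH
    have h := lt_min hr hs
    exact ⟨min r s, h, _, (hB.mono_radius h.le (min_le_left _ _)).mul h.le
      (hB'.mono_radius h.le (min_le_right _ _))⟩
  one_mem' := by
    rw [Set.mem_ofPred_eq]
    exact ⟨1, one_pos, _, NormBound.one⟩
  add_mem' {G H} hG hH := by
    rw [Set.mem_ofPred_eq] at hG hH ⊢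
    obtain ⟨r, hr, B, hB⟩ := hG
    obtain ⟨s, hs, B', hB'⟩ := hH
    have h := lt_min hr hs
    exact ⟨min r s, h, _, (hB.mono_radius h.le (min_le_left _ _)).add h.le
      (hB'.mono_radius h.le (min_le_right _ _))⟩
  zero_mem' := by
    rw [Set.mem_ofPred_eq]
    exact ⟨1, one_pos, _, NormBound.zero⟩
  neg_mem' {G} hG := by
    rw [Set.mem_ofPred_eq] at hG ⊢
    obtain ⟨r, hr, B, hB⟩ := hG
    exact ⟨r, hr, B, hB.neg⟩

theorem mem_convergentSeries {G : PowerSeries κ} :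
    G ∈ convergentSeries j ↔ ∃ r > 0, ∃ B, NormBound j r G B := Set.mem_ofPred_eq ▸ Iff.rfl

theorem C_mem_convergentSeries (c : κ) : PowerSeries.C c ∈ convergentSeries j :=
  mem_convergentSeries.2 ⟨1, one_pos, _, NormBound.C c⟩

theorem X_mem_convergentSeries : (PowerSeries.X : PowerSeries κ) ∈ convergentSeries j := by
  refine mem_convergentSeries.2 ⟨1, one_pos, 1 * 1, fun N => ?_⟩
  cases N with
  | zero => simp [partialNorm]
  | succ N =>
    rw [← mul_one PowerSeries.X, partialNorm_succ_X_mul]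
    gcongr
    exact partialNorm_one_le N

theorem eventually_normBound {G : PowerSeries κ} (hG : G ∈ convergentSeries j)
    (h0 : PowerSeries.constantCoeff G = 0) {ε : ℝ} (hε : 0 < ε) :
    ∀ᶠ r in 𝓝[>] (0 : ℝ), NormBound j r G ε := by
  obtain ⟨r, hr, B, hB⟩ := mem_convergentSeries.1 hG
  have h1 : ∀ᶠ s in 𝓝[>] (0 : ℝ), s < min r (ε * r / (B + 1)) := by
    have := hB.nonneg
    have : 0 < min r (ε * r / (B + 1)) := lt_min hr (by positivity)
    exact nhdsWithin_le_nhds (eventually_lt_nhds this)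
  filter_upwards [h1, self_mem_nhdsWithin] with s hs hs0
  rw [Set.mem_Ioi] at hs0
  refine (hB.shrink hs0.le (hs.le.trans (min_le_left _ _)) hr h0).mono ?_
  have h2 : s ≤ ε * r / (B + 1) := hs.le.trans (min_le_right _ _)
  have hB0 := hB.nonneg
  rw [le_div_iff₀ (by linarith)] at h2
  rw [div_mul_eq_mul_div, div_le_iff₀ hr]
  nlinarith

theorem eventually_exists_normBound {G : PowerSeries κ} (hG : G ∈ convergentSeries j) :
    ∃ B, 0 ≤ B ∧ ∀ᶠ r in 𝓝[>] (0 : ℝ), NormBound j r G B := by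
  obtain ⟨r, hr, B, hB⟩ := mem_convergentSeries.1 hG
  refine ⟨B, hB.nonneg, ?_⟩
  filter_upwards [nhdsWithin_le_nhds (eventually_le_nhds hr), self_mem_nhdsWithin] with s hs hs0
  exact hB.mono_radius (le_of_lt hs0) hs

/-- Power series that are simple roots of polynomials with convergent coefficients converge. -/
theorem mem_convergentSeries_of_root {n : ℕ} {c : ℕ → PowerSeries κ}
    (hc : ∀ i, c i ∈ convergentSeries j) (h0 : PowerSeries.constantCoeff (c 0) = 0)
    (h1 : PowerSeries.constantCoeff (c 1) ≠ 0) {S : PowerSeries κ}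
    (hS0 : PowerSeries.constantCoeff S = 0)
    (hS : c 0 + c 1 * S + ∑ i ∈ Finset.range n, c (i + 2) * S ^ (i + 2) = 0) :
    S ∈ convergentSeries j := by
  set δ := PowerSeries.constantCoeff (c 1) with hδ
  set c₁ := PowerSeries.C δ⁻¹ * c 1 - 1 with hc₁
  have hc₁0 : PowerSeries.constantCoeff c₁ = 0 := by
    rw [hc₁, map_sub, map_mul, map_one, PowerSeries.constantCoeff_C, ← hδ, inv_mul_cancel₀ h1,
      sub_self]
  have hc₁m : c₁ ∈ convergentSeries j :=
    sub_mem (mul_mem (C_mem_convergentSeries _) (hc 1)) (one_mem _)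
  set c₀ := PowerSeries.C δ⁻¹ * c 0 with hc₀
  have hc₀m : c₀ ∈ convergentSeries j := mul_mem (C_mem_convergentSeries _) (hc 0)
  have hc₀0 : PowerSeries.constantCoeff c₀ = 0 := by rw [hc₀, map_mul, h0, mul_zero]
  have hdm : ∀ i, PowerSeries.C δ⁻¹ * c (i + 2) ∈ convergentSeries j :=
    fun i => mul_mem (C_mem_convergentSeries _) (hc _)
  -- With the linear coefficient normalized to `1 + c₁`, the root is a fixed point of a map whose
  -- constant and linear parts are small on small discs.
  have hSeq : S = -(c₀ + c₁ * S +
      ∑ i ∈ Finset.range n, PowerSeries.C δ⁻¹ * c (i + 2) * S ^ (i + 2)) := by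
    have h2 : PowerSeries.C δ⁻¹ *
        (c 0 + c 1 * S + ∑ i ∈ Finset.range n, c (i + 2) * S ^ (i + 2)) = 0 := by
      rw [hS, mul_zero]
    rw [mul_add, Finset.mul_sum] at h2
    simp_rw [← mul_assoc] at h2
    rw [hc₀, hc₁]
    linear_combination h2
  choose B hB0 hB using fun i => eventually_exists_normBound (hdm i)
  -- `ρ` will bound `S`. It is small enough for the nonlinear terms to contribute at most `ρ / 4`;
  -- the radius is chosen afterwards so that the constant and the linear term contribute at most `ρ
  -- / 4` each.
  obtain ⟨ρ, hρ, hρ0, hρ1⟩ : ∃ ρ : ℝ,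
      (∑ i ∈ Finset.range n, B i * ρ ^ (i + 1) < 1 / 4) ∧ 0 < ρ ∧ ρ < 1 := by
    have hcont : Tendsto (fun ρ : ℝ => ∑ i ∈ Finset.range n, B i * ρ ^ (i + 1)) (𝓝[>] 0) (𝓝 0) := by
      have : Continuous (fun ρ : ℝ => ∑ i ∈ Finset.range n, B i * ρ ^ (i + 1)) := by fun_prop
      have h := this.tendsto 0
      simp only [ne_eq, Nat.add_eq_zero_iff, one_ne_zero, and_false, not_false_eq_true, zero_pow,
        mul_zero, Finset.sum_const_zero] at h
      exact h.mono_left nhdsWithin_le_nhds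
    exact ((hcont.eventually_lt_const (by norm_num)).and
      ((eventually_mem_nhdsWithin (s := Set.Ioi (0 : ℝ))).and
        (nhdsWithin_le_nhds (eventually_lt_nhds one_pos)))).exists
  have hev : ∀ᶠ r in 𝓝[>] (0 : ℝ), ∀ i ∈ Finset.range n,
      NormBound j r (PowerSeries.C δ⁻¹ * c (i + 2)) (B i) := by
    rw [Filter.eventually_all_finset]
    exact fun i _ => hB i
  obtain ⟨r, hr0, hrB, hr1, hr2⟩ := ((eventually_mem_nhdsWithin (s := Set.Ioi (0 : ℝ))).and (hev.and
    ((eventually_normBound hc₀m hc₀0 (show 0 < ρ / 4 by positivity)).and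
    (eventually_normBound hc₁m hc₁0 (show (0 : ℝ) < 1 / 4 by norm_num))))).exists
  rw [Set.mem_Ioi] at hr0
  refine mem_convergentSeries.2 ⟨r, hr0, ρ, fun N => ?_⟩
  -- Convergence is not presupposed: the bound on the truncation at `N`, inserted on the right of
  -- the fixed-point equation, yields the bound at `N + 1`.
  induction N with
  | zero => simpa [partialNorm] using hρ0.le
  | succ N ih =>
    have hpow : ∀ i, partialNorm j r (N + 1) (S ^ (i + 2)) ≤ ρ ^ (i + 2) := by
      intro i
      rw [pow_succ S (i + 1), pow_succ ρ (i + 1)]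
      refine (partialNorm_succ_mul_le hr0.le N (by rw [map_pow, hS0, zero_pow (by omega)])
        hS0).trans ?_
      exact mul_le_mul ((partialNorm_pow_le hr0.le _ _ _).trans
        (pow_le_pow_left₀ (partialNorm_nonneg hr0.le _ _) ih _)) ih
        (partialNorm_nonneg hr0.le _ _) (by positivity)
    rw [hSeq, partialNorm_neg]
    refine (partialNorm_add_le hr0.le _ _ _).trans ?_
    have e1 : partialNorm j r (N + 1) (c₀ + c₁ * S) ≤ ρ / 4 + 1 / 4 * ρ := by
      refine (partialNorm_add_le hr0.le _ _ _).trans (add_le_add (hr1 _) ?_)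
      refine (partialNorm_succ_mul_le hr0.le N hc₁0 hS0).trans ?_
      exact mul_le_mul (hr2 N) ih (partialNorm_nonneg hr0.le _ _) (by norm_num)
    have e2 : partialNorm j r (N + 1)
        (∑ i ∈ Finset.range n, PowerSeries.C δ⁻¹ * c (i + 2) * S ^ (i + 2)) ≤ 1 / 4 * ρ := by
      refine (partialNorm_sum_le hr0.le _ _ _).trans ?_
      calc _ ≤ ∑ i ∈ Finset.range n, B i * ρ ^ (i + 2) := by
            refine Finset.sum_le_sum fun i hi => ?_
            exact (partialNorm_mul_le hr0.le _ _ _).trans (mul_le_mul (hrB i hi _) (hpow i)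
              (partialNorm_nonneg hr0.le _ _) (hB0 i))
        _ = (∑ i ∈ Finset.range n, B i * ρ ^ (i + 1)) * ρ := by
            rw [Finset.sum_mul]
            exact Finset.sum_congr rfl fun i _ => by ring
        _ ≤ 1 / 4 * ρ := by gcongr
    linarith

/-- The inverse minus its constant term solves a linear equation with convergent coefficients, the
case `n = 0` of `mem_convergentSeries_of_root`. -/
theorem inv_mem_convergentSeries {G : PowerSeries κ} (hG : G ∈ convergentSeries j) :
    G⁻¹ ∈ convergentSeries j := by
  by_cases h : PowerSeries.constantCoeff G = 0
  · rw [PowerSeries.inv_eq_zero.2 h]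
    exact zero_mem _
  have hmul := PowerSeries.mul_inv_cancel G h
  set a := PowerSeries.constantCoeff G
  have hS : G⁻¹ - PowerSeries.C a⁻¹ ∈ convergentSeries j := by
    refine mem_convergentSeries_of_root (n := 0)
      (c := fun i => if i = 0 then G * PowerSeries.C a⁻¹ - 1 else G) ?_ ?_ ?_ ?_ ?_
    · intro i
      split_ifs
      · exact sub_mem (mul_mem hG (C_mem_convergentSeries _)) (one_mem _)
      · exact hG
    · simp only [if_true, map_sub, map_mul, PowerSeries.constantCoeff_C, map_one]
      rw [mul_inv_cancel₀ h, sub_self]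
    · simpa using h
    · rw [map_sub, PowerSeries.constantCoeff_inv, PowerSeries.constantCoeff_C, sub_self]
    · simp only [if_true, one_ne_zero, if_false, Finset.range_zero, Finset.sum_empty, add_zero]
      linear_combination hmul
  simpa using add_mem hS (C_mem_convergentSeries a⁻¹)

end PartialNorm

end PolyFamily

namespace PolyFamily

/-! ### Infinite sums, logarithm and exponential of power series. -/

section SeriesSum

variable {κ L : Type*} [Field κ] [NormedField L] {j : κ →+* L} {r : ℝ}

/-- The sum of a sequence of power series whose `n`-th term is divisible by `X ^ n`. -/
noncomputable def seriesSum (E : ℕ → PowerSeries κ) : PowerSeries κ :=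
  PowerSeries.mk fun m => ∑ n ∈ Finset.range (m + 1), PowerSeries.coeff m (E n)

theorem coeff_seriesSum (E : ℕ → PowerSeries κ) (m : ℕ) : PowerSeries.coeff m (seriesSum E) =
    ∑ n ∈ Finset.range (m + 1), PowerSeries.coeff m (E n) := PowerSeries.coeff_mk _ _

theorem X_pow_dvd_seriesSum {E : ℕ → PowerSeries κ} {m : ℕ} (h : ∀ n, PowerSeries.X ^ m ∣ E n) :
    PowerSeries.X ^ m ∣ seriesSum E := by
  rw [PowerSeries.X_pow_dvd_iff]
  intro i hi
  rw [coeff_seriesSum]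
  exact Finset.sum_eq_zero fun n _ => PowerSeries.X_pow_dvd_iff.1 (h n) i hi

theorem NormBound.seriesSum (hr : 0 ≤ r) {E : ℕ → PowerSeries κ} {B : ℕ → ℝ}
    (hE : ∀ n, NormBound j r (E n) (B n)) (hB : Summable B) :
    NormBound j r (seriesSum E) (∑' n, B n) := by
  intro N
  refine le_trans ?_ (hB.sum_le_tsum (Finset.range N) fun n _ => (hE n).nonneg)
  refine le_trans ?_ (Finset.sum_le_sum fun n _ => hE n N)
  simp only [partialNorm]
  rw [Finset.sum_comm]
  refine Finset.sum_le_sum fun m hm => ?_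
  rw [coeff_seriesSum, map_sum, ← Finset.sum_mul]
  gcongr
  refine (norm_sum_le _ _).trans (Finset.sum_le_sum_of_subset_of_nonneg ?_ fun _ _ _ => norm_nonneg _)
  exact Finset.range_mono (Finset.mem_range.1 hm)

theorem partialNorm_succ_mul_le' (hr : 0 ≤ r) (N : ℕ) {G H : PowerSeries κ}
    (hG : PowerSeries.constantCoeff G = 0) :
    partialNorm j r (N + 1) (G * H) ≤ partialNorm j r (N + 1) G * partialNorm j r N H := by
  obtain ⟨G, rfl⟩ := PowerSeries.X_dvd_iff.2 hG
  rw [mul_assoc, partialNorm_succ_X_mul, partialNorm_succ_X_mul, mul_assoc]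
  gcongr
  exact partialNorm_mul_le hr _ _ _

/-- Writing the inverse `H` as `1 - G * H`, where `G` has no constant term, bounds its truncated
norms recursively by `1` plus half of the preceding one. -/
theorem NormBound.inv_one_add (hr : 0 ≤ r) {G : PowerSeries κ}
    (hG0 : PowerSeries.constantCoeff G = 0) (hG : NormBound j r G (1 / 2)) :
    NormBound j r (1 + G)⁻¹ 2 := by
  have h1 : (1 + G)⁻¹ = 1 + -(G * (1 + G)⁻¹) := by
    have := PowerSeries.mul_inv_cancel (1 + G) (by simp [hG0])
    linear_combination this
  intro N
  induction N with
  | zero => simp [partialNorm]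
  | succ N ih =>
    rw [h1]
    refine (partialNorm_add_le hr _ _ _).trans ?_
    rw [partialNorm_neg]
    have h2 : partialNorm j r (N + 1) (G * (1 + G)⁻¹) ≤ 1 / 2 * 2 :=
      (partialNorm_succ_mul_le' hr N hG0).trans
        (mul_le_mul (hG _) ih (partialNorm_nonneg hr _ _) (by norm_num))
    have := partialNorm_one_le (j := j) (r := r) (N + 1)
    linarith

variable (L) in
/-- The denominators of the logarithm and the exponential series grow at most geometrically. -/
structure FactorialBound (C : ℝ) : Prop where
  one_le : 1 ≤ C
  inv : ∀ n : ℕ, n ≠ 0 → ‖(n : L)⁻¹‖ ≤ C ^ n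
  inv_factorial : ∀ n : ℕ, ‖((n.factorial : ℕ) : L)⁻¹‖ ≤ C ^ n

/-- The series `log (1 + G)`. -/
noncomputable def logSeries (G : PowerSeries κ) : PowerSeries κ :=
  seriesSum fun n => PowerSeries.C ((-1) ^ n * ((n + 1 : ℕ) : κ)⁻¹) * G ^ (n + 1)

/-- The series `exp G`. -/
noncomputable def expSeries (G : PowerSeries κ) : PowerSeries κ :=
  seriesSum fun n => PowerSeries.C ((n.factorial : ℕ) : κ)⁻¹ * G ^ n

theorem X_pow_dvd_logSeries {G : PowerSeries κ} {m : ℕ} (h : PowerSeries.X ^ m ∣ G) :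
    PowerSeries.X ^ m ∣ logSeries G :=
  X_pow_dvd_seriesSum fun n => ((h.trans (dvd_pow_self _ n.succ_ne_zero)).mul_left _)

theorem hasSum_geometric_succ_le {q : ℝ} (h0 : 0 ≤ q) (h1 : q ≤ 1 / 2) :
    Summable (fun n : ℕ => q ^ (n + 1)) ∧ ∑' n : ℕ, q ^ (n + 1) ≤ 2 * q := by
  have hs := summable_geometric_of_lt_one h0 (by linarith : q < 1)
  have hs1 : Summable (fun n : ℕ => q ^ (n + 1)) := by
    simpa [pow_succ] using hs.mul_right q
  refine ⟨hs1, ?_⟩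
  have : ∑' n : ℕ, q ^ (n + 1) = (1 - q)⁻¹ * q := by
    simp_rw [pow_succ]
    rw [tsum_mul_right, tsum_geometric_of_lt_one h0 (by linarith)]
  rw [this]
  refine mul_le_mul_of_nonneg_right ?_ h0
  rw [inv_le_comm₀ (by linarith) (by norm_num)]
  linarith

theorem NormBound.logSeries (hr : 0 ≤ r) {C : ℝ} (hC : FactorialBound L C) {G : PowerSeries κ}
    {B : ℝ} (hG : NormBound j r G B) (hB : C * B ≤ 1 / 2) :
    NormBound j r (logSeries G) (2 * (C * B)) := by
  have hq : 0 ≤ C * B := mul_nonneg (by linarith [hC.one_le]) hG.nonneg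
  obtain ⟨h1, h2⟩ := hasSum_geometric_succ_le hq hB
  refine NormBound.mono (NormBound.seriesSum hr (fun n => ?_) h1) h2
  rw [mul_pow]
  refine ((NormBound.C _).mono ?_).mul hr (hG.pow hr (n + 1))
  rw [map_mul, map_pow, map_neg, map_one, map_inv₀, map_natCast, norm_mul, norm_pow, norm_neg,
    norm_one, one_pow, one_mul]
  exact hC.inv (n + 1) n.succ_ne_zero

theorem NormBound.expSeries (hr : 0 ≤ r) {C : ℝ} (hC : FactorialBound L C) {G : PowerSeries κ}
    {B : ℝ} (hG : NormBound j r G B) (hB : C * B ≤ 1 / 2) :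
    NormBound j r (expSeries G) 2 := by
  have hq : 0 ≤ C * B := mul_nonneg (by linarith [hC.one_le]) hG.nonneg
  refine NormBound.mono (NormBound.seriesSum hr (B := fun n => (C * B) ^ n) (fun n => ?_)
    (summable_geometric_of_lt_one hq (by linarith))) ?_
  · rw [mul_pow]
    refine ((NormBound.C _).mono ?_).mul hr (hG.pow hr n)
    rw [map_inv₀, map_natCast]
    exact hC.inv_factorial n
  · rw [tsum_geometric_of_lt_one hq (by linarith), inv_le_comm₀ (by linarith) (by norm_num)]
    linarith

end SeriesSum

/-! ### The orbit and the deviation as formal power series. -/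

section EscapeSeries

variable {κ L : Type*} [Field κ] [NormedField L] {j : κ →+* L} {r : ℝ}
  {d : ℕ} {A Y : PowerSeries κ} {b : ℕ → PowerSeries κ}

theorem dvd_escapeError {R : Type*} [CommRing R] {d : ℕ} (b : ℕ → R) (y : R) :
    y ∣ escapeError d b y :=
  Finset.dvd_sum fun i hi => (dvd_pow_self y (by have := Finset.mem_range.1 hi; omega)).mul_left _

/-- The factor `A` already gains one order of vanishing per step, which is all that the formal
summation over `n` requires. -/
theorem X_pow_dvd_escapeSeq (hd : 2 ≤ d) (hA : PowerSeries.X ∣ A) (hY : PowerSeries.X ∣ Y)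
    (n : ℕ) : PowerSeries.X ^ (n + 1) ∣ escapeSeq d A b Y n := by
  induction n with
  | zero => rw [zero_add, pow_one]; exact hY
  | succ n ih =>
    refine Dvd.dvd.mul_right ?_ _
    rw [pow_succ']
    exact mul_dvd_mul hA (ih.trans (dvd_pow_self _ (by omega)))

theorem X_pow_dvd_escapeError (hd : 2 ≤ d) (hA : PowerSeries.X ∣ A) (hY : PowerSeries.X ∣ Y)
    (n : ℕ) : PowerSeries.X ^ (n + 1) ∣ escapeError d b (escapeSeq d A b Y n) :=
  (X_pow_dvd_escapeSeq hd hA hY n).trans (dvd_escapeError _ _)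

theorem NormBound.escapeError (hr : 0 ≤ r) (hd : 2 ≤ d)
    (hb : ∀ i < d, NormBound j r (b i) (1 / (2 * d))) {y : PowerSeries κ} {B : ℝ}
    (hy : NormBound j r y B) (hB : B ≤ 1) : NormBound j r (escapeError d b y) (B / 2) := by
  have h1 : NormBound j r (PolyFamily.escapeError d b y)
      (∑ i ∈ Finset.range d, 1 / (2 * (d : ℝ)) * B ^ (d - i)) :=
    NormBound.sum hr fun i hi => (hb i (Finset.mem_range.1 hi)).mul hr (hy.pow hr _)
  refine h1.mono ?_
  calc _ ≤ ∑ i ∈ Finset.range d, 1 / (2 * (d : ℝ)) * B := by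
        refine Finset.sum_le_sum fun i hi => ?_
        gcongr
        exact pow_le_of_le_one hy.nonneg hB (by have := Finset.mem_range.1 hi; omega)
    _ = B / 2 := by
        rw [Finset.sum_const, Finset.card_range, nsmul_eq_mul]
        have : (d : ℝ) ≠ 0 := by positivity
        field_simp

/-- A step raises the bound to a power at least two and multiplies it by at most `1/4` from `A` and
`2` from the inverse of `1 + error`, so the bounds decay geometrically. -/
theorem NormBound.escapeSeq (hr : 0 ≤ r) (hd : 2 ≤ d) (hA0 : PowerSeries.X ∣ A)
    (hY0 : PowerSeries.X ∣ Y) (hA : NormBound j r A (1 / 4))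
    (hb : ∀ i < d, NormBound j r (b i) (1 / (2 * d))) {τ : ℝ} (hτ : τ ≤ 1)
    (hY : NormBound j r Y τ) (n : ℕ) : NormBound j r (escapeSeq d A b Y n) (τ ^ (n + 1)) := by
  have hτ0 := hY.nonneg
  induction n with
  | zero => rw [zero_add, pow_one]; exact hY
  | succ n ih =>
    have h1 : τ ^ (n + 1) ≤ 1 := pow_le_one₀ hτ0 hτ
    have h2 : NormBound j r (1 + PolyFamily.escapeError d b (PolyFamily.escapeSeq d A b Y n))⁻¹ 2 := by
      refine NormBound.inv_one_add hr ?_ ((ih.escapeError hr hd hb h1).mono (by linarith))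
      exact PowerSeries.X_dvd_iff.1
        ((dvd_pow_self _ n.succ_ne_zero).trans (X_pow_dvd_escapeError hd hA0 hY0 n))
    refine ((hA.mul hr (ih.pow hr d)).mul hr h2).mono ?_
    have h3 : (τ ^ (n + 1)) ^ d ≤ (τ ^ (n + 1)) ^ 2 := pow_le_pow_of_le_one (by positivity) h1 hd
    have h4 : (τ ^ (n + 1)) ^ 2 ≤ τ ^ (n + 1 + 1) := by
      rw [← pow_mul]
      exact pow_le_pow_of_le_one hτ0 hτ (by omega)
    have h5 : 0 ≤ (τ ^ (n + 1)) ^ d := by positivity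
    linarith

/-- The logarithm of the germ which describes the variation of the canonical height. -/
noncomputable def germLog (d N : ℕ) (A : PowerSeries κ) (b : ℕ → PowerSeries κ)
    (Y u : PowerSeries κ) : PowerSeries κ :=
  -(PowerSeries.C ((((d - 1) * d ^ N : ℕ) : κ)⁻¹) *
    logSeries (PowerSeries.C (PowerSeries.constantCoeff u)⁻¹ * u - 1)) +
  seriesSum fun n => PowerSeries.C ((d : κ)⁻¹ ^ (N + (n + 1))) *
    logSeries (escapeError d b (escapeSeq d A b Y n))

theorem constantCoeff_unit_sub_one {u : PowerSeries κ} (hu : PowerSeries.constantCoeff u ≠ 0) :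
    PowerSeries.constantCoeff (PowerSeries.C (PowerSeries.constantCoeff u)⁻¹ * u - 1) = 0 := by
  rw [map_sub, map_mul, PowerSeries.constantCoeff_C, inv_mul_cancel₀ hu, map_one, sub_self]

theorem X_dvd_germLog (hd : 2 ≤ d) (N : ℕ) (hA : PowerSeries.X ∣ A) (hY : PowerSeries.X ∣ Y)
    {u : PowerSeries κ} (hu : PowerSeries.constantCoeff u ≠ 0) :
    PowerSeries.X ∣ germLog d N A b Y u := by
  refine dvd_add ((Dvd.dvd.mul_left ?_ _).neg_right) ?_
  · have := X_pow_dvd_logSeries (m := 1)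
      (G := PowerSeries.C (PowerSeries.constantCoeff u)⁻¹ * u - 1)
      (by rw [pow_one]; exact PowerSeries.X_dvd_iff.2 (constantCoeff_unit_sub_one hu))
    rwa [pow_one] at this
  · have := X_pow_dvd_seriesSum (m := 1)
      (E := fun n => PowerSeries.C ((d : κ)⁻¹ ^ (N + (n + 1))) *
        logSeries (escapeError d b (escapeSeq d A b Y n))) fun n =>
      Dvd.dvd.mul_left (X_pow_dvd_logSeries
        ((pow_dvd_pow _ (by omega)).trans (X_pow_dvd_escapeError hd hA hY n))) _
    rwa [pow_one] at this

/-- On small discs all series in the definition of `germLog` are small. -/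
theorem exists_normBound_germLog (hd : 2 ≤ d) (N : ℕ) {C : ℝ} (hC : FactorialBound L C)
    (hA : A ∈ convergentSeries j) (hA0 : PowerSeries.X ∣ A)
    (hb : ∀ i < d, b i ∈ convergentSeries j) (hb0 : ∀ i < d, PowerSeries.X ∣ b i)
    (hY : Y ∈ convergentSeries j) (hY0 : PowerSeries.X ∣ Y)
    {u : PowerSeries κ} (hu : u ∈ convergentSeries j) (hu0 : PowerSeries.constantCoeff u ≠ 0) :
    ∃ τ > 0, τ ≤ 1 / 2 ∧ C * τ ≤ 1 / 2 ∧ ‖(d : L)⁻¹‖ * τ ≤ 1 / 2 ∧ ∃ r₀ > 0, ∀ r ∈ Set.Ioc 0 r₀,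
      NormBound j r A (1 / 4) ∧ (∀ i < d, NormBound j r (b i) (1 / (2 * d))) ∧
      NormBound j r Y τ ∧
      NormBound j r (PowerSeries.C (PowerSeries.constantCoeff u)⁻¹ * u - 1) τ ∧
      NormBound j r (germLog d N A b Y u) (1 / (2 * C)) := by
  have hC1 := hC.one_le
  have hC0 : 0 < C := by linarith
  set D := ‖(d : L)⁻¹‖ with hD
  have hD0 : 0 ≤ D := norm_nonneg _
  set M := ‖((((d - 1) * d ^ N : ℕ) : L)⁻¹)‖ with hM
  have hM0 : 0 ≤ M := norm_nonneg _
  -- At places dividing `d` the weight `D = ‖1/d‖` exceeds `1`; the decay `τ ^ (n + 1)` of the orbit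
  -- compensates `D ^ (n + 1)` once `D * τ ≤ 1 / 2`. The last inequality makes the logarithm of the
  -- germ small enough for the exponential series.
  obtain ⟨τ, hτ0, h1, h2, h3, h4⟩ : ∃ τ > 0, τ ≤ 1 / 2 ∧ C * τ ≤ 1 / 2 ∧ D * τ ≤ 1 / 2 ∧
      M * (2 * (C * τ)) + D ^ N * C * (2 * (D * τ)) ≤ 1 / (2 * C) := by
    have e1 : ∀ᶠ τ : ℝ in 𝓝[>] 0, τ ≤ 1 / 2 :=
      nhdsWithin_le_nhds (eventually_le_nhds (by norm_num))
    have e2 : ∀ c : ℝ, Tendsto (fun τ : ℝ => c * τ) (𝓝[>] 0) (𝓝 0) := fun c => by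
      have : Continuous fun τ : ℝ => c * τ := by fun_prop
      simpa using (this.tendsto 0).mono_left (nhdsWithin_le_nhds (s := Set.Ioi 0))
    have e3 : Tendsto (fun τ : ℝ => M * (2 * (C * τ)) + D ^ N * C * (2 * (D * τ)))
        (𝓝[>] 0) (𝓝 0) := by
      refine (e2 (M * (2 * C) + D ^ N * C * (2 * D))).congr fun τ => by ring
    obtain ⟨τ, h0, h⟩ := ((eventually_mem_nhdsWithin (s := Set.Ioi (0 : ℝ))).and (e1.and
      (((e2 C).eventually_le_const (by norm_num : (0 : ℝ) < 1 / 2)).and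
        (((e2 D).eventually_le_const (by norm_num : (0 : ℝ) < 1 / 2)).and
          (e3.eventually_le_const (by positivity : (0 : ℝ) < 1 / (2 * C))))))).exists
    exact ⟨τ, h0, h⟩
  refine ⟨τ, hτ0, h1, h2, h3, ?_⟩
  have hη : PowerSeries.C (PowerSeries.constantCoeff u)⁻¹ * u - 1 ∈ convergentSeries j :=
    sub_mem (mul_mem (C_mem_convergentSeries _) hu) (one_mem _)
  have hη0 := constantCoeff_unit_sub_one hu0
  have hdpos : (0 : ℝ) < 1 / (2 * d) := by
    have : (0 : ℝ) < d := by exact_mod_cast (by omega : 0 < d)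
    positivity
  have hev : ∀ᶠ r in 𝓝[>] (0 : ℝ), ∀ i ∈ Finset.range d, NormBound j r (b i) (1 / (2 * d)) := by
    rw [Filter.eventually_all_finset]
    exact fun i hi => eventually_normBound (hb i (Finset.mem_range.1 hi))
      (PowerSeries.X_dvd_iff.1 (hb0 i (Finset.mem_range.1 hi))) hdpos
  obtain ⟨r, hr0, hrA, hrb, hrY, hrη⟩ := ((eventually_mem_nhdsWithin (s := Set.Ioi (0 : ℝ))).and
    ((eventually_normBound hA (PowerSeries.X_dvd_iff.1 hA0) (by norm_num : (0 : ℝ) < 1 / 4)).and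
      (hev.and ((eventually_normBound hY (PowerSeries.X_dvd_iff.1 hY0) hτ0).and
        (eventually_normBound hη hη0 hτ0))))).exists
  refine ⟨r, hr0, fun s hs => ?_⟩
  replace hrA := hrA.mono_radius hs.1.le hs.2
  replace hrb := fun i hi => (hrb i hi).mono_radius hs.1.le hs.2
  replace hrY := hrY.mono_radius hs.1.le hs.2
  replace hrη := hrη.mono_radius hs.1.le hs.2
  have hs0 := hs.1.le
  have hrb' : ∀ i < d, NormBound j s (b i) (1 / (2 * d)) :=
    fun i hi => hrb i (Finset.mem_range.2 hi)
  refine ⟨hrA, hrb', hrY, hrη, NormBound.mono (NormBound.add hs0 ?_ ?_) h4⟩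
  · refine NormBound.neg (NormBound.mul hs0 ?_ (hrη.logSeries hs0 hC h2))
    have := NormBound.C (j := j) (r := s) ((((d - 1) * d ^ N : ℕ) : κ)⁻¹)
    rwa [map_inv₀ j, map_natCast j] at this
  · obtain ⟨hs1, hs2⟩ := hasSum_geometric_succ_le (mul_nonneg hD0 hτ0.le) h3
    refine NormBound.mono (NormBound.seriesSum hs0 (B := fun n => D ^ N * C * (D * τ) ^ (n + 1))
      (fun n => ?_) (hs1.mul_left _)) ?_
    · have e1 := (NormBound.escapeSeq hs0 hd hA0 hY0 hrA hrb' (by linarith) hrY n).escapeError hs0 hd hrb'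
        (pow_le_one₀ hτ0.le (by linarith))
      have hle : C * (τ ^ (n + 1) / 2) ≤ 1 / 2 := by
        have : τ ^ (n + 1) ≤ τ := pow_le_of_le_one hτ0.le (by linarith) n.succ_ne_zero
        nlinarith
      have e2 := e1.logSeries hs0 hC hle
      have e3 := NormBound.C (j := j) (r := s) ((d : κ)⁻¹ ^ (N + (n + 1)))
      rw [map_pow j, map_inv₀ j, map_natCast j, norm_pow, ← hD] at e3
      refine (e3.mul hs0 e2).mono (le_of_eq ?_)
      rw [pow_add, mul_pow]
      ring
    · rw [tsum_mul_left]
      gcongr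

theorem expSeries_germLog_mem (hd : 2 ≤ d) (N : ℕ) {C : ℝ} (hC : FactorialBound L C)
    (hA : A ∈ convergentSeries j) (hA0 : PowerSeries.X ∣ A)
    (hb : ∀ i < d, b i ∈ convergentSeries j) (hb0 : ∀ i < d, PowerSeries.X ∣ b i)
    (hY : Y ∈ convergentSeries j) (hY0 : PowerSeries.X ∣ Y)
    {u : PowerSeries κ} (hu : u ∈ convergentSeries j) (hu0 : PowerSeries.constantCoeff u ≠ 0) :
    expSeries (germLog d N A b Y u) ∈ convergentSeries j := by
  obtain ⟨τ, -, -, -, -, r, hr, h⟩ := exists_normBound_germLog hd N hC hA hA0 hb hb0 hY hY0 hu hu0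
  have hC1 := hC.one_le
  refine mem_convergentSeries.2 ⟨r, hr, 2, (h r ⟨hr, le_rfl⟩).2.2.2.2.expSeries hr.le hC ?_⟩
  have : C ≠ 0 := by linarith
  field_simp
  exact le_rfl

end EscapeSeries

end PolyFamily

namespace PolyFamily

/-! ### Evaluation of power series -/

section Eval

variable {κ L : Type*} [Field κ] [NormedField L] {j : κ →+* L} {r : ℝ} {x : L}

variable (j) in
/-- The value at `x` of a power series. -/
noncomputable def evalAt (x : L) (G : PowerSeries κ) : L :=
  ∑' n, j (PowerSeries.coeff n G) * x ^ n

theorem NormBound.summable_norm {G : PowerSeries κ} {B : ℝ} (h : NormBound j r G B)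
    (hx : ‖x‖ ≤ r) : Summable (fun n => ‖j (PowerSeries.coeff n G) * x ^ n‖) ∧
      ∑' n, ‖j (PowerSeries.coeff n G) * x ^ n‖ ≤ B := by
  have hB : ∀ N, ∑ n ∈ Finset.range N, ‖j (PowerSeries.coeff n G) * x ^ n‖ ≤ B := by
    intro N
    refine le_trans (Finset.sum_le_sum fun n _ => ?_) (h N)
    rw [norm_mul, norm_pow]
    gcongr
  exact ⟨summable_of_sum_range_le (fun _ => norm_nonneg _) hB,
    Real.tsum_le_of_sum_range_le (fun _ => norm_nonneg _) hB⟩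

theorem evalAt_C (c : κ) : evalAt j x (PowerSeries.C c) = j c := by
  rw [evalAt, tsum_eq_single 0]
  · simp
  · intro n hn
    simp [PowerSeries.coeff_C, hn]

theorem evalAt_X : evalAt j x PowerSeries.X = x := by
  rw [evalAt, tsum_eq_single 1]
  · simp
  · intro n hn
    simp [PowerSeries.coeff_X, hn]

variable (j) in
/-- The ring of power series of finite `ℓ¹` norm on the disc of radius `r`. -/
def boundedSeries (r : ℝ) (hr : 0 ≤ r) : Subring (PowerSeries κ) where
  carrier := {G | ∃ B, NormBound j r G B}
  mul_mem' {G H} hG hH := by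
    rw [Set.mem_ofPred_eq] at hG hH ⊢
    obtain ⟨B, hB⟩ := hG
    obtain ⟨B', hB'⟩ := hH
    exact ⟨_, hB.mul hr hB'⟩
  one_mem' := by
    rw [Set.mem_ofPred_eq]
    exact ⟨_, NormBound.one⟩
  add_mem' {G H} hG hH := by
    rw [Set.mem_ofPred_eq] at hG hH ⊢
    obtain ⟨B, hB⟩ := hG
    obtain ⟨B', hB'⟩ := hH
    exact ⟨_, hB.add hr hB'⟩
  zero_mem' := by
    rw [Set.mem_ofPred_eq]
    exact ⟨_, NormBound.zero⟩
  neg_mem' {G} hG := by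
    rw [Set.mem_ofPred_eq] at hG ⊢
    obtain ⟨B, hB⟩ := hG
    exact ⟨B, hB.neg⟩

theorem mem_boundedSeries {hr : 0 ≤ r} {G : PowerSeries κ} :
    G ∈ boundedSeries j r hr ↔ ∃ B, NormBound j r G B := Set.mem_ofPred_eq ▸ Iff.rfl

theorem NormBound.norm_evalAt_le {G : PowerSeries κ} {B : ℝ} (h : NormBound j r G B)
    (hx : ‖x‖ ≤ r) : ‖evalAt j x G‖ ≤ B :=
  (norm_tsum_le_tsum_norm (h.summable_norm hx).1).trans (h.summable_norm hx).2

theorem evalAt_one : evalAt j x 1 = 1 := by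
  have := evalAt_C (j := j) (x := x) 1
  rwa [map_one, map_one] at this

variable [CompleteSpace L]

theorem NormBound.summable {G : PowerSeries κ} {B : ℝ} (h : NormBound j r G B) (hx : ‖x‖ ≤ r) :
    Summable (fun n => j (PowerSeries.coeff n G) * x ^ n) := (h.summable_norm hx).1.of_norm

variable (j) in
/-- Evaluation at a point of the disc of radius `r`. -/
noncomputable def evalHom (hr : 0 ≤ r) (hx : ‖x‖ ≤ r) : boundedSeries j r hr →+* L where
  toFun G := evalAt j x G
  map_one' := by
    have := evalAt_C (j := j) (x := x) 1
    rwa [map_one, map_one] at this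
  map_mul' G H := by
    obtain ⟨B, hB⟩ := mem_boundedSeries.1 G.2
    obtain ⟨B', hB'⟩ := mem_boundedSeries.1 H.2
    rw [evalAt, evalAt, evalAt, tsum_mul_tsum_eq_tsum_sum_antidiagonal_of_summable_norm
      (hB.summable_norm hx).1 (hB'.summable_norm hx).1]
    refine tsum_congr fun n => ?_
    rw [Subring.coe_mul, PowerSeries.coeff_mul, map_sum, Finset.sum_mul]
    refine Finset.sum_congr rfl fun p hp => ?_
    rw [map_mul, ← Finset.HasAntidiagonal.mem_antidiagonal.1 hp, pow_add]
    ring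
  map_zero' := by simp [evalAt]
  map_add' G H := by
    obtain ⟨B, hB⟩ := mem_boundedSeries.1 G.2
    obtain ⟨B', hB'⟩ := mem_boundedSeries.1 H.2
    rw [evalAt, evalAt, evalAt, ← (hB.summable hx).tsum_add (hB'.summable hx)]
    refine tsum_congr fun n => ?_
    rw [Subring.coe_add, map_add, map_add, add_mul]

section

variable {G H : PowerSeries κ} {B B' : ℝ}

theorem NormBound.evalAt_add (hr : 0 ≤ r) (hx : ‖x‖ ≤ r) (hG : NormBound j r G B)
    (hH : NormBound j r H B') : evalAt j x (G + H) = evalAt j x G + evalAt j x H :=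
  map_add (evalHom j hr hx) ⟨G, mem_boundedSeries.2 ⟨B, hG⟩⟩ ⟨H, mem_boundedSeries.2 ⟨B', hH⟩⟩

theorem NormBound.evalAt_mul (hr : 0 ≤ r) (hx : ‖x‖ ≤ r) (hG : NormBound j r G B)
    (hH : NormBound j r H B') : evalAt j x (G * H) = evalAt j x G * evalAt j x H :=
  map_mul (evalHom j hr hx) ⟨G, mem_boundedSeries.2 ⟨B, hG⟩⟩ ⟨H, mem_boundedSeries.2 ⟨B', hH⟩⟩

theorem NormBound.evalAt_neg (hr : 0 ≤ r) (hx : ‖x‖ ≤ r) (hG : NormBound j r G B) :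
    evalAt j x (-G) = -evalAt j x G :=
  map_neg (evalHom j hr hx) ⟨G, mem_boundedSeries.2 ⟨B, hG⟩⟩

theorem NormBound.evalAt_pow (hr : 0 ≤ r) (hx : ‖x‖ ≤ r) (hG : NormBound j r G B) (n : ℕ) :
    evalAt j x (G ^ n) = evalAt j x G ^ n :=
  map_pow (evalHom j hr hx) ⟨G, mem_boundedSeries.2 ⟨B, hG⟩⟩ n

theorem NormBound.evalAt_sum (hr : 0 ≤ r) (hx : ‖x‖ ≤ r) {α : Type*} {s : Finset α}
    {G : α → PowerSeries κ} {B : α → ℝ} (h : ∀ i ∈ s, NormBound j r (G i) (B i)) :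
    evalAt j x (∑ i ∈ s, G i) = ∑ i ∈ s, evalAt j x (G i) := by
  classical
  induction s using Finset.induction_on with
  | empty => simp [evalAt]
  | insert i s his ih =>
    rw [Finset.sum_insert his, Finset.sum_insert his, NormBound.evalAt_add hr hx (h i (by simp))
      (NormBound.sum hr fun k hk => h k (by simp [hk])), ih fun k hk => h k (by simp [hk])]

theorem NormBound.evalAt_inv (hr : 0 ≤ r) (hx : ‖x‖ ≤ r) (hG : NormBound j r G B)
    (hG' : NormBound j r G⁻¹ B') (h0 : PowerSeries.constantCoeff G ≠ 0) :
    evalAt j x G⁻¹ = (evalAt j x G)⁻¹ := by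
  have := hG.evalAt_mul hr hx hG'
  rw [PowerSeries.mul_inv_cancel _ h0, evalAt_one] at this
  exact eq_inv_of_mul_eq_one_right this.symm

theorem hasSum_tsum_comm {a : ℕ → ℕ → L} {B : ℕ → ℝ} (ha : ∀ n, Summable fun m => ‖a n m‖)
    (haB : ∀ n, ∑' m, ‖a n m‖ ≤ B n) (hB : Summable B) :
    HasSum (fun n => ∑' m, a n m) (∑' m, ∑' n, a n m) := by
  have hs : Summable (fun p : ℕ × ℕ => a p.1 p.2) := by
    apply Summable.of_norm
    rw [summable_prod_of_nonneg (fun _ => norm_nonneg _)]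
    exact ⟨ha, Summable.of_nonneg_of_le (fun n => tsum_nonneg fun _ => norm_nonneg _) haB hB⟩
  have h3 : Summable (fun p : ℕ × ℕ => a p.2 p.1) := (Equiv.prodComm ℕ ℕ).summable_iff.2 hs
  have h4 : ∑' p : ℕ × ℕ, a p.2 p.1 = ∑' p : ℕ × ℕ, a p.1 p.2 :=
    (Equiv.prodComm ℕ ℕ).tsum_eq fun p : ℕ × ℕ => a p.1 p.2
  rw [← h3.tsum_prod, h4]
  exact hs.hasSum.prod_fiberwise fun n => (ha n).of_norm.hasSum

/-- The majorants `B n` make the double series absolutely summable, so summation and evaluation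
commute; divisibility by `X ^ n` identifies the inner sums with the finite sums defining
`seriesSum`. -/
theorem NormBound.hasSum_evalAt (hx : ‖x‖ ≤ r) {E : ℕ → PowerSeries κ} {B : ℕ → ℝ}
    (hE : ∀ n, NormBound j r (E n) (B n)) (hB : Summable B) (hX : ∀ n, PowerSeries.X ^ n ∣ E n) :
    HasSum (fun n => PolyFamily.evalAt j x (E n))
      (PolyFamily.evalAt j x (PolyFamily.seriesSum E)) := by
  have h2 : PolyFamily.evalAt j x (PolyFamily.seriesSum E) =
      ∑' m, ∑' n, j (PowerSeries.coeff m (E n)) * x ^ m := by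
    refine tsum_congr fun m => ?_
    have h4 : ∀ n ∉ Finset.range (m + 1), j (PowerSeries.coeff m (E n)) * x ^ m = 0 := by
      intro n hn
      have h5 : m < n := by
        have := Finset.mem_range.not.1 hn
        omega
      rw [PowerSeries.X_pow_dvd_iff.1 (hX n) m h5, map_zero, zero_mul]
    rw [coeff_seriesSum, map_sum, Finset.sum_mul, tsum_eq_sum h4]
  rw [h2]
  exact hasSum_tsum_comm (fun n => ((hE n).summable_norm hx).1)
    (fun n => ((hE n).summable_norm hx).2) hB

theorem NormBound.norm_evalAt_sub_le {G : PowerSeries κ} {B : ℝ} (hr : 0 < r) (hx : ‖x‖ ≤ r)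
    (h : NormBound j r G B) :
    ‖evalAt j x G - j (PowerSeries.constantCoeff G)‖ ≤ ‖x‖ / r * (B + ‖j (PowerSeries.constantCoeff G)‖) := by
  have h1 : NormBound j r (G - PowerSeries.C (PowerSeries.constantCoeff G))
      (B + ‖j (PowerSeries.constantCoeff G)‖) := by
    rw [sub_eq_add_neg]
    exact h.add hr.le (NormBound.C _).neg
  have h2 := h1.shrink (norm_nonneg x) hx hr (by simp)
  have h3 := h2.norm_evalAt_le le_rfl
  rwa [sub_eq_add_neg, h.evalAt_add hr.le hx (NormBound.C _).neg,
    (NormBound.C _).evalAt_neg hr.le hx, evalAt_C, ← sub_eq_add_neg] at h3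

theorem tendsto_evalAt {G : PowerSeries κ} (hG : G ∈ convergentSeries j) {α : Type*} {l : Filter α}
    {x : α → L} (hx : Tendsto x l (𝓝 0)) :
    Tendsto (fun t => evalAt j (x t) G) l (𝓝 (j (PowerSeries.constantCoeff G))) := by
  obtain ⟨r, hr, B, hB⟩ := mem_convergentSeries.1 hG
  rw [tendsto_iff_norm_sub_tendsto_zero]
  have h1 : Tendsto (fun t => ‖x t‖ / r * (B + ‖j (PowerSeries.constantCoeff G)‖)) l (𝓝 0) := by
    have := (hx.norm.div_const r).mul_const (B + ‖j (PowerSeries.constantCoeff G)‖)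
    simpa using this
  refine squeeze_zero' (Eventually.of_forall fun _ => norm_nonneg _) ?_ h1
  have h2 : ∀ᶠ t in l, ‖x t‖ < r := by
    have := hx.norm
    rw [norm_zero] at this
    exact this.eventually_lt_const hr
  filter_upwards [h2] with t ht
  exact hB.norm_evalAt_sub_le hr ht.le

theorem NormBound.evalAt_escapeError (hr : 0 ≤ r) (hx : ‖x‖ ≤ r) {d : ℕ} {b : ℕ → PowerSeries κ}
    {Bb : ℝ} (hb : ∀ i < d, NormBound j r (b i) Bb) {y : PowerSeries κ} (hy : NormBound j r y B) :
    evalAt j x (PolyFamily.escapeError d b y) =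
      PolyFamily.escapeError d (fun i => evalAt j x (b i)) (evalAt j x y) := by
  rw [PolyFamily.escapeError, PolyFamily.escapeError, NormBound.evalAt_sum hr hx
    (B := fun i => Bb * B ^ (d - i)) fun i hi => (hb i (Finset.mem_range.1 hi)).mul hr (hy.pow hr _)]
  refine Finset.sum_congr rfl fun i hi => ?_
  rw [(hb i (Finset.mem_range.1 hi)).evalAt_mul hr hx (hy.pow hr _), hy.evalAt_pow hr hx]

theorem NormBound.evalAt_escapeSeq (hr : 0 ≤ r) (hx : ‖x‖ ≤ r) {d : ℕ} (hd : 2 ≤ d)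
    {A Y : PowerSeries κ} {b : ℕ → PowerSeries κ} (hA0 : PowerSeries.X ∣ A)
    (hY0 : PowerSeries.X ∣ Y) (hA : NormBound j r A (1 / 4))
    (hb : ∀ i < d, NormBound j r (b i) (1 / (2 * d))) {τ : ℝ} (hτ : τ ≤ 1)
    (hY : NormBound j r Y τ) (n : ℕ) :
    evalAt j x (PolyFamily.escapeSeq d A b Y n) =
      PolyFamily.escapeSeq d (evalAt j x A) (fun i => evalAt j x (b i)) (evalAt j x Y) n := by
  induction n with
  | zero => rfl
  | succ n ih =>
    have h0 := NormBound.escapeSeq hr hd hA0 hY0 hA hb hτ hY n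
    have h1 : τ ^ (n + 1) ≤ 1 := pow_le_one₀ hY.nonneg hτ
    have h2 := (h0.escapeError hr hd hb h1).mono (show τ ^ (n + 1) / 2 ≤ 1 / 2 by linarith)
    have h3 : PowerSeries.constantCoeff
        (PolyFamily.escapeError d b (PolyFamily.escapeSeq d A b Y n)) = 0 :=
      PowerSeries.X_dvd_iff.1
        ((dvd_pow_self _ n.succ_ne_zero).trans (X_pow_dvd_escapeError hd hA0 hY0 n))
    have h4 := NormBound.inv_one_add hr h3 h2
    have h5 := NormBound.one.add hr h2
    rw [PolyFamily.escapeSeq, PolyFamily.escapeSeq,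
      (hA.mul hr (h0.pow hr d)).evalAt_mul hr hx h4, hA.evalAt_mul hr hx (h0.pow hr d),
      h0.evalAt_pow hr hx, h5.evalAt_inv hr hx h4 (by simp [h3]),
      NormBound.one.evalAt_add hr hx h2, evalAt_one, h0.evalAt_escapeError hr hx hb, ih]

end

end Eval

/-! ### Comparison with the complex logarithm and exponential. -/

section Complex

variable {κ : Type*} [Field κ] {j : κ →+* ℂ} {r : ℝ} {x : ℂ} {G : PowerSeries κ} {B : ℝ}

theorem factorialBound_complex : FactorialBound ℂ 1 where
  one_le := le_rfl
  inv n hn := by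
    rw [norm_inv, Complex.norm_natCast, one_pow]
    exact inv_le_one_of_one_le₀ (by exact_mod_cast Nat.one_le_iff_ne_zero.2 hn)
  inv_factorial n := by
    rw [norm_inv, Complex.norm_natCast, one_pow]
    exact inv_le_one_of_one_le₀ (by exact_mod_cast n.factorial_pos)

/-- Evaluated term by term, the formal logarithm is the Taylor series of the principal branch at
`1`, valid since the argument has norm at most `1/2`. -/
theorem NormBound.evalAt_logSeries (hr : 0 ≤ r) (hx : ‖x‖ ≤ r) (hG : NormBound j r G B)
    (hB : B ≤ 1 / 2) (hX : PowerSeries.X ∣ G) :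
    evalAt j x (PolyFamily.logSeries G) = Complex.log (1 + evalAt j x G) := by
  have h1 : ‖evalAt j x G‖ < 1 := (hG.norm_evalAt_le hx).trans_lt (by linarith)
  have h2 := Complex.hasSum_taylorSeries_log h1
  rw [← hasSum_nat_add_iff' 1] at h2
  simp only [Finset.range_one, Finset.sum_singleton, Nat.cast_zero, div_zero, sub_zero] at h2
  have hs := (hasSum_geometric_succ_le hG.nonneg hB).1
  have hterm : ∀ n : ℕ, NormBound j r
      (PowerSeries.C ((-1) ^ n * ((n + 1 : ℕ) : κ)⁻¹) * G ^ (n + 1)) (B ^ (n + 1)) := by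
    intro n
    rw [← one_mul (B ^ (n + 1))]
    refine ((NormBound.C _).mono ?_).mul hr (hG.pow hr (n + 1))
    rw [map_mul, map_pow, map_neg, map_one, map_inv₀, map_natCast, norm_mul, norm_pow, norm_neg,
      norm_one, one_pow, one_mul]
    simpa using factorialBound_complex.inv (n + 1) n.succ_ne_zero
  refine HasSum.unique (NormBound.hasSum_evalAt hx hterm hs fun n => ?_) (h2.congr_fun fun n => ?_)
  · exact ((pow_dvd_pow_of_dvd hX n).trans (pow_dvd_pow G n.le_succ)).mul_left _
  · rw [(NormBound.C _).evalAt_mul hr hx (hG.pow hr _), hG.evalAt_pow hr hx, evalAt_C,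
      map_mul, map_pow, map_neg, map_one, map_inv₀, map_natCast, pow_succ (-1 : ℂ) (n + 1), pow_succ (-1 : ℂ) n]
    push_cast
    ring

theorem NormBound.evalAt_expSeries (hr : 0 ≤ r) (hx : ‖x‖ ≤ r) (hG : NormBound j r G B)
    (hB : B ≤ 1 / 2) (hX : PowerSeries.X ∣ G) :
    evalAt j x (PolyFamily.expSeries G) = Complex.exp (evalAt j x G) := by
  have h2 : HasSum (fun n : ℕ => evalAt j x G ^ n / (n.factorial : ℂ)) (Complex.exp (evalAt j x G)) := by
    rw [Complex.exp_eq_exp_ℂ]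
    exact NormedSpace.expSeries_div_hasSum_exp _
  have hterm : ∀ n : ℕ, NormBound j r
      (PowerSeries.C ((n.factorial : ℕ) : κ)⁻¹ * G ^ n) (B ^ n) := by
    intro n
    rw [← one_mul (B ^ n)]
    refine ((NormBound.C _).mono ?_).mul hr (hG.pow hr n)
    rw [map_inv₀, map_natCast]
    simpa using factorialBound_complex.inv_factorial n
  refine HasSum.unique (NormBound.hasSum_evalAt hx hterm
    (summable_geometric_of_lt_one hG.nonneg (by linarith)) fun n => ?_) (h2.congr_fun fun n => ?_)
  · exact (pow_dvd_pow_of_dvd hX n).mul_left _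
  · rw [(NormBound.C _).evalAt_mul hr hx (hG.pow hr _), hG.evalAt_pow hr hx, evalAt_C,
      map_inv₀, map_natCast]
    field_simp

/-- On a small disc all formal operations commute with evaluation, so the real part of the formal
logarithm becomes a combination of logarithms of absolute values. Up to the constant coming from `u`
at the centre, it is the deviation in `EscapeFunctions.tendsto`; the exponential supplies a
nonvanishing germ. -/
theorem exists_evalAt_germLog {d : ℕ} {A Y u : PowerSeries κ} {b : ℕ → PowerSeries κ}
    (hd : 2 ≤ d) (N : ℕ)
    (hA : A ∈ convergentSeries j) (hA0 : PowerSeries.X ∣ A)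
    (hb : ∀ i < d, b i ∈ convergentSeries j) (hb0 : ∀ i < d, PowerSeries.X ∣ b i)
    (hY : Y ∈ convergentSeries j) (hY0 : PowerSeries.X ∣ Y)
    (hu : u ∈ convergentSeries j) (hu0 : PowerSeries.constantCoeff u ≠ 0) :
    ∃ r₀ > 0, NormBound j r₀ (germLog d N A b Y u) (1 / 2) ∧ ∀ x : ℂ, ‖x‖ ≤ r₀ →
      HasSum (fun n => j (PowerSeries.coeff n (expSeries (germLog d N A b Y u))) * x ^ n)
        (Complex.exp (evalAt j x (germLog d N A b Y u))) ∧
      (∀ n, ‖escapeSeq d (evalAt j x A) (fun i => evalAt j x (b i)) (evalAt j x Y) n‖ ≤ 1) ∧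
      (∀ n, ‖escapeError d (fun i => evalAt j x (b i))
        (escapeSeq d (evalAt j x A) (fun i => evalAt j x (b i)) (evalAt j x Y) n)‖ ≤ 1 / 2) ∧
      (evalAt j x (germLog d N A b Y u)).re =
        -(Real.log ‖evalAt j x u‖ - Real.log ‖j (PowerSeries.constantCoeff u)‖) /
          ((d : ℝ) ^ N * ((d : ℝ) - 1)) +
        (∑' n, Real.log ‖1 + escapeError d (fun i => evalAt j x (b i))
          (escapeSeq d (evalAt j x A) (fun i => evalAt j x (b i)) (evalAt j x Y) n)‖ /
            (d : ℝ) ^ (n + 1)) / (d : ℝ) ^ N := by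
  obtain ⟨τ, hτ0, hτ1, -, -, r, hr, h⟩ :=
    exists_normBound_germLog hd N factorialBound_complex hA hA0 hb hb0 hY hY0 hu hu0
  obtain ⟨hA', hb', hY', hη, hL⟩ := h r ⟨hr, le_rfl⟩
  rw [mul_one] at hL
  refine ⟨r, hr, hL, fun x hx => ?_⟩
  have hseq := NormBound.escapeSeq hr.le hd hA0 hY0 hA' hb' (by linarith) hY'
  have hτn : ∀ n, τ ^ (n + 1) ≤ 1 := fun n => pow_le_one₀ hτ0.le (by linarith)
  have hevs := fun n => NormBound.evalAt_escapeSeq hr.le hx hd hA0 hY0 hA' hb'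
    (by linarith : τ ≤ 1) hY' n
  have herr := fun n => (hseq n).escapeError hr.le hd hb' (hτn n)
  have heve : ∀ n, evalAt j x (escapeError d b (escapeSeq d A b Y n)) = _ := fun n =>
    ((hseq n).evalAt_escapeError hr.le hx hb').trans (by rw [hevs n])
  have hLX := X_dvd_germLog hd N hA0 hY0 hu0 (b := b)
  refine ⟨?_, fun n => ?_, fun n => ?_, ?_⟩
  · rw [← hL.evalAt_expSeries hr.le hx le_rfl hLX]
    exact ((hL.expSeries hr.le factorialBound_complex (by norm_num)).summable hx).hasSum
  · rw [← hevs n]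
    exact ((hseq n).norm_evalAt_le hx).trans (hτn n)
  · rw [← heve n]
    exact ((herr n).norm_evalAt_le hx).trans (by linarith [hτn n])
  have hη0 := constantCoeff_unit_sub_one hu0
  have hlogη := hη.logSeries hr.le factorialBound_complex (by linarith)
  have hD : ‖((d : ℂ))⁻¹‖ ≤ 1 / 2 := by
    rw [norm_inv, Complex.norm_natCast, inv_le_comm₀ (by positivity) (by norm_num)]
    simpa using (by exact_mod_cast hd : (2 : ℝ) ≤ d)
  have hlogerr := fun n => (herr n).logSeries hr.le factorialBound_complex
    (by linarith [hτn n] : 1 * (τ ^ (n + 1) / 2) ≤ 1 / 2)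
  have hterm : ∀ n, NormBound j r (PowerSeries.C ((d : κ)⁻¹ ^ (N + (n + 1))) *
      logSeries (escapeError d b (escapeSeq d A b Y n))) ((1 / 2) ^ n) := by
    intro n
    have e3 := NormBound.C (j := j) (r := r) ((d : κ)⁻¹ ^ (N + (n + 1)))
    rw [map_pow j, map_inv₀ j, map_natCast j, norm_pow] at e3
    refine (e3.mul hr.le (hlogerr n)).mono ?_
    have e4 : ‖((d : ℂ))⁻¹‖ ^ (N + (n + 1)) ≤ (1 / 2) ^ n := by
      calc _ ≤ (1 / 2 : ℝ) ^ (N + (n + 1)) := by gcongr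
        _ ≤ (1 / 2) ^ n := pow_le_pow_of_le_one (by norm_num) (by norm_num) (by omega)
    calc _ ≤ (1 / 2 : ℝ) ^ n * 1 := by
          refine mul_le_mul e4 (by linarith [hτn n]) (by positivity) (by positivity)
      _ = _ := mul_one _
  have hgeo : Summable fun n : ℕ => (1 / 2 : ℝ) ^ n :=
    summable_geometric_of_lt_one (by norm_num) (by norm_num)
  have hsum := NormBound.hasSum_evalAt hx hterm hgeo fun n =>
    Dvd.dvd.mul_left (X_pow_dvd_logSeries ((pow_dvd_pow _ (by omega)).trans
      (X_pow_dvd_escapeError hd hA0 hY0 n))) _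
  have hC1 := NormBound.C (j := j) (r := r) ((((d - 1) * d ^ N : ℕ) : κ)⁻¹)
  rw [germLog, NormBound.evalAt_add hr.le hx (hC1.mul hr.le hlogη).neg
    (NormBound.seriesSum hr.le hterm hgeo), (hC1.mul hr.le hlogη).evalAt_neg hr.le hx,
    hC1.evalAt_mul hr.le hx hlogη, evalAt_C,
    hη.evalAt_logSeries hr.le hx hτ1 (PowerSeries.X_dvd_iff.2 hη0), Complex.add_re]
  obtain ⟨Bu, hBu⟩ : ∃ Bu, NormBound j r u Bu := by
    have h1 := (hη.add hr.le NormBound.one)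
    rw [sub_add_cancel] at h1
    have h2 := (NormBound.C (j := j) (r := r) (PowerSeries.constantCoeff u)).mul hr.le h1
    rw [← mul_assoc, ← map_mul, mul_inv_cancel₀ hu0, map_one, one_mul] at h2
    exact ⟨_, h2⟩
  congr 1
  · have e1 : 1 + evalAt j x (PowerSeries.C (PowerSeries.constantCoeff u)⁻¹ * u - 1) =
        (j (PowerSeries.constantCoeff u))⁻¹ * evalAt j x u := by
      have := (NormBound.one (j := j) (r := r)).evalAt_add hr.le hx hη
      rw [add_sub_cancel, evalAt_one, (NormBound.C _).evalAt_mul hr.le hx hBu, evalAt_C,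
        map_inv₀] at this
      exact this.symm
    have hju0 : j (PowerSeries.constantCoeff u) ≠ 0 := by simpa using hu0
    have hux : evalAt j x u ≠ 0 := by
      intro h0
      rw [h0, mul_zero] at e1
      have h1 := hη.norm_evalAt_le hx
      rw [eq_neg_of_add_eq_zero_right e1, norm_neg, norm_one] at h1
      linarith
    have e2 : j (((d - 1) * d ^ N : ℕ) : κ)⁻¹ = (((d : ℝ) ^ N * ((d : ℝ) - 1))⁻¹ : ℝ) := by
      rw [map_inv₀, map_natCast]
      push_cast [Nat.cast_sub (by omega : 1 ≤ d)]
      rw [mul_comm]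
    rw [e1, e2, Complex.neg_re, Complex.re_ofReal_mul, Complex.log_re, norm_mul, norm_inv,
      Real.log_mul (by simpa using hju0) (by simpa using hux), Real.log_inv]
    ring
  · have h3 := (Complex.hasSum_re hsum).tsum_eq
    rw [← h3, ← tsum_div_const]
    refine tsum_congr fun n => ?_
    have e3 := NormBound.C (j := j) (r := r) ((d : κ)⁻¹ ^ (N + (n + 1)))
    have e4 : j ((d : κ)⁻¹ ^ (N + (n + 1))) = (((d : ℝ) ^ (N + (n + 1)))⁻¹ : ℝ) := by
      rw [map_pow, map_inv₀, map_natCast]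
      push_cast
      rw [inv_pow]
    rw [e3.evalAt_mul hr.le hx (hlogerr n), evalAt_C, e4, Complex.re_ofReal_mul,
      (herr n).evalAt_logSeries hr.le hx (by linarith [hτn n]) (PowerSeries.X_dvd_iff.2
        (PowerSeries.X_dvd_iff.1 ((dvd_pow_self _ n.succ_ne_zero).trans
          (X_pow_dvd_escapeError hd hA0 hY0 n)))), Complex.log_re, heve n, pow_add]
    field_simp

end Complex

end PolyFamily

namespace PolyFamily

/-! ### Local coordinates -/

section BivEval

variable {k A B : Type*} [CommRing k] [CommRing A] [CommRing B]

/-- Evaluation of a polynomial in two variables. -/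
noncomputable def bivEval (ι : k →+* A) (x y : A) : k[X][X] →+* A :=
  eval₂RingHom (eval₂RingHom ι x) y

variable {ι : k →+* A} {x y s : A}

theorem map_bivEval (h : A →+* B) (F : k[X][X]) :
    h (bivEval ι x y F) = bivEval (h.comp ι) (h x) (h y) F := by
  have : h.comp (bivEval ι x y) = bivEval (h.comp ι) (h x) (h y) := by
    refine Polynomial.ringHom_ext' (Polynomial.ringHom_ext' ?_ ?_) ?_
    · ext c
      simp [bivEval]
    · simp [bivEval]
    · simp [bivEval]
  exact congrArg (fun e => e F) this

theorem bivEval_eq_eval (F : k[X][X]) :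
    bivEval ι x y F = (F.map (eval₂RingHom ι x)).eval y := by
  rw [bivEval, coe_eval₂RingHom, eval_map]

theorem bivEval_eq_sum (F : k[X][X]) : bivEval ι x y F =
    ∑ i ∈ Finset.range (F.natDegree + 1), (∑ l ∈ Finset.range ((F.coeff i).natDegree + 1),
      ι ((F.coeff i).coeff l) * x ^ l) * y ^ i := by
  rw [bivEval, coe_eval₂RingHom, eval₂_eq_sum_range]
  refine Finset.sum_congr rfl fun i _ => ?_
  rw [coe_eval₂RingHom, eval₂_eq_sum_range]

theorem bivEval_mem {S : Subring A} (hι : ∀ c, ι c ∈ S) (hx : x ∈ S) (hy : y ∈ S) (F : k[X][X]) :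
    bivEval ι x y F ∈ S := by
  rw [bivEval_eq_sum]
  exact sum_mem fun i _ => mul_mem (sum_mem fun l _ => mul_mem (hι _) (pow_mem hx _))
    (pow_mem hy _)

theorem bivEval_add (F : k[X][X]) : bivEval ι x (y + s) F =
    ∑ i ∈ Finset.range (F.natDegree + 1), bivEval ι x y (hasseDeriv i F) * s ^ i := by
  have h1 : ∀ i, bivEval ι x y (hasseDeriv i F) =
      (taylor y (F.map (eval₂RingHom ι x))).coeff i := by
    intro i
    rw [taylor_coeff, bivEval_eq_eval]
    congr 1
    ext n
    rw [coeff_map, hasseDeriv_coeff, hasseDeriv_coeff, map_mul, map_natCast, coeff_map]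
  have h2 : (taylor y (F.map (eval₂RingHom ι x))).natDegree < F.natDegree + 1 := by
    rw [natDegree_taylor]
    exact Nat.lt_succ_of_le natDegree_map_le
  rw [bivEval_eq_eval, add_comm, ← taylor_eval, eval_eq_sum_range' h2]
  exact Finset.sum_congr rfl fun i _ => by rw [h1]

theorem tendsto_bivEval [TopologicalSpace A] [IsTopologicalRing A] {α : Type*} {l : Filter α}
    {u v : α → A} (hu : Tendsto u l (𝓝 x)) (hv : Tendsto v l (𝓝 y)) (F : k[X][X]) :
    Tendsto (fun t => bivEval ι (u t) (v t) F) l (𝓝 (bivEval ι x y F)) := by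
  simp only [bivEval_eq_sum]
  exact tendsto_finsetSum _ fun i _ => (tendsto_finsetSum _ fun m _ =>
    tendsto_const_nhds.mul (hu.pow m)).mul (hv.pow i)

end BivEval

/-! ### Étale coordinates on a curve. -/

section LocalStructure

variable {k K : Type*} [Field k] [Field K]

theorem exists_frac_of_heightOneSpectrum {A : Type*} [CommRing A] [IsDedekindDomain A] [Algebra A K]
    [IsFractionRing A K] (v : IsDedekindDomain.HeightOneSpectrum A) {y : K}
    (hy : y ∈ (v.valuation K).valuationSubring) :
    ∃ a s : A, s ∉ v.asIdeal ∧ y * algebraMap A K s = algebraMap A K a := by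
  obtain ⟨n, d, hnd⟩ := v.exists_primeCompl_mul_eq_of_integer y
    ((Valuation.mem_valuationSubring_iff _ _).1 hy)
  exact ⟨n, d, d.2, hnd⟩

/-- The residue fields have characteristic zero, so the residue extension is separable, and the
contracted prime extends to the maximal ideal because it contains the generator `w`. These are the
two conditions for being unramified. -/
theorem isUnramifiedAt_of_uniformizer [CharZero k] {R A : Type*} [CommRing R] [IsDomain R]
    [Algebra k R] [CommRing A] [IsDedekindDomain A] [Algebra R A] [Module.Finite R A] [Algebra A K]
    [IsFractionRing A K] (v : IsDedekindDomain.HeightOneSpectrum A) {w : R}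
    (hw : ∀ a ∈ v.asIdeal, ∃ c ∈ (v.valuation K).valuationSubring,
      algebraMap A K a = algebraMap A K (algebraMap R A w) * c)
    (hwv : algebraMap R A w ∈ v.asIdeal) : Algebra.IsUnramifiedAt R v.asIdeal := by
  let p := v.asIdeal.under R
  let q := v.asIdeal
  let := Localization.AtPrime.algebraOfLiesOver p q
  have : CharZero p.ResidueField := by
    have : Algebra k p.ResidueField := ((algebraMap R p.ResidueField).comp (algebraMap k R)).toAlgebra
    exact charZero_of_injective_algebraMap (algebraMap k p.ResidueField).injective
  rw [Algebra.isUnramifiedAt_iff_map_eq R p q]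
  refine ⟨?_, ?_⟩
  · have : Algebra.IsAlgebraic p.ResidueField q.ResidueField := inferInstance
    infer_instance
  apply le_antisymm
  · rw [Ideal.map_le_iff_le_comap]
    intro a ha
    rw [Ideal.mem_comap, IsScalarTower.algebraMap_apply R A (Localization.AtPrime q)]
    exact (IsLocalization.AtPrime.to_map_mem_maximal_iff (Localization.AtPrime q) q _).2 ha
  · rw [← Localization.AtPrime.map_eq_maximalIdeal, Ideal.map_le_iff_le_comap]
    intro a ha
    obtain ⟨c, hc, hac⟩ := hw a ha
    obtain ⟨b, s, hs, hcs⟩ := exists_frac_of_heightOneSpectrum v hc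
    have h1 : s * a = b * algebraMap R A w := by
      apply IsFractionRing.injective A K
      rw [map_mul, map_mul, hac, ← hcs]
      ring
    have h2 := congrArg (algebraMap A (Localization.AtPrime q)) h1
    rw [map_mul, map_mul, ← IsScalarTower.algebraMap_apply R A (Localization.AtPrime q)] at h2
    have hu : IsUnit (algebraMap A (Localization.AtPrime q) s) :=
      IsLocalization.map_units _ (⟨s, hs⟩ : q.primeCompl)
    rw [Ideal.mem_comap, ← hu.unit.inv_mul_cancel_left (algebraMap A (Localization.AtPrime q) a)]
    refine Ideal.mul_mem_left _ _ ?_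
    rw [IsUnit.unit_spec, h2]
    exact Ideal.mul_mem_left _ _ (Ideal.mem_map_of_mem _ hwv)

variable [Algebra k K]

/-- A local ring of a smooth curve is, locally on the affine line with coordinate `w`, given by a
polynomial with a simple root. -/
theorem exists_bivEval_generator [CharZero k] (hK : IsCurveField k K) {V : ValuationSubring K}
    (hV : IsPlace k V) {w : K} (hwV : w ∈ V)
    (hw : IsLocalRing.maximalIdeal V = Ideal.span {⟨w, hwV⟩}) :
    ∃ (θ : K) (F : k[X][X]), θ ∈ V ∧ F.Monic ∧ bivEval (algebraMap k K) w θ F = 0 ∧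
      bivEval (algebraMap k K) w θ (derivative F) ∉ V.nonunits ∧
      ∀ y ∈ V, ∃ p q : k[X][X], bivEval (algebraMap k K) w θ q ∉ V.nonunits ∧
        y * bivEval (algebraMap k K) w θ q = bivEval (algebraMap k K) w θ p := by
  have hdiv : ∀ a ∈ V.nonunits, ∃ c ∈ V, a = w * c := by
    intro a ha
    obtain ⟨haV, ha'⟩ := ValuationSubring.mem_nonunits_iff_exists_mem_maximalIdeal.1 ha
    rw [hw, Ideal.mem_span_singleton] at ha'
    obtain ⟨c, hc⟩ := ha'
    exact ⟨c, c.2, congrArg Subtype.val hc⟩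
  have hwn : w ∈ V.nonunits := by
    rw [ValuationSubring.mem_nonunits_iff_exists_mem_maximalIdeal, hw]
    exact ⟨hwV, Ideal.mem_span_singleton_self _⟩
  have hw0 : w ≠ 0 := by
    rintro rfl
    obtain ⟨x, hx⟩ := hV.exists_notMem
    obtain ⟨c, -, hc⟩ := hdiv _ (inv_mem_nonunits_of_notMem V hx)
    rw [zero_mul, inv_eq_zero] at hc
    exact hx (hc ▸ V.zero_mem)
  have hwt : Transcendental k w := by
    have h1 : w⁻¹ ∉ V := by
      rw [ValuationSubring.mem_nonunits_iff_or] at hwn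
      exact hwn.resolve_left hw0
    have := Transcendental.inv' (hV.transcendental_of_notMem h1)
    rwa [inv_inv] at this
  let R := Algebra.adjoin k {w}
  let A := integralClosure R K
  obtain ⟨hA1, hA2, hA3⟩ := integralClosure_adjoin_isDedekindDomain hK hwt
  obtain ⟨v, hv, hvV⟩ := hV.exists_heightOneSpectrum hwV
  let w' : R := ⟨w, Algebra.self_mem_adjoin_singleton k w⟩
  have hunr : Algebra.IsUnramifiedAt R v.asIdeal := by
    refine isUnramifiedAt_of_uniformizer (k := k) (K := K) v (w := w') ?_ ((hv _).2 hwn)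
    rw [hvV]
    exact fun a ha => hdiv _ ((hv a).1 ha)
  -- Locally, unramified algebras are quotients of standard étale ones. This provides the monic
  -- polynomial with invertible derivative and expresses all functions near the point through `w`
  -- and one further function.
  obtain ⟨s, hs, P, φ, hφ⟩ :=
    Algebra.IsUnramifiedAt.exists_hasStandardEtaleSurjectionOn (R := R) v.asIdeal
  have hsV : (s : K) ≠ 0 ∧ (s : K)⁻¹ ∈ V := by
    rw [hv, ValuationSubring.mem_nonunits_iff_or, not_or, not_not] at hs
    exact hs
  have hAV : ∀ a : A, (a : K) ∈ V := fun a => hV.mem_of_isIntegral_adjoin hwV a.2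
  have hsu : IsUnit (IsScalarTower.toAlgHom R A K s) := isUnit_iff_ne_zero.2 hsV.1
  let ψ : Localization.Away s →ₐ[R] K := IsLocalization.Away.liftAlgHom s hsu
  have hψ : ∀ a : A, ψ (algebraMap A _ a) = a := fun a => IsLocalization.Away.lift_eq s hsu a
  have hψV : ∀ z, ψ z ∈ V := by
    intro z
    obtain ⟨n, a, hna⟩ := IsLocalization.Away.surj s z
    have h1 := congrArg ψ hna
    rw [map_mul, map_pow, hψ, hψ] at h1
    rw [← mul_inv_cancel_right₀ (pow_ne_zero n hsV.1) (ψ z), h1, ← inv_pow]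
    exact V.mul_mem _ _ (hAV a) (pow_mem hsV.2 n)
  let Ψ : P.Ring →ₐ[R] K := ψ.comp φ
  have hΨV : ∀ z, Ψ z ∈ V := fun z => hψV _
  have hΨu : ∀ z, IsUnit z → Ψ z ∉ V.nonunits := by
    rintro _ ⟨z, rfl⟩
    rw [ValuationSubring.mem_nonunits_iff_or, not_or, not_not]
    have h1 : Ψ z * Ψ (z⁻¹ : P.Ringˣ) = 1 := by rw [← map_mul, Units.mul_inv, map_one]
    refine ⟨left_ne_zero_of_mul_eq_one h1, ?_⟩
    rw [inv_eq_of_mul_eq_one_right h1]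
    exact hΨV _
  let θ : K := Ψ P.X
  let π : k[X] →+* R := (aeval w).toRingHom.codRestrict R.toSubring fun p => by
    have : aeval w p ∈ (aeval (R := k) w).range := ⟨p, rfl⟩
    rwa [← Algebra.adjoin_singleton_eq_range_aeval] at this
  have hπ : Function.Surjective π := by
    rintro ⟨y, hy⟩
    have hy' : y ∈ (aeval (R := k) w).range := by
      rwa [← Algebra.adjoin_singleton_eq_range_aeval]
    obtain ⟨p, hp⟩ := hy'
    exact ⟨p, Subtype.ext hp⟩
  have hbiv : ∀ p : k[X][X], bivEval (algebraMap k K) w θ p = Ψ (aeval P.X (p.map π)) := by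
    intro p
    rw [← aeval_algHom_apply, aeval_def, eval₂_map, bivEval, coe_eval₂RingHom]
    rfl
  have hlift : ∀ p : R[X], ∃ p₀ : k[X][X], bivEval (algebraMap k K) w θ p₀ = Ψ (aeval P.X p) := by
    intro p
    obtain ⟨p₀, rfl⟩ := Polynomial.map_surjective π hπ p
    exact ⟨p₀, hbiv p₀⟩
  obtain ⟨F, hF, -, hFm⟩ := lifts_and_natDegree_eq_and_monic
    ((mem_lifts P.f).2 (Polynomial.map_surjective π hπ P.f)) P.monic_f
  let SP : StandardEtalePresentation R P.Ring :=
    ⟨P, P.X, P.hasMap_X, by rw [P.lift_X_left]; exact Function.bijective_id⟩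
  have hfrac : ∀ a : A, ∃ (p : k[X][X]) (n : ℕ),
      (a : K) * Ψ (aeval P.X P.g) ^ n = bivEval (algebraMap k K) w θ p := by
    intro a
    obtain ⟨z, hz⟩ := hφ (algebraMap A _ a)
    obtain ⟨p, n, hpn⟩ := SP.exists_mul_aeval_x_g_pow_eq_aeval_x z
    obtain ⟨p₀, hp₀⟩ := hlift p
    refine ⟨p₀, n, ?_⟩
    have h1 := congrArg Ψ hpn
    rw [map_mul, map_pow] at h1
    rw [hp₀, ← hψ a, ← hz]
    exact h1
  obtain ⟨G, hG⟩ := hlift P.g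
  have hGu : bivEval (algebraMap k K) w θ G ∉ V.nonunits := hG ▸ hΨu _ P.hasMap_X.2
  refine ⟨θ, F, hΨV _, hFm, ?_, ?_, fun y hy => ?_⟩
  · rw [hbiv, hF, P.hasMap_X.1, map_zero]
  · rw [hbiv, ← derivative_map, hF]
    exact hΨu _ P.hasMap_X.isUnit_derivative_f
  · obtain ⟨a, c, hc, hac⟩ := exists_frac_of_heightOneSpectrum v (hvV ▸ hy : y ∈ (v.valuation K).valuationSubring)
    obtain ⟨p, n, hp⟩ := hfrac a
    obtain ⟨q, m, hq⟩ := hfrac c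
    rw [← hG] at hp hq
    have hcV : (c : K) ∉ V.nonunits := (hv c).not.1 hc
    have hmul : ∀ {a b : K}, a ∉ V.nonunits → b ∉ V.nonunits → a * b ∉ V.nonunits := by
      intro a b ha hb
      rw [ValuationSubring.mem_nonunits_iff_or, not_or, not_not] at ha hb ⊢
      exact ⟨mul_ne_zero ha.1 hb.1, mul_inv a b ▸ V.mul_mem _ _ ha.2 hb.2⟩
    have hpow : ∀ n : ℕ, bivEval (algebraMap k K) w θ G ^ n ∉ V.nonunits := by
      intro n
      induction n with
      | zero =>
        rw [pow_zero, ValuationSubring.mem_nonunits_iff_or, not_or, not_not, inv_one]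
        exact ⟨one_ne_zero, V.one_mem⟩
      | succ n ih => exact pow_succ (bivEval (algebraMap k K) w θ G) n ▸ hmul ih hGu
    refine ⟨p * G ^ m, q * G ^ n, ?_, ?_⟩
    · rw [map_mul, map_pow, ← hq]
      exact hmul (hmul hcV (hpow m)) (hpow n)
    · rw [map_mul, map_pow, ← hq, map_mul, map_pow, ← hp]
      have : y * (c : K) = a := hac
      rw [← this]
      ring

end LocalStructure

end PolyFamily

/-! ### Absolute values on the completions and growth of factorials. -/

namespace PolyFamily

/-- By Ostrowski's theorem the restriction to `ℚ` is trivial or a power of a `p`-adic absolute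
value. In the second case the `p`-adic valuations of `n` and, by Legendre's formula, of `n!` are at
most `n`, so the denominators grow at most geometrically. -/
theorem exists_factorialBound_of_isNonarchimedean {L : Type*} [NormedField L] [CharZero L]
    (h : ∀ n : ℕ, ‖(n : L)‖ ≤ 1) : ∃ C, FactorialBound L C := by
  let a : AbsoluteValue ℚ ℝ :=
    (NormedField.toAbsoluteValue L).comp (f := algebraMap ℚ L) (algebraMap ℚ L).injective
  have ha : ∀ n : ℕ, a n = ‖(n : L)‖ := fun n => by
    change ‖algebraMap ℚ L n‖ = _
    rw [map_natCast]
  by_cases hn : a.IsNontrivial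
  · obtain ⟨p, ⟨hp, hpa⟩, -⟩ := Rat.AbsoluteValue.equiv_padic_of_bounded hn fun n => (ha n).trans_le (h n)
    obtain ⟨c, hc, hac⟩ := Rat.AbsoluteValue.exists_nat_rpow_iff_isEquiv.2 hpa.symm
    have hp1 : (1 : ℝ) < p := by exact_mod_cast hp.out.one_lt
    have key : ∀ m n : ℕ, m ≠ 0 → padicValNat p m ≤ n → ‖(m : L)⁻¹‖ ≤ ((p : ℝ) ^ c) ^ n := by
      intro m n hm hmn
      rw [norm_inv, ← ha, ← hac, Rat.AbsoluteValue.padic_eq_padicNorm,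
        padicNorm.eq_zpow_of_nonzero (by exact_mod_cast hm), padicValRat.of_nat]
      rw [Rat.cast_zpow, Rat.cast_natCast, zpow_neg, zpow_natCast, ← Real.inv_rpow (by positivity), inv_inv,
        ← Real.rpow_natCast, ← Real.rpow_natCast, ← Real.rpow_mul (by positivity),
        ← Real.rpow_mul (by positivity)]
      apply Real.rpow_le_rpow_of_exponent_le hp1.le
      rw [mul_comm]
      gcongr
    refine ⟨(p : ℝ) ^ c, ⟨Real.one_le_rpow hp1.le hc.le, fun n hn0 => key n n hn0 ?_,
      fun n => key _ n n.factorial_ne_zero ?_⟩⟩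
    · exact (padicValNat_le_nat_log n).trans (Nat.log_le_self p n)
    · have h1 := sub_one_mul_padicValNat_factorial (p := p) n
      have h2 : 1 ≤ p - 1 := by have := hp.out.two_le; omega
      calc padicValNat p n.factorial = 1 * padicValNat p n.factorial := (one_mul _).symm
        _ ≤ (p - 1) * padicValNat p n.factorial := Nat.mul_le_mul_right _ h2
        _ ≤ n := by omega
  · have key : ∀ m : ℕ, m ≠ 0 → ‖(m : L)⁻¹‖ ≤ 1 := by
      intro m hm
      rw [norm_inv, ← ha]
      have : a m = 1 := by
        by_contra h1
        exact hn ⟨m, by exact_mod_cast hm, h1⟩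
      rw [this, inv_one]
    exact ⟨1, le_rfl, fun n hn0 => by simpa using key n hn0,
      fun n => by simpa using key _ n.factorial_ne_zero⟩

namespace PlaceExtension

variable {k : Type*} [Field k] [NumberField k] (e : PlaceExtension k)

theorem norm_emb (v : Place k) (x : AlgebraicClosure k) : ‖e.emb v x‖ = e.abv v x := by
  change ‖((WithAbs.equiv (e.abv v)).symm x : (e.abv v).Completion)‖ = _
  rw [UniformSpace.Completion.norm_coe]
  rfl

theorem norm_toComplex (v : InfinitePlace k) (x : e.Cv (.inl v)) : ‖e.toComplex v x‖ = ‖x‖ := by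
  have h1 := (InfinitePlace.Completion.isometry_extensionEmbedding (e.inf v)).norm_map_of_map_zero
    (map_zero _) ((InfinitePlace.Completion.equiv (e.inf v)).symm x)
  exact h1

theorem abv_algebraMap (v : Place k) (c : k) :
    e.abv v (algebraMap k (AlgebraicClosure k) c) = v.abv c := by
  rcases v with v | v
  · change (e.inf v) (algebraMap k (AlgebraicClosure k) c) = v c
    conv_rhs => rw [← e.inf_comap v]
    rfl
  · exact e.fin_apply v c

theorem norm_natCast_le_one (v : FinitePlace k) (n : ℕ) : ‖(n : e.Cv (.inr v))‖ ≤ 1 := by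
  rw [← map_natCast (e.emb (.inr v)), e.norm_emb, ← map_natCast (algebraMap k (AlgebraicClosure k)),
    e.abv_algebraMap]
  have := FinitePlace.isNonarchimedean v
  exact IsNonarchimedean.apply_natCast_le_one this

instance (v : Place k) : CharZero (e.Cv v) :=
  charZero_of_injective_ringHom (e.emb v).injective

theorem exists_factorialBound (v : Place k) : ∃ C, FactorialBound (e.Cv v) C := by
  rcases v with v | v
  · have h : ∀ n : ℕ, ‖((n : e.Cv (.inl v)))⁻¹‖ = ‖(n : ℂ)⁻¹‖ := fun n => by
      rw [← e.norm_toComplex, map_inv₀, map_natCast]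
    refine ⟨1, le_rfl, fun n hn => ?_, fun n => ?_⟩
    · rw [h]
      exact factorialBound_complex.inv n hn
    · rw [h]
      exact factorialBound_complex.inv_factorial n
  · exact exists_factorialBound_of_isNonarchimedean (e.norm_natCast_le_one v)

theorem tendsto_toComplex {α : Type*} {l : Filter α} {v : InfinitePlace k} {u : α → e.Cv (.inl v)}
    {z : e.Cv (.inl v)} (h : Tendsto u l (𝓝 z)) :
    Tendsto (fun t => e.toComplex v (u t)) l (𝓝 (e.toComplex v z)) :=
  ((AddMonoidHomClass.isometry_of_norm (e.toComplex v) (e.norm_toComplex v)).continuous.tendsto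
    z).comp h

end PlaceExtension

/-! ### Simple roots in rings of power series. -/

section Hensel

variable {k κ L : Type*} [Field k] [Field κ] [NormedField L] {ι : k →+* κ} {a : κ} {F : k[X][X]}

theorem constantCoeff_bivEval (y : PowerSeries κ) :
    PowerSeries.constantCoeff (bivEval ((PowerSeries.C (R := κ)).comp ι) PowerSeries.X y F) =
      bivEval ι 0 (PowerSeries.constantCoeff y) F := by
  rw [map_bivEval, PowerSeries.constantCoeff_X]
  congr 2

/-- Hensel's lemma in the `X`-adically complete ring of power series lifts the simple root `a`. -/
theorem exists_powerSeries_root (hF : F.Monic) (h0 : bivEval ι 0 a F = 0)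
    (h1 : bivEval ι 0 a (derivative F) ≠ 0) :
    ∃ Θ : PowerSeries κ, PowerSeries.constantCoeff Θ = a ∧
      bivEval ((PowerSeries.C (R := κ)).comp ι) PowerSeries.X Θ F = 0 := by
  let φ : k[X] →+* PowerSeries κ := eval₂RingHom ((PowerSeries.C (R := κ)).comp ι) PowerSeries.X
  have h2 : (F.map φ).eval (PowerSeries.C a) ∈ Ideal.span {(PowerSeries.X : PowerSeries κ)} := by
    rw [Ideal.mem_span_singleton, PowerSeries.X_dvd_iff, ← bivEval_eq_eval, constantCoeff_bivEval,
      PowerSeries.constantCoeff_C, h0]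
  have h3 : IsUnit (Ideal.Quotient.mk (Ideal.span {(PowerSeries.X : PowerSeries κ)})
      ((F.map φ).derivative.eval (PowerSeries.C a))) := by
    apply IsUnit.map
    rw [derivative_map, ← bivEval_eq_eval, PowerSeries.isUnit_iff_constantCoeff,
      constantCoeff_bivEval, PowerSeries.constantCoeff_C]
    exact isUnit_iff_ne_zero.2 h1
  obtain ⟨Θ, hΘ, hΘa⟩ := HenselianRing.is_henselian (F.map φ) (hF.map φ) (PowerSeries.C a) h2 h3
  refine ⟨Θ, ?_, ?_⟩
  · rw [Ideal.mem_span_singleton, PowerSeries.X_dvd_iff, map_sub, PowerSeries.constantCoeff_C,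
      sub_eq_zero] at hΘa
    exact hΘa
  · rw [bivEval_eq_eval]
    exact hΘ

theorem bivEval_mem_convergentSeries {j : κ →+* L} {Θ : PowerSeries κ}
    (hΘ : Θ ∈ convergentSeries j) (F : k[X][X]) :
    bivEval ((PowerSeries.C (R := κ)).comp ι) PowerSeries.X Θ F ∈ convergentSeries j :=
  bivEval_mem (fun c => C_mem_convergentSeries (ι c)) X_mem_convergentSeries hΘ F

/-- Taylor expansion of `F` at the constant term `a` makes `Θ - a` a simple root of a polynomial
with convergent coefficients. Nothing is required of `j`, so one and the same series converges at
every place. -/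
theorem mem_convergentSeries_of_bivEval_eq_zero (j : κ →+* L) {Θ : PowerSeries κ}
    (hΘ : bivEval ((PowerSeries.C (R := κ)).comp ι) PowerSeries.X Θ F = 0)
    (h1 : bivEval ι 0 (PowerSeries.constantCoeff Θ) (derivative F) ≠ 0) :
    Θ ∈ convergentSeries j := by
  set a := PowerSeries.constantCoeff Θ with ha
  have hn : 0 < F.natDegree := by
    by_contra hn
    rw [derivative_of_natDegree_zero (by omega), map_zero] at h1
    exact h1 rfl
  obtain ⟨n, hn⟩ : ∃ n, F.natDegree = n + 1 := ⟨F.natDegree - 1, by omega⟩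
  have h2 := bivEval_add (ι := (PowerSeries.C (R := κ)).comp ι) (x := PowerSeries.X)
    (y := PowerSeries.C a) (s := Θ - PowerSeries.C a) F
  rw [add_sub_cancel, hΘ, hn, Finset.sum_range_succ', Finset.sum_range_succ'] at h2
  have h3 : Θ - PowerSeries.C a ∈ convergentSeries j := by
    refine mem_convergentSeries_of_root (n := n)
      (c := fun i => bivEval ((PowerSeries.C (R := κ)).comp ι) PowerSeries.X (PowerSeries.C a)
        (hasseDeriv i F)) (fun i => bivEval_mem_convergentSeries (C_mem_convergentSeries _) _)
      ?_ ?_ (by simp [ha]) ?_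
    · have h4 : bivEval ι 0 a F = 0 := by rw [ha, ← constantCoeff_bivEval, hΘ, map_zero]
      rw [constantCoeff_bivEval, PowerSeries.constantCoeff_C, hasseDeriv_zero', h4]
    · rw [constantCoeff_bivEval, PowerSeries.constantCoeff_C, hasseDeriv_one']
      exact h1
    · rw [h2]
      ring
  have h4 := add_mem h3 (C_mem_convergentSeries a)
  rwa [sub_add_cancel] at h4

theorem NormBound.X {j : κ →+* L} {r : ℝ} (hr : 0 ≤ r) :
    NormBound j r (PowerSeries.X : PowerSeries κ) r := by
  intro N
  refine (partialNorm_mono hr N.le_succ _).trans ?_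
  rw [← mul_one (PowerSeries.X : PowerSeries κ), partialNorm_succ_X_mul]
  exact mul_le_of_le_one_right hr (partialNorm_one_le N)

/-- Uniqueness of a root of a polynomial near a simple root. -/
theorem eventually_eq_of_bivEval_eq_zero {ι : k →+* L} {α : Type*} {l : Filter α} {x a b : α → L}
    {a₀ : L} (hx : Tendsto x l (𝓝 0)) (ha : Tendsto a l (𝓝 a₀)) (hb : Tendsto b l (𝓝 a₀))
    (h1 : bivEval ι 0 a₀ (derivative F) ≠ 0) (hFa : ∀ᶠ t in l, bivEval ι (x t) (a t) F = 0)
    (hFb : ∀ᶠ t in l, bivEval ι (x t) (b t) F = 0) : ∀ᶠ t in l, a t = b t := by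
  have hn : 0 < F.natDegree := by
    by_contra hn
    rw [derivative_of_natDegree_zero (by omega), map_zero] at h1
    exact h1 rfl
  have hs : Tendsto (fun t => a t - b t) l (𝓝 0) := by simpa using ha.sub hb
  -- The difference quotient of `F` between the two roots tends to the derivative at the common
  -- limit, so it is eventually nonzero.
  have h2 : Tendsto (fun t => ∑ i ∈ Finset.range F.natDegree,
      bivEval ι (x t) (b t) (hasseDeriv (i + 1) F) * (a t - b t) ^ i) l
      (𝓝 (∑ i ∈ Finset.range F.natDegree, bivEval ι 0 a₀ (hasseDeriv (i + 1) F) * 0 ^ i)) :=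
    tendsto_finsetSum _ fun i _ => (tendsto_bivEval hx hb _).mul (hs.pow i)
  have h3 : ∑ i ∈ Finset.range F.natDegree, bivEval ι 0 a₀ (hasseDeriv (i + 1) F) * 0 ^ i =
      bivEval ι 0 a₀ (derivative F) := by
    rw [Finset.sum_eq_single_of_mem 0 (Finset.mem_range.2 hn), pow_zero, mul_one, zero_add,
      hasseDeriv_one']
    intro i _ hi
    rw [zero_pow hi, mul_zero]
  rw [h3] at h2
  filter_upwards [h2.eventually_ne h1, hFa, hFb] with t h4 h5 h6
  have h7 := bivEval_add (ι := ι) (x := x t) (y := b t) (s := a t - b t) F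
  rw [add_sub_cancel, h5, Finset.sum_range_succ', hasseDeriv_zero', h6, zero_mul, add_zero] at h7
  have h8 : (∑ i ∈ Finset.range F.natDegree,
      bivEval ι (x t) (b t) (hasseDeriv (i + 1) F) * (a t - b t) ^ i) * (a t - b t) = 0 := by
    rw [h7, Finset.sum_mul]
    exact Finset.sum_congr rfl fun i _ => by ring
  exact sub_eq_zero.1 ((mul_eq_zero.1 h8).resolve_left h4)

variable [CompleteSpace L]

theorem NormBound.evalAt_bivEval {j : κ →+* L} {r B : ℝ} {x : L} {G : PowerSeries κ} (hr : 0 ≤ r)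
    (hx : ‖x‖ ≤ r) (hG : NormBound j r G B) (F : k[X][X]) :
    evalAt j x (bivEval ((PowerSeries.C (R := κ)).comp ι) PowerSeries.X G F) =
      bivEval (j.comp ι) x (evalAt j x G) F := by
  let S := boundedSeries j r hr
  let c : κ →+* S := (PowerSeries.C (R := κ)).codRestrict S fun a =>
    mem_boundedSeries.2 ⟨_, NormBound.C a⟩
  have h1 := map_bivEval (ι := c.comp ι) (x := ⟨PowerSeries.X, mem_boundedSeries.2 ⟨r, NormBound.X hr⟩⟩)
    (y := ⟨G, mem_boundedSeries.2 ⟨B, hG⟩⟩) S.subtype F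
  have h2 := map_bivEval (ι := c.comp ι) (x := ⟨PowerSeries.X, mem_boundedSeries.2 ⟨r, NormBound.X hr⟩⟩)
    (y := ⟨G, mem_boundedSeries.2 ⟨B, hG⟩⟩) (evalHom j hr hx) F
  have h3 : S.subtype.comp (c.comp ι) = (PowerSeries.C (R := κ)).comp ι := rfl
  have h4 : (evalHom j hr hx).comp (c.comp ι) = j.comp ι := by
    ext a
    exact evalAt_C (ι a)
  have h5 : evalHom j hr hx ⟨PowerSeries.X, mem_boundedSeries.2 ⟨r, NormBound.X hr⟩⟩ = x := evalAt_X
  rw [h3] at h1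
  rw [h4, h5] at h2
  refine Eq.trans ?_ h2
  change _ = evalAt j x (S.subtype _)
  rw [h1]
  rfl

end Hensel

end PolyFamily

namespace PolyFamily

/-! ### Residue fields and continuity of values. -/

namespace CurvePoint

section

variable {k K L : Type*} [Field k] [Field K] [Algebra k K] [Field L] {ι : k →+* L}

theorem bivEval_mem_localRing (t : CurvePoint K ι) {x y : K} (hx : x ∈ t.localRing)
    (hy : y ∈ t.localRing) (F : k[X][X]) : bivEval (algebraMap k K) x y F ∈ t.localRing :=
  bivEval_mem (S := t.localRing.toSubring) t.algebraMap_mem hx hy F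

theorem value_bivEval (t : CurvePoint K ι) {x y : K} (hx : x ∈ t.localRing)
    (hy : y ∈ t.localRing) (F : k[X][X]) :
    t.value (bivEval (algebraMap k K) x y F) = bivEval ι (t.value x) (t.value y) F := by
  let c : k →+* t.localRing := (algebraMap k K).codRestrict t.localRing.toSubring t.algebraMap_mem
  have h1 := map_bivEval (ι := c) (x := ⟨x, hx⟩) (y := ⟨y, hy⟩) t.localRing.subtype F
  have h2 := map_bivEval (ι := c) (x := ⟨x, hx⟩) (y := ⟨y, hy⟩) t.residue F
  have h3 : t.residue.comp c = ι := by
    ext a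
    exact t.residue_algebraMap a
  rw [h3, ← t.value_of_mem hx, ← t.value_of_mem hy] at h2
  rw [← h2, t.value_of_mem (t.bivEval_mem_localRing hx hy F)]
  congr 1
  exact Subtype.ext h1.symm

/-- The residue field of a point as an extension of the ground field. -/
noncomputable def baseMap (t : CurvePoint K ι) : k →+* IsLocalRing.ResidueField t.localRing :=
  (IsLocalRing.residue t.localRing).comp
    ((algebraMap k K).codRestrict t.localRing.toSubring t.algebraMap_mem)

/-- A point with its residue field as field of values. -/
noncomputable def residuePoint (t : CurvePoint K ι) : CurvePoint K t.baseMap where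
  localRing := t.localRing
  residue := IsLocalRing.residue t.localRing
  isLocalHom_residue := inferInstance
  algebraMap_mem := t.algebraMap_mem
  residue_algebraMap _ := rfl

/-- The embedding of the residue field of a point. -/
noncomputable def residueEmb (t : CurvePoint K ι) : IsLocalRing.ResidueField t.localRing →+* L :=
  have := t.isLocalHom_residue
  IsLocalRing.ResidueField.lift t.residue

theorem residueEmb_value (t : CurvePoint K ι) (x : K) :
    t.residueEmb (t.residuePoint.value x) = t.value x := by
  have := t.isLocalHom_residue
  by_cases hx : x ∈ t.localRing
  · rw [t.value_of_mem hx, t.residuePoint.value_of_mem hx]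
    rfl
  · rw [t.value_of_notMem hx, t.residuePoint.value_of_notMem hx, map_zero]

theorem residueEmb_mem_range (t : CurvePoint K ι) (x : IsLocalRing.ResidueField t.localRing) :
    t.residueEmb x ∈ t.residue.range := by
  obtain ⟨y, rfl⟩ := IsLocalRing.residue_surjective x
  exact ⟨y, rfl⟩

theorem residueEmb_comp (t : CurvePoint K ι) :
    t.residueEmb.comp t.baseMap = ι := by
  ext c
  exact t.residue_algebraMap c

variable [TopologicalSpace L]

theorem eventually_value_mem (t : CurvePoint K ι) {x : K} (hx : x ∈ t.localRing) {V : Set L}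
    (hV : V ∈ 𝓝 (t.value x)) : ∀ᶠ s in 𝓝 t, x ∈ s.localRing ∧ s.value x ∈ V := by
  obtain ⟨W, hWV, hW, htW⟩ := mem_nhds_iff.1 hV
  have h1 : IsOpen {s : CurvePoint K ι | x ∈ s.localRing ∧ s.value x ∈ W} :=
    TopologicalSpace.isOpen_generateFrom_of_mem ⟨x, W, hW, rfl⟩
  filter_upwards [h1.mem_nhds (show t ∈ _ from ⟨hx, htW⟩)] with s hs
  exact ⟨hs.1, hWV hs.2⟩

theorem eventually_mem_localRing (t : CurvePoint K ι) {x : K} (hx : x ∈ t.localRing) :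
    ∀ᶠ s in 𝓝 t, x ∈ s.localRing :=
  (t.eventually_value_mem hx univ_mem).mono fun _ h => h.1

theorem tendsto_value (t : CurvePoint K ι) {x : K} (hx : x ∈ t.localRing) :
    Tendsto (fun s : CurvePoint K ι => s.value x) (𝓝 t) (𝓝 (t.value x)) :=
  fun _ hV => (t.eventually_value_mem hx hV).mono fun _ h => h.2

end

end CurvePoint

section Norm

variable {κ L L' : Type*} [Field κ] [NormedField L] [NormedField L'] {j : κ →+* L} {j' : κ →+* L'}

theorem convergentSeries_eq_of_norm_eq (h : ∀ c, ‖j c‖ = ‖j' c‖) :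
    convergentSeries j = convergentSeries j' := by
  have h1 : ∀ r N G, partialNorm j r N G = partialNorm j' r N G := fun r N G =>
    Finset.sum_congr rfl fun n _ => by rw [h]
  ext G
  simp only [mem_convergentSeries, NormBound, h1]

end Norm

section RootExpansion

variable {k κ L : Type*} [Field k] [Field κ] [NormedField L] {ι : k →+* κ} {j : κ →+* L}
  {Θ : PowerSeries κ} {F p q : k[X][X]}

variable (ι) in
/-- The power series `p(X, Θ) / q(X, Θ)`. -/
noncomputable def rootExpansion (Θ : PowerSeries κ) (p q : k[X][X]) : PowerSeries κ :=
  bivEval ((PowerSeries.C (R := κ)).comp ι) PowerSeries.X Θ p *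
    (bivEval ((PowerSeries.C (R := κ)).comp ι) PowerSeries.X Θ q)⁻¹

theorem constantCoeff_rootExpansion : PowerSeries.constantCoeff (rootExpansion ι Θ p q) =
    bivEval ι 0 (PowerSeries.constantCoeff Θ) p *
      (bivEval ι 0 (PowerSeries.constantCoeff Θ) q)⁻¹ := by
  rw [rootExpansion, map_mul, PowerSeries.constantCoeff_inv, constantCoeff_bivEval,
    constantCoeff_bivEval]

theorem rootExpansion_mem_convergentSeries (hΘ : Θ ∈ convergentSeries j) :
    rootExpansion ι Θ p q ∈ convergentSeries j :=
  mul_mem (bivEval_mem_convergentSeries hΘ p)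
    (inv_mem_convergentSeries (bivEval_mem_convergentSeries hΘ q))

/-- The actual value `a` and the sum of `Θ` are roots of the same polynomial tending to the same
simple root, so they agree eventually; the quotient of `p` by `q` is then the same on both sides. -/
theorem eventually_eq_evalAt_rootExpansion [CompleteSpace L] (hΘj : Θ ∈ convergentSeries j)
    (hΘ : bivEval ((PowerSeries.C (R := κ)).comp ι) PowerSeries.X Θ F = 0)
    (h1 : bivEval ι 0 (PowerSeries.constantCoeff Θ) (derivative F) ≠ 0)
    (hq : bivEval ι 0 (PowerSeries.constantCoeff Θ) q ≠ 0) {α : Type*} {l : Filter α}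
    {x a y : α → L} (hx : Tendsto x l (𝓝 0))
    (ha : Tendsto a l (𝓝 (j (PowerSeries.constantCoeff Θ))))
    (hF : ∀ᶠ t in l, bivEval (j.comp ι) (x t) (a t) F = 0)
    (hpq : ∀ᶠ t in l, y t * bivEval (j.comp ι) (x t) (a t) q = bivEval (j.comp ι) (x t) (a t) p) :
    ∀ᶠ t in l, y t = evalAt j (x t) (rootExpansion ι Θ p q) := by
  have hb := tendsto_evalAt hΘj hx
  have hxn := hx.norm
  rw [norm_zero] at hxn
  have hev : ∀ G : k[X][X], ∀ᶠ t in l,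
      evalAt j (x t) (bivEval ((PowerSeries.C (R := κ)).comp ι) PowerSeries.X Θ G) =
        bivEval (j.comp ι) (x t) (evalAt j (x t) Θ) G := by
    intro G
    obtain ⟨r, hr, C, hC⟩ := mem_convergentSeries.1 hΘj
    filter_upwards [hxn.eventually_lt_const hr] with t ht
    exact hC.evalAt_bivEval hr.le ht.le G
  have hbiv0 : ∀ G : k[X][X], bivEval (j.comp ι) 0 (j (PowerSeries.constantCoeff Θ)) G =
      j (bivEval ι 0 (PowerSeries.constantCoeff Θ) G) := fun G => by
    rw [map_bivEval, map_zero]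
  have heq := eventually_eq_of_bivEval_eq_zero hx ha hb
    (by rw [hbiv0]; exact (map_ne_zero j).2 h1) hF
    (by
      filter_upwards [hev F] with t h2
      rw [← h2, hΘ]
      simp [evalAt])
  have hqne : ∀ᶠ t in l, bivEval (j.comp ι) (x t) (a t) q ≠ 0 := by
    refine (tendsto_bivEval hx ha q).eventually_ne ?_
    rw [hbiv0]
    exact (map_ne_zero j).2 hq
  have hmul : ∀ᶠ t in l, evalAt j (x t) (rootExpansion ι Θ p q) *
      evalAt j (x t) (bivEval ((PowerSeries.C (R := κ)).comp ι) PowerSeries.X Θ q) =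
        evalAt j (x t) (bivEval ((PowerSeries.C (R := κ)).comp ι) PowerSeries.X Θ p) := by
    obtain ⟨r₁, hr₁, C₁, hC₁⟩ := mem_convergentSeries.1
      (rootExpansion_mem_convergentSeries (ι := ι) (p := p) (q := q) hΘj)
    obtain ⟨r₂, hr₂, C₂, hC₂⟩ := mem_convergentSeries.1
      (bivEval_mem_convergentSeries (ι := ι) hΘj q)
    filter_upwards [hxn.eventually_lt_const (lt_min hr₁ hr₂)] with t ht
    have hr := (lt_min hr₁ hr₂).le
    rw [← (hC₁.mono_radius hr (min_le_left _ _)).evalAt_mul hr ht.le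
      (hC₂.mono_radius hr (min_le_right _ _)), rootExpansion, mul_assoc,
      PowerSeries.inv_mul_cancel _ (by rwa [constantCoeff_bivEval]), mul_one]
  filter_upwards [heq, hqne, hmul, hev p, hev q, hpq] with t h4 h5 h6 h7 h8 h9
  rw [h7, h8, ← h4] at h6
  exact mul_right_cancel₀ h5 (h9.trans h6.symm)

end RootExpansion

/-! ### Expansions of functions at a geometric point. -/

section Expansion

variable {k K : Type*} [Field k] [NumberField k] [Field K] [Algebra k K] (e : PlaceExtension k)

namespace PlaceExtension

/-- The embedding of the residue field of `β` into `k̄_v`. -/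
noncomputable def residueEmb (v : Place k) (β : GeomPoint k K) :
    IsLocalRing.ResidueField β.localRing →+* e.Cv v := (e.emb v).comp (CurvePoint.residueEmb β)

/-- The embedding of the residue field of `β` into `ℂ` given by an infinite place. -/
noncomputable def residueEmbComplex (v : InfinitePlace k) (β : GeomPoint k K) :
    IsLocalRing.ResidueField β.localRing →+* ℂ := (e.toComplex v).comp (e.residueEmb (.inl v) β)

theorem residueEmb_value (v : Place k) (β : GeomPoint k K) (x : K) :
    e.residueEmb v β ((CurvePoint.residuePoint β).value x) = (e.ofGeom v β).value x := by
  rw [ofGeom, CurvePoint.map_value]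
  exact congrArg (e.emb v) (CurvePoint.residueEmb_value β x)

theorem residueEmbComplex_value (v : InfinitePlace k) (β : GeomPoint k K) (x : K) :
    e.residueEmbComplex v β ((CurvePoint.residuePoint β).value x) =
      e.toComplex v ((e.ofGeom (.inl v) β).value x) :=
  congrArg (e.toComplex v) (e.residueEmb_value (.inl v) β x)

theorem residueEmbComplex_comp (v : InfinitePlace k) (β : GeomPoint k K) :
    (e.residueEmbComplex v β).comp (CurvePoint.baseMap β) =
      (e.toComplex v).comp ((e.emb (.inl v)).comp (algebraMap k (AlgebraicClosure k))) :=
  RingHom.ext fun c => congrArg (fun x => e.toComplex v (e.emb (.inl v) x))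
    (RingHom.congr_fun (CurvePoint.residueEmb_comp β) c)

theorem convergentSeries_residueEmbComplex (v : InfinitePlace k) (β : GeomPoint k K) :
    convergentSeries (e.residueEmbComplex v β) = convergentSeries (e.residueEmb (.inl v) β) :=
  convergentSeries_eq_of_norm_eq fun _ => e.norm_toComplex v _

theorem tendsto_toComplex_value (v : InfinitePlace k) (β : GeomPoint k K) {x : K}
    (hx : x ∈ β.localRing) :
    Tendsto (fun t : e.Pts K (.inl v) => e.toComplex v (t.value x)) (𝓝 (e.ofGeom (.inl v) β))
      (𝓝 (e.residueEmbComplex v β ((CurvePoint.residuePoint β).value x))) := by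
  rw [e.residueEmbComplex_value]
  exact e.tendsto_toComplex ((e.ofGeom (.inl v) β).tendsto_value hx)

theorem toComplex_value_bivEval (v : InfinitePlace k) (t : e.Pts K (.inl v)) {x y : K}
    (hx : x ∈ t.localRing) (hy : y ∈ t.localRing) (F : k[X][X]) :
    e.toComplex v (t.value (bivEval (algebraMap k K) x y F)) =
      bivEval ((e.toComplex v).comp ((e.emb (.inl v)).comp (algebraMap k (AlgebraicClosure k))))
        (e.toComplex v (t.value x)) (e.toComplex v (t.value y)) F := by
  rw [t.value_bivEval hx hy, map_bivEval]

/-- `G` is the expansion at `β` of `y` in powers of `w`. -/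
structure IsExpansion (β : GeomPoint k K) (w y : K)
    (G : PowerSeries (IsLocalRing.ResidueField β.localRing)) : Prop where
  mem : y ∈ β.localRing
  constantCoeff : PowerSeries.constantCoeff G = (CurvePoint.residuePoint β).value y
  convergent : ∀ v : Place k, G ∈ convergentSeries (e.residueEmb v β)
  eventually_eq : ∀ v : InfinitePlace k, ∀ᶠ t in 𝓝 (e.ofGeom (.inl v) β), y ∈ t.localRing ∧
    e.toComplex v (t.value y) = evalAt (e.residueEmbComplex v β) (e.toComplex v (t.value w)) G

/-- Functions regular at `β` are quotients of polynomials in `w` and a simple root `θ`, and `θ` is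
expanded by Hensel's lemma over the residue field. The series is thus constructed before any place
is chosen; convergence and agreement with values follow afterwards. -/
theorem exists_isExpansion (hK : IsCurveField k K) (β : GeomPoint k K) {w : K}
    (hw : β.IsUniformizer w) {y : K} (hy : y ∈ β.localRing) :
    ∃ G, e.IsExpansion β w y G := by
  obtain ⟨hwO, hw⟩ := hw
  obtain ⟨θ, F, hθ, hFm, hF0, hF1, hfrac⟩ := exists_bivEval_generator hK (β.isPlace hK) hwO hw
  obtain ⟨p, q, hq, hpq⟩ := hfrac y hy
  have hwρ : (CurvePoint.residuePoint β).value w = 0 := by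
    refine ((CurvePoint.residuePoint β).value_eq_zero_iff (x := w) hwO).2 ?_
    exact ValuationSubring.mem_nonunits_iff_exists_mem_maximalIdeal.2 ⟨hwO, hw ▸ Ideal.mem_span_singleton_self _⟩
  have hρ : ∀ G : k[X][X],
      (CurvePoint.residuePoint β).value (bivEval (algebraMap k K) w θ G) =
        bivEval (CurvePoint.baseMap β) 0 ((CurvePoint.residuePoint β).value θ) G := by
    intro G
    rw [← hwρ]
    exact (CurvePoint.residuePoint β).value_bivEval hwO hθ G
  have hρne : ∀ {G : k[X][X]}, bivEval (algebraMap k K) w θ G ∉ β.localRing.nonunits →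
      bivEval (CurvePoint.baseMap β) 0 ((CurvePoint.residuePoint β).value θ) G ≠ 0 := fun {G} h => by
    rw [← hρ]
    exact ((CurvePoint.residuePoint β).value_eq_zero_iff
      (CurvePoint.bivEval_mem_localRing _ hwO hθ G)).not.2 h
  obtain ⟨Θ, hΘa, hΘ⟩ := exists_powerSeries_root hFm
    (by rw [← hρ, hF0, CurvePoint.value_zero]) (hρne hF1)
  rw [← hΘa] at hρ hρne
  have hΘc : ∀ v : Place k, Θ ∈ convergentSeries (e.residueEmb v β) := fun v =>
    mem_convergentSeries_of_bivEval_eq_zero _ hΘ (hρne hF1)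
  refine ⟨rootExpansion (CurvePoint.baseMap β) Θ p q, hy, ?_, fun v => rootExpansion_mem_convergentSeries (hΘc v),
    fun v => ?_⟩
  · have h1 := (CurvePoint.residuePoint β).value_mul hy
      (CurvePoint.bivEval_mem_localRing (CurvePoint.residuePoint β) hwO hθ q)
    rw [hpq, hρ, hρ] at h1
    rw [constantCoeff_rootExpansion, h1, mul_inv_cancel_right₀ (hρne hq)]
  have hJι := e.residueEmbComplex_comp v β
  have hx : Tendsto (fun t : e.Pts K (.inl v) => e.toComplex v (t.value w))
      (𝓝 (e.ofGeom (.inl v) β)) (𝓝 0) := by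
    have := e.tendsto_toComplex_value v β hwO
    rwa [hwρ, map_zero] at this
  have ha := e.tendsto_toComplex_value v β hθ
  rw [← hΘa] at ha
  have hwt := (e.ofGeom (.inl v) β).eventually_mem_localRing hwO
  have hθt := (e.ofGeom (.inl v) β).eventually_mem_localRing hθ
  have hyt := (e.ofGeom (.inl v) β).eventually_mem_localRing hy
  refine hyt.and (eventually_eq_evalAt_rootExpansion
    (e.convergentSeries_residueEmbComplex v β ▸ hΘc _) hΘ (hρne hF1) (hρne hq) hx ha ?_ ?_)
  · filter_upwards [hwt, hθt] with t h1 h2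
    rw [hJι, ← e.toComplex_value_bivEval v t h1 h2, hF0, t.value_zero, map_zero]
  · filter_upwards [hwt, hθt, hyt] with t h1 h2 h3
    rw [hJι, ← e.toComplex_value_bivEval v t h1 h2, ← e.toComplex_value_bivEval v t h1 h2, ← hpq,
      t.value_mul h3 (t.bivEval_mem_localRing h1 h2 q), map_mul]

end PlaceExtension

end Expansion

end PolyFamily

namespace PolyFamily

/-! ### Rational points near the support of `D`. -/

section LocalHeights

variable {k K : Type*} [Field k] [NumberField k] [Field K] [Algebra k K] (e : PlaceExtension k)
  {f : K[X]} {P g : K} {M : ℕ}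

namespace PlaceExtension

theorem ofRat_value (v : Place k) (t : RatPoint k K) (x : K) :
    (e.ofRat v t).value x = e.emb v (algebraMap k (AlgebraicClosure k) (t.value x)) := by
  rw [ofRat, ofGeom, CurvePoint.map_value, t.toGeom_value]

theorem norm_ofRat_value (v : Place k) (t : RatPoint k K) (x : K) :
    ‖(e.ofRat v t).value x‖ = v.abv (t.value x) := by
  rw [e.ofRat_value, e.norm_emb, e.abv_algebraMap]

theorem norm_ofGeom_value (v : Place k) (β : GeomPoint k K) (x : K) :
    ‖(e.ofGeom v β).value x‖ = e.abv v (β.value x) := by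
  rw [ofGeom, CurvePoint.map_value, e.norm_emb]

theorem ofGeom_value_eq_zero (v : Place k) {β : GeomPoint k K} {x : K}
    (hx : x ∈ β.localRing.nonunits) : (e.ofGeom v β).value x = 0 :=
  ((e.ofGeom v β).value_eq_zero_iff (x := x) (ValuationSubring.nonunits_subset hx)).2 hx

theorem eventually_norm_value_lt (v : Place k) {β : GeomPoint k K} {x : K}
    (hx : x ∈ β.localRing.nonunits) {ε : ℝ} (hε : 0 < ε) :
    ∀ᶠ p in 𝓝 (e.ofGeom v β), x ∈ p.localRing ∧ ‖p.value x‖ < ε := by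
  refine (e.ofGeom v β).eventually_value_mem (x := x) (V := {y | ‖y‖ < ε})
    (ValuationSubring.nonunits_subset hx) ?_
  have h0 := (continuous_norm (E := e.Cv v)).tendsto ((e.ofGeom v β).value x)
  rw [e.ofGeom_value_eq_zero v hx, norm_zero] at h0
  rw [e.ofGeom_value_eq_zero v hx]
  exact h0.eventually_lt_const hε

/-- Near a point of the support of `D` there are no other rational points of the support. -/
theorem eventually_eq_of_mem_divisorSupport (hK : IsCurveField k K) (hd : 2 ≤ f.natDegree)
    (v : Place k) (β : GeomPoint k K) :
    ∀ᶠ p in 𝓝 (e.ofGeom v β), ∀ t : RatPoint k K, e.ofRat v t = p →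
      t.toGeom ∈ divisorSupport k f P → t.toGeom = β := by
  have h1 : ∀ V ∈ supportPlaces k f P, ∀ᶠ p in 𝓝 (e.ofGeom v β),
      V ≠ β.localRing → p.localRing ≠ V := by
    intro V hV
    by_cases hVβ : V = β.localRing
    · exact Eventually.of_forall fun p h => absurd hVβ h
    -- A function whose only pole is `V` is regular at `β`, hence at all points near `β`, which
    -- excludes `V` as their local ring.
    obtain ⟨x, hxV, hx⟩ := exists_single_pole hK hV.1
    filter_upwards [(e.ofGeom v β).eventually_mem_localRing (hx _ (β.isPlace hK) (Ne.symm hVβ))]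
      with p hp _ h
    exact hxV (h ▸ hp)
  filter_upwards [(eventually_all_finite (finite_supportPlaces hK hd)).2 h1] with p hp t htp ht
  apply RatPoint.toGeom_eq
  by_contra hne
  rw [mem_divisorSupport_iff hK] at ht
  exact hp _ ht hne (by rw [← htp]; rfl)

theorem eventually_value_ne_zero (hg0 : g ≠ 0) (v : Place k) {β : GeomPoint k K}
    (hβ : g ∉ β.localRing) : ∀ᶠ p in 𝓝 (e.ofGeom v β), ∀ t : RatPoint k K, e.ofRat v t = p →
      g ∈ t.localRing → t.value g ≠ 0 ∧ 1 < v.abv (t.value g) := by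
  filter_upwards [e.eventually_norm_value_lt v (inv_mem_nonunits_of_notMem _ hβ) one_pos]
    with p hp t htp hgt
  subst htp
  have h1 : t.value g * t.value g⁻¹ = 1 := by
    rw [← t.value_mul hgt hp.1, mul_inv_cancel₀ hg0, t.value_one]
  have h2 : t.value g ≠ 0 := left_ne_zero_of_mul_eq_one h1
  refine ⟨h2, ?_⟩
  have h3 := hp.2
  rw [e.norm_ofRat_value, eq_inv_of_mul_eq_one_right h1, map_inv₀] at h3
  exact (inv_lt_one₀ (v.abv.pos h2)).1 h3

/-- Reversing the monic polynomial `Q` of degree `n` gives `Q(g) = g ^ n * (1 + y)` with `y`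
vanishing at `β`. Close to `β` one has `|y| < 1`, so neither factor vanishes. -/
theorem eventually_value_aeval_ne_zero (hg0 : g ≠ 0) (v : Place k) {β : GeomPoint k K}
    (hβ : g ∉ β.localRing) {Q : k[X]} (hQ : Q.Monic) :
    ∀ᶠ p in 𝓝 (e.ofGeom v β), ∀ t : RatPoint k K, e.ofRat v t = p →
      g ∈ t.localRing → t.value (aeval g Q) ≠ 0 := by
  have hgi := inv_mem_nonunits_of_notMem _ hβ
  have hr : ∀ (V : ValuationSubring K), (∀ c, algebraMap k K c ∈ V) → g⁻¹ ∈ V.nonunits →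
      ∃ y ∈ V.nonunits, aeval g⁻¹ Q.reverse = 1 + y := by
    intro V hV hgV
    refine ⟨aeval g⁻¹ Q.reverse.divX * g⁻¹, ?_, ?_⟩
    · have h1 : aeval g⁻¹ Q.reverse.divX ∈ V := by
        rw [aeval_eq_sum_range]
        refine sum_mem fun i _ => ?_
        rw [Algebra.smul_def]
        exact V.mul_mem _ _ (hV _) (pow_mem (ValuationSubring.nonunits_subset hgV) _)
      obtain ⟨h2, h3⟩ := ValuationSubring.mem_nonunits_iff_exists_mem_maximalIdeal.1 hgV
      exact ValuationSubring.mem_nonunits_iff_exists_mem_maximalIdeal.2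
        ⟨V.mul_mem _ _ h1 h2, Ideal.mul_mem_left _ ⟨_, h1⟩ h3⟩
    · conv_lhs => rw [← divX_mul_X_add Q.reverse]
      rw [map_add, map_mul, aeval_X, aeval_C, coeff_zero_reverse, hQ.leadingCoeff, map_one,
        add_comm]
  obtain ⟨y, hy, hyQ⟩ := hr β.localRing β.algebraMap_mem hgi
  filter_upwards [e.eventually_value_ne_zero hg0 v hβ, e.eventually_norm_value_lt v hy one_pos]
    with p hp hpy t htp hgt
  have h1 := (hp t htp hgt).1
  subst htp
  have hyt : y ∈ t.localRing := hpy.1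
  have h2 : aeval g Q = g ^ Q.natDegree * (1 + y) := by
    have := invertibleOfNonzero hg0
    have h3 := eval₂_reverse_mul_pow (algebraMap k K) g Q
    rw [invOf_eq_inv, ← aeval_def, ← aeval_def, hyQ] at h3
    rw [← h3, mul_comm]
  rw [h2, t.value_mul (pow_mem hgt _) (t.localRing.add_mem _ _ t.localRing.one_mem hyt),
    t.value_pow hgt, t.value_add t.localRing.one_mem hyt, t.value_one]
  refine mul_ne_zero (pow_ne_zero _ h1) fun h4 => ?_
  have h5 := hpy.2
  rw [e.norm_ofRat_value, eq_neg_of_add_eq_zero_right h4, map_neg_eq_map, map_one] at h5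
  exact lt_irrefl _ h5

/-- Near a point of the support of `D`, outside of the support, `f` has good reduction and `P` is
regular. -/
theorem eventually_goodReduction (hK : IsCurveField k K) (hf : f ≠ 0) (hg0 : g ≠ 0) (v : Place k)
    {β : GeomPoint k K} (hβ : g ∉ β.localRing) {Q : k[X]} (hQ : Q.Monic)
    (hQf : ∀ i, IsIntegral (Algebra.adjoin k {g}) (aeval g Q * f.coeff i))
    (hQl : IsIntegral (Algebra.adjoin k {g}) (aeval g Q * f.leadingCoeff⁻¹))
    (hQP : IsIntegral (Algebra.adjoin k {g}) (aeval g Q * P)) :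
    ∀ᶠ p in 𝓝 (e.ofGeom v β), ∀ t : RatPoint k K, e.ofRat v t = p →
      g ∈ t.localRing → t.GoodReduction f ∧ P ∈ t.localRing ∧ t.value g ≠ 0 ∧
        t.value (aeval g Q) ≠ 0 := by
  filter_upwards [e.eventually_value_ne_zero hg0 v hβ,
    e.eventually_value_aeval_ne_zero hg0 v hβ hQ] with p hp hpQ t htp hgt
  have hQt := hpQ t htp hgt
  have hQ0 : aeval g Q ≠ 0 := by
    intro h0
    rw [h0, t.value_zero] at hQt
    exact hQt rfl
  -- `Q(g)` is a unit at `t`, so the common denominator can be removed there.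
  have hmem : ∀ x, IsIntegral (Algebra.adjoin k {g}) (aeval g Q * x) → x ∈ t.localRing := by
    intro x hx
    have h1 := t.localRing.mul_mem _ _ (t.inv_mem_of_value_ne_zero hQt)
      ((t.isPlace hK).mem_of_isIntegral_adjoin hgt hx)
    rwa [inv_mul_cancel_left₀ hQ0] at h1
  refine ⟨⟨fun i => hmem _ (hQf i), fun h0 => ?_⟩, hmem _ hQP, (hp t htp hgt).1, hQt⟩
  have h1 := t.value_mul (x := f.leadingCoeff) (y := f.leadingCoeff⁻¹) (hmem _ (hQf _)) (hmem _ hQl)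
  rw [mul_inv_cancel₀ (leadingCoeff_ne_zero.2 hf), t.value_one, h0, zero_mul] at h1
  exact one_ne_zero h1

theorem isUltrametricDist (v : FinitePlace k) : IsUltrametricDist (e.Cv (.inr v)) :=
  IsUltrametricDist.isUltrametricDist_of_forall_norm_natCast_le_one (e.norm_natCast_le_one v)

/-- Ultrametric absolute values are locally constant away from `0`; this is why finite places
contribute only constants. -/
theorem eventually_norm_value_eq (v : FinitePlace k) {β : GeomPoint k K} {x : K}
    (hx : x ∈ β.localRing) (hx0 : x ∉ β.localRing.nonunits) :
    ∀ᶠ p in 𝓝 (e.ofGeom (.inr v) β), x ∈ p.localRing ∧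
      ‖p.value x‖ = ‖(e.ofGeom (.inr v) β).value x‖ := by
  have := e.isUltrametricDist v
  have hne : (e.ofGeom (.inr v) β).value x ≠ 0 := fun h =>
    hx0 (((e.ofGeom (.inr v) β).value_eq_zero_iff (x := x) hx).1 h)
  refine (e.ofGeom (.inr v) β).eventually_value_mem hx
    (V := {y | ‖y‖ = ‖(e.ofGeom (.inr v) β).value x‖}) ?_
  filter_upwards [Metric.ball_mem_nhds _ (norm_pos_iff.2 hne)] with y hy
  rw [mem_ball_iff_norm] at hy
  set b := (e.ofGeom (.inr v) β).value x
  apply le_antisymm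
  · have h1 := IsUltrametricDist.norm_add_le_max (y - b) b
    rw [sub_add_cancel] at h1
    exact h1.trans (max_le hy.le le_rfl)
  · by_contra! h
    have h1 := IsUltrametricDist.norm_add_le_max (b - y) y
    rw [sub_add_cancel, norm_sub_rev] at h1
    exact absurd h1 (not_le.2 (max_lt hy h))

end PlaceExtension

end LocalHeights

end PolyFamily

namespace PolyFamily

/-! ### Compatibility of the escape orbit with field homomorphisms. -/

section Maps

variable {E E' : Type*} [Field E] [Field E'] (φ : E →+* E') {d : ℕ}

theorem map_escapeError (b : ℕ → E) (y : E) :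
    φ (escapeError d b y) = escapeError d (fun i => φ (b i)) (φ y) := by
  simp only [escapeError, map_sum, map_mul, map_pow]

theorem map_escapeSeq (A : E) (b : ℕ → E) (y : E) (n : ℕ) :
    φ (escapeSeq d A b y n) = escapeSeq d (φ A) (fun i => φ (b i)) (φ y) n := by
  induction n with
  | zero => rfl
  | succ n ih =>
    rw [escapeSeq, escapeSeq, map_mul, map_mul, map_pow, map_inv₀, map_add, map_one,
      map_escapeError, ih]

theorem escapeError_congr {b b' : ℕ → E} (h : ∀ i < d, b i = b' i) (y : E) :
    escapeError d b y = escapeError d b' y :=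
  Finset.sum_congr rfl fun i hi => by rw [h i (Finset.mem_range.1 hi)]

theorem escapeSeq_congr {b b' : ℕ → E} (h : ∀ i < d, b i = b' i) (A y : E) (n : ℕ) :
    escapeSeq d A b y n = escapeSeq d A b' y n := by
  induction n with
  | zero => rfl
  | succ n ih => rw [escapeSeq, escapeSeq, ih, escapeError_congr h]

end Maps

theorem NormBound.analyticAt_evalAt {κ : Type*} [Field κ] {j : κ →+* ℂ} {r B : ℝ} {x : ℂ}
    {G : PowerSeries κ} (hG : NormBound j r G B) (hx : ‖x‖ < r) :
    AnalyticAt ℂ (fun y => evalAt j y G) x := by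
  have hr : 0 ≤ r := (norm_nonneg x).trans hx.le
  have h1 := (hG.summable_norm (x := (r : ℂ)) (by simp [abs_of_nonneg hr])).1
  have h2 : DifferentiableOn ℂ (fun y => evalAt j y G) (Metric.ball 0 r) := by
    refine Complex.differentiableOn_tsum_of_summable_norm h1 (fun n => ?_) Metric.isOpen_ball
      fun n y hy => ?_
    · fun_prop
    · rw [mem_ball_zero_iff] at hy
      rw [norm_mul, norm_mul, norm_pow, norm_pow, Complex.norm_real, Real.norm_of_nonneg hr]
      gcongr
  exact h2.analyticAt (Metric.isOpen_ball.mem_nhds (mem_ball_zero_iff.2 hx))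

theorem EscapeFunctions.u_notMem_nonunits {k K : Type*} [Field k] [Field K] [Algebra k K]
    {f : K[X]} {P g : K} {M : ℕ} (E : EscapeFunctions k f P M g) (hg0 : g ≠ 0)
    {V : ValuationSubring K} (hV : V ∈ supportPlaces k f P) : E.u ∉ V.nonunits := by
  have hA0 : E.A ≠ 0 := by
    intro h0
    have := E.data.leading
    rw [h0] at this
    simp at this
  have hY0 : E.Y ≠ 0 := by
    intro h0
    have := E.iter_mul
    rw [h0, mul_zero] at this
    exact E.data.ne_zero this.symm
  rw [ValuationSubring.mem_nonunits_iff_or, not_or, not_not]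
  refine ⟨?_, E.u_inv_mem _ hV⟩
  rw [E.u_eq]
  exact mul_ne_zero (mul_ne_zero (pow_ne_zero _ hg0) hA0) (pow_ne_zero _ hY0)

/-! ### The deviation of the local height near a point of the support. -/

section LocalHeights

variable {k K : Type*} [Field k] [NumberField k] [Field K] [Algebra k K] {e : PlaceExtension k}
  {f : K[X]} {P g : K} {M : ℕ}

/-- Close to `β` the functions `A`, `b j` and `Y` have absolute value below `1`, so the error series
vanishes, while `|u|` keeps its value at `β`. -/
theorem EscapeFunctions.eventually_localCanonicalHeight_finite (E : EscapeFunctions k f P M g)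
    (hd : 2 ≤ f.natDegree) (hg0 : g ≠ 0) (v : FinitePlace k) {β : GeomPoint k K}
    (hβ : β.localRing ∈ supportPlaces k f P) (hgβ : g ∉ β.localRing) :
    ∀ᶠ p in 𝓝 (e.ofGeom (.inr v) β), ∀ t : RatPoint k K, e.ofRat (.inr v) t = p →
      t.GoodReduction f → P ∈ t.localRing → g ∈ t.localRing →
      localCanonicalHeight (.inr v) (t.specialize f) (t.value P) =
        Real.posLog (Place.abv (.inr v) (t.value g)) /
          ((f.natDegree : ℝ) ^ M * ((f.natDegree : ℝ) - 1)) -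
        Real.log (e.abv (.inr v) (β.value E.u)) /
          ((f.natDegree : ℝ) ^ E.N * ((f.natDegree : ℝ) - 1)) := by
  have hub := E.u_notMem_nonunits hg0 hβ
  filter_upwards [e.eventually_value_ne_zero hg0 _ hgβ,
    e.eventually_norm_value_lt _ (E.A_mem _ hβ) one_pos,
    e.eventually_norm_value_lt _ (E.Y_mem _ hβ) one_pos,
    (eventually_all_finset (Finset.range f.natDegree)).2 fun j hj =>
      e.eventually_norm_value_lt _ (E.b_mem _ hβ j (Finset.mem_range.1 hj)) one_pos,
    e.eventually_norm_value_eq v (E.u_mem _ hβ) hub] with p h1 hA hY hb hu t htp hgood hP hgt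
  obtain ⟨hgt0, hg1⟩ := h1 t htp hgt
  subst htp
  have hA' := hA.2
  have hY' := hY.2
  rw [e.norm_ofRat_value] at hA' hY'
  have hb' : ∀ j < f.natDegree, Place.abv (.inr v) (t.value (E.b j)) ≤ 1 := fun j hj => by
    have := (hb j (Finset.mem_range.2 hj)).2
    rw [e.norm_ofRat_value] at this
    exact this.le
  have hna : IsNonarchimedean (Place.abv (.inr v : Place k)) := FinitePlace.isNonarchimedean v
  have hseq := EscapeData.seq_lt_one_of_nonarch hna (d := f.natDegree) (by omega) hA'.le hb' hY'
  have h1 := fun n => EscapeData.one_add_error_of_nonarch hna hb' (hseq n)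
  have key := (E.tendsto hd hgood hP hgt0 hA.1 (fun j hj => (hb j (Finset.mem_range.2 hj)).1) hY.1
    (Place.abv (.inr v)) (B := 0) (fun n h0 => by have := h1 n; rw [h0] at this; simp at this)
    (fun n => by rw [h1 n]; simp) (fun n => (hseq n).le)).2.limUnder_eq
  have hu' := hu.2
  rw [e.norm_ofRat_value, e.norm_ofGeom_value] at hu'
  rw [localCanonicalHeight, key, Real.posLog_eq_log (by rw [abs_of_nonneg (AbsoluteValue.nonneg _ _)]; exact hg1.le), hu']
  simp only [h1, Real.log_one, zero_div, tsum_zero, add_zero]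
  ring

/-- Expansions at `β` of the functions which describe the escape to infinity. -/
structure EscapeExpansion (e : PlaceExtension k) (E : EscapeFunctions k f P M g) (β : GeomPoint k K)
    (w : K) where
  A : PowerSeries (IsLocalRing.ResidueField β.localRing)
  b : ℕ → PowerSeries (IsLocalRing.ResidueField β.localRing)
  Y : PowerSeries (IsLocalRing.ResidueField β.localRing)
  u : PowerSeries (IsLocalRing.ResidueField β.localRing)
  isExpansion_A : e.IsExpansion β w E.A A
  isExpansion_b : ∀ i < f.natDegree, e.IsExpansion β w (E.b i) (b i)
  isExpansion_Y : e.IsExpansion β w E.Y Y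
  isExpansion_u : e.IsExpansion β w E.u u
  X_dvd_A : PowerSeries.X ∣ A
  X_dvd_b : ∀ i < f.natDegree, PowerSeries.X ∣ b i
  X_dvd_Y : PowerSeries.X ∣ Y
  constantCoeff_u : PowerSeries.constantCoeff u ≠ 0

theorem PlaceExtension.IsExpansion.X_dvd {β : GeomPoint k K} {w y : K}
    {G : PowerSeries (IsLocalRing.ResidueField β.localRing)} (h : e.IsExpansion β w y G)
    (hy : y ∈ β.localRing.nonunits) : PowerSeries.X ∣ G := by
  rw [PowerSeries.X_dvd_iff, h.constantCoeff]
  exact ((CurvePoint.residuePoint β).value_eq_zero_iff (x := y) h.mem).2 hy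

theorem EscapeFunctions.exists_escapeExpansion (E : EscapeFunctions k f P M g)
    (hK : IsCurveField k K) (hg0 : g ≠ 0) {β : GeomPoint k K} {w : K} (hw : β.IsUniformizer w)
    (hβ : β.localRing ∈ supportPlaces k f P) : Nonempty (EscapeExpansion e E β w) := by
  have hn := fun {x : K} (hx : x ∈ β.localRing.nonunits) => ValuationSubring.nonunits_subset hx
  obtain ⟨A, hA⟩ := e.exists_isExpansion hK β hw (hn (E.A_mem _ hβ))
  obtain ⟨Y, hY⟩ := e.exists_isExpansion hK β hw (hn (E.Y_mem _ hβ))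
  obtain ⟨u, hu⟩ := e.exists_isExpansion hK β hw (E.u_mem _ hβ)
  have hb : ∀ i, ∃ b, i < f.natDegree → e.IsExpansion β w (E.b i) b := by
    intro i
    by_cases hi : i < f.natDegree
    · obtain ⟨b, hb⟩ := e.exists_isExpansion hK β hw (hn (E.b_mem _ hβ i hi))
      exact ⟨b, fun _ => hb⟩
    · exact ⟨0, fun h => absurd h hi⟩
  choose b hb using hb
  refine ⟨⟨A, b, Y, u, hA, hb, hY, hu, hA.X_dvd (E.A_mem _ hβ), fun i hi =>
    (hb i hi).X_dvd (E.b_mem _ hβ i hi), hY.X_dvd (E.Y_mem _ hβ), ?_⟩⟩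
  rw [hu.constantCoeff]
  exact ((CurvePoint.residuePoint β).value_eq_zero_iff (x := E.u) hu.mem).not.2
    (E.u_notMem_nonunits hg0 hβ)

namespace EscapeExpansion

variable {E : EscapeFunctions k f P M g} {β : GeomPoint k K} {w : K} (X : EscapeExpansion e E β w)

/-- The logarithm of the germ at `β` whose logarithmic absolute value is the deviation of the local
canonical height. -/
noncomputable def log : PowerSeries (IsLocalRing.ResidueField β.localRing) :=
  germLog f.natDegree E.N X.A X.b X.Y X.u

/-- The germ at `β` whose logarithmic absolute value is the deviation of the local canonical
height. -/
noncomputable def germ : PowerSeries (AlgebraicClosure k) :=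
  (expSeries X.log).map (CurvePoint.residueEmb β)

theorem isGermAt : IsGermAt β X.germ := fun n => by
  rw [germ, PowerSeries.coeff_map]
  exact CurvePoint.residueEmb_mem_range β _

theorem emb_coeff_germ (v : Place k) (n : ℕ) : e.emb v (PowerSeries.coeff n X.germ) =
    e.residueEmb v β (PowerSeries.coeff n (expSeries X.log)) := by
  rw [germ, PowerSeries.coeff_map]
  rfl

theorem expSeries_log_mem (hd : 2 ≤ f.natDegree) (v : Place k) :
    expSeries X.log ∈ convergentSeries (e.residueEmb v β) := by
  obtain ⟨C, hC⟩ := e.exists_factorialBound v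
  exact expSeries_germLog_mem hd E.N hC (X.isExpansion_A.convergent v) X.X_dvd_A
    (fun i hi => (X.isExpansion_b i hi).convergent v) X.X_dvd_b (X.isExpansion_Y.convergent v)
    X.X_dvd_Y (X.isExpansion_u.convergent v) X.constantCoeff_u

theorem isAnalytic (hd : 2 ≤ f.natDegree) (v : Place k) : e.IsAnalytic v X.germ := by
  obtain ⟨r, hr, B, hB⟩ := mem_convergentSeries.1 (X.expSeries_log_mem hd v)
  refine ⟨r, hr, fun x hx => ?_⟩
  simp only [X.emb_coeff_germ]
  exact (hB.summable_norm hx.le).1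

/-- The deviation of the local canonical height near `β`. -/
noncomputable def deviation (v : InfinitePlace k) (p : e.Pts K (.inl v)) : ℝ :=
  (evalAt (e.residueEmbComplex v β) (e.toComplex v (p.value w)) X.log).re

/-- Near `β` the values of `A`, `b`, `Y` and `u` are the sums of their expansions, so the limit
formula at `t` matches the evaluated series of `exists_evalAt_germLog`, up to the constant `log
|u(β)|`. -/
theorem eventually_deviation (hd : 2 ≤ f.natDegree) (hw : β.IsUniformizer w) (hg0 : g ≠ 0)
    (hgβ : g ∉ β.localRing) (v : InfinitePlace k) :
    ∀ᶠ p in 𝓝 (e.ofGeom (.inl v) β), w ∈ p.localRing ∧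
      (∃ z : e.Cv (.inl v), z ≠ 0 ∧ HasSum (fun n : ℕ =>
        e.emb (.inl v) (PowerSeries.coeff n X.germ) * p.value w ^ n) z ∧
        X.deviation v p = Real.log ‖z‖) ∧
      (∀ c : ℝ, e.RealAnalyticAt (fun q => c * X.deviation v q) p) ∧
      ∀ t : RatPoint k K, e.ofRat (.inl v) t = p →
      t.GoodReduction f → P ∈ t.localRing → g ∈ t.localRing →
      localCanonicalHeight (.inl v) (t.specialize f) (t.value P) =
        Real.posLog (Place.abv (.inl v) (t.value g)) /
          ((f.natDegree : ℝ) ^ M * ((f.natDegree : ℝ) - 1)) + X.deviation v p -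
        Real.log (e.abv (.inl v) (β.value E.u)) /
          ((f.natDegree : ℝ) ^ E.N * ((f.natDegree : ℝ) - 1)) := by
  have hconv := e.convergentSeries_residueEmbComplex v β
  obtain ⟨r, hr, hL, h⟩ := exists_evalAt_germLog (j := e.residueEmbComplex v β) hd E.N
    (hconv ▸ X.isExpansion_A.convergent _) X.X_dvd_A
    (fun i hi => hconv ▸ (X.isExpansion_b i hi).convergent _) X.X_dvd_b
    (hconv ▸ X.isExpansion_Y.convergent _) X.X_dvd_Y (hconv ▸ X.isExpansion_u.convergent _)
    X.constantCoeff_u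
  obtain ⟨hwO, hwm⟩ := hw
  have hwn : w ∈ β.localRing.nonunits :=
    ValuationSubring.mem_nonunits_iff_exists_mem_maximalIdeal.2
      ⟨hwO, hwm ▸ Ideal.mem_span_singleton_self _⟩
  obtain ⟨r', hr', B, hB⟩ := mem_convergentSeries.1 (X.expSeries_log_mem hd (.inl v))
  filter_upwards [e.eventually_norm_value_lt _ hwn (lt_min hr hr'),
    e.eventually_value_ne_zero hg0 _ hgβ,
    X.isExpansion_A.eventually_eq v, X.isExpansion_Y.eventually_eq v,
    X.isExpansion_u.eventually_eq v, (eventually_all_finset (Finset.range f.natDegree)).2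
      fun i hi => (X.isExpansion_b i (Finset.mem_range.1 hi)).eventually_eq v]
    with p hwp hgp hA hY hu hb
  have hx : ‖e.toComplex v (p.value w)‖ < r := by
    rw [e.norm_toComplex]
    exact hwp.2.trans_le (min_le_left _ _)
  have hx' : ‖p.value w‖ ≤ r' := (hwp.2.trans_le (min_le_right _ _)).le
  obtain ⟨hexp, hseq, herr, hre⟩ := h _ hx.le
  refine ⟨hwp.1, ?_, fun c => ⟨w, hwp.1, fun y => c * (evalAt (e.residueEmbComplex v β) y X.log).re,
    ?_, Eventually.of_forall fun _ => rfl⟩, fun t htp hgood hP hgt => ?_⟩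
  -- Summability is established in `k̄_v`; the sum is then identified through its image in `ℂ`,
  -- which is an exponential and hence nonzero.
  · have hs : Summable fun n : ℕ => e.emb (.inl v) (PowerSeries.coeff n X.germ) * p.value w ^ n := by
      simp only [X.emb_coeff_germ]
      exact (hB.summable_norm hx').1.of_norm
    have h1 := e.tendsto_toComplex (v := v) hs.hasSum
    have h2 : (fun s : Finset ℕ => e.toComplex v (∑ n ∈ s,
        e.emb (.inl v) (PowerSeries.coeff n X.germ) * p.value w ^ n)) = fun s => ∑ n ∈ s,
        e.residueEmbComplex v β (PowerSeries.coeff n (expSeries X.log)) *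
          e.toComplex v (p.value w) ^ n := by
      funext s
      rw [map_sum]
      refine Finset.sum_congr rfl fun n _ => ?_
      rw [map_mul, map_pow, X.emb_coeff_germ]
      rfl
    have h3 : e.toComplex v (∑' n : ℕ, e.emb (.inl v) (PowerSeries.coeff n X.germ) *
        p.value w ^ n) = Complex.exp (evalAt (e.residueEmbComplex v β)
          (e.toComplex v (p.value w)) X.log) :=
      tendsto_nhds_unique (h2 ▸ h1) hexp
    refine ⟨_, ?_, hs.hasSum, ?_⟩
    · intro h0
      rw [h0, map_zero] at h3
      exact Complex.exp_ne_zero _ h3.symm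
    · rw [← e.norm_toComplex, h3, Complex.norm_exp, Real.log_exp]
      rfl
  · exact analyticAt_const.mul
      ((Complex.reCLM.analyticAt _).comp ((hL.analyticAt_evalAt hx).restrictScalars))
  · obtain ⟨hgt0, hg1⟩ := hgp t htp hgt
    subst htp
    let η : k →+* ℂ := (e.toComplex v).comp
      ((e.emb (.inl v)).comp (algebraMap k (AlgebraicClosure k)))
    have hη : ∀ c, ‖η c‖ = Place.abv (.inl v) c := fun c => by
      rw [← e.abv_algebraMap, ← e.norm_emb, ← e.norm_toComplex]
      rfl
    have hηv : ∀ x, η (t.value x) = e.toComplex v ((e.ofRat (.inl v) t).value x) := fun x => by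
      rw [e.ofRat_value]
      rfl
    have hA' := (hηv E.A).trans hA.2
    have hY' := (hηv E.Y).trans hY.2
    have hu' := (hηv E.u).trans hu.2
    have hb' : ∀ i < f.natDegree, η (t.value (E.b i)) = _ := fun i hi =>
      (hηv _).trans (hb i (Finset.mem_range.2 hi)).2
    have hseq' : ∀ n, η (escapeSeq f.natDegree (t.value E.A) (fun j => t.value (E.b j))
        (t.value E.Y) n) = _ := fun n => by
      rw [map_escapeSeq, hA', hY', escapeSeq_congr hb']
    have herr' : ∀ n, Place.abv (.inl v) (1 + escapeError f.natDegree (fun j => t.value (E.b j))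
        (escapeSeq f.natDegree (t.value E.A) (fun j => t.value (E.b j)) (t.value E.Y) n)) = _ :=
      fun n => by rw [← hη, map_add, map_one, map_escapeError, hseq', escapeError_congr hb']
    -- Hence all logarithms in the error series are bounded by `log 2`.
    have hbd : ∀ z : ℂ, ‖z‖ ≤ 1 / 2 → 1 / 2 ≤ ‖1 + z‖ ∧ ‖1 + z‖ ≤ 2 := by
      intro z hz
      constructor
      · have := norm_sub_le_norm_add (1 : ℂ) z
        rw [norm_one] at this
        linarith
      · have := norm_add_le (1 : ℂ) z
        rw [norm_one] at this
        linarith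
    have key := (E.tendsto hd hgood hP hgt0 hA.1
      (fun j hj => (hb j (Finset.mem_range.2 hj)).1) hY.1
      (Place.abv (.inl v)) (B := Real.log 2)
      (fun n h0 => by
        have h1 := herr' n
        rw [h0, map_zero] at h1
        have h2 := (hbd _ (herr n)).1
        rw [← h1] at h2
        linarith)
      (fun n => by
        rw [herr' n, abs_le]
        obtain ⟨h2, h3⟩ := hbd _ (herr n)
        constructor
        · rw [← Real.log_inv]
          exact Real.log_le_log (by norm_num) (by linarith)
        · exact Real.log_le_log (by linarith) h3)
      (fun n => by
        rw [← hη, hseq' n]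
        exact hseq n)).2.limUnder_eq
    have hre' : X.deviation v (e.ofRat (.inl v) t) = _ := hre
    have hu0 : ‖e.residueEmbComplex v β (PowerSeries.constantCoeff X.u)‖ =
        e.abv (.inl v) (β.value E.u) := by
      rw [X.isExpansion_u.constantCoeff, e.residueEmbComplex_value, e.norm_toComplex,
        e.norm_ofGeom_value]
    rw [localCanonicalHeight, key, hre', Real.posLog_eq_log
      (by rw [abs_of_nonneg (AbsoluteValue.nonneg _ _)]; exact hg1.le), ← hη (t.value E.u), hu', hu0]
    simp only [herr']
    ring

theorem tendsto_deviation (hd : 2 ≤ f.natDegree) (hw : β.IsUniformizer w) (v : InfinitePlace k) :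
    Tendsto (X.deviation v) (𝓝 (e.ofGeom (.inl v) β)) (𝓝 0) := by
  have hconv := e.convergentSeries_residueEmbComplex v β
  obtain ⟨r, hr, hL, -⟩ := exists_evalAt_germLog (j := e.residueEmbComplex v β) hd E.N
    (hconv ▸ X.isExpansion_A.convergent _) X.X_dvd_A
    (fun i hi => hconv ▸ (X.isExpansion_b i hi).convergent _) X.X_dvd_b
    (hconv ▸ X.isExpansion_Y.convergent _) X.X_dvd_Y (hconv ▸ X.isExpansion_u.convergent _)
    X.constantCoeff_u
  obtain ⟨hwO, hwm⟩ := hw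
  have hw0 : (CurvePoint.residuePoint β).value w = 0 :=
    ((CurvePoint.residuePoint β).value_eq_zero_iff (x := w) hwO).2
      (ValuationSubring.mem_nonunits_iff_exists_mem_maximalIdeal.2
        ⟨hwO, hwm ▸ Ideal.mem_span_singleton_self _⟩)
  have h1 := e.tendsto_toComplex_value v β hwO
  rw [hw0, map_zero] at h1
  have h2 := tendsto_evalAt (mem_convergentSeries.2 ⟨r, hr, _, hL⟩) h1
  rw [PowerSeries.X_dvd_iff.1 (X_dvd_germLog hd E.N X.X_dvd_A X.X_dvd_Y X.constantCoeff_u),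
    map_zero] at h2
  exact (Complex.continuous_re.tendsto 0).comp h2

/-- A limit along all neighbourhoods, centre included, is the value at the centre. -/
theorem deviation_self (hd : 2 ≤ f.natDegree) (hw : β.IsUniformizer w) (v : InfinitePlace k) :
    X.deviation v (e.ofGeom (.inl v) β) = 0 :=
  tendsto_nhds_unique (tendsto_pure_nhds _ _)
    ((X.tendsto_deviation hd hw v).mono_left (pure_le_nhds _))

/-- The deviation of the local canonical height near `β` at an arbitrary place. -/
noncomputable def localDeviation : ∀ v : Place k, e.Pts K v → ℝ
  | .inl v => X.deviation v
  | .inr _ => fun _ => 0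

/-- The deviation is analytic at `p` and given by the germ, if the place is infinite. -/
def IsAnalyticAt : ∀ v : Place k, e.Pts K v → Prop
  | .inl v => fun p => w ∈ p.localRing ∧ (∃ z : e.Cv (.inl v), z ≠ 0 ∧ HasSum (fun n : ℕ =>
      e.emb (.inl v) (PowerSeries.coeff n X.germ) * p.value w ^ n) z ∧
      X.deviation v p = Real.log ‖z‖) ∧
      ∀ c : ℝ, e.RealAnalyticAt (fun q => c * X.deviation v q) p
  | .inr _ => fun _ => True

theorem eventually_localCanonicalHeight (hd : 2 ≤ f.natDegree) (hw : β.IsUniformizer w)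
    (hg0 : g ≠ 0) (hβ : β.localRing ∈ supportPlaces k f P) (hgβ : g ∉ β.localRing) (v : Place k) :
    ∀ᶠ p in 𝓝 (e.ofGeom v β), X.IsAnalyticAt v p ∧
      ∀ t : RatPoint k K, e.ofRat v t = p →
      t.GoodReduction f → P ∈ t.localRing → g ∈ t.localRing →
      localCanonicalHeight v (t.specialize f) (t.value P) =
        Real.posLog (v.abv (t.value g)) / ((f.natDegree : ℝ) ^ M * ((f.natDegree : ℝ) - 1)) +
          (X.localDeviation v p - Real.log (e.abv v (β.value E.u)) /
            ((f.natDegree : ℝ) ^ E.N * ((f.natDegree : ℝ) - 1))) := by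
  rcases v with v | v
  · filter_upwards [X.eventually_deviation hd hw hg0 hgβ v] with p hp
    refine ⟨⟨hp.1, hp.2.1, hp.2.2.1⟩, fun t htp hgood hP hgt => ?_⟩
    rw [hp.2.2.2 t htp hgood hP hgt, add_sub_assoc]
    rfl
  · filter_upwards [E.eventually_localCanonicalHeight_finite hd hg0 v hβ hgβ] with p hp
    refine ⟨trivial, fun t htp hgood hP hgt => ?_⟩
    rw [hp t htp hgood hP hgt]
    simp only [localDeviation]
    ring

end EscapeExpansion

end LocalHeights

end PolyFamily

namespace PolyFamily

/-! ### Summation over all places. -/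

section Global

variable {k : Type*} [Field k] [NumberField k]

/-- The product formula. -/
theorem sum_weight_mul_log_eq_zero {x : k} (hx : x ≠ 0) (T : Finset (FinitePlace k))
    (hT : ∀ v ∉ T, v x = 1) :
    ∑ v ∈ Finset.disjSum Finset.univ T, Place.weight v * Real.log (Place.abv v x) = 0 := by
  have h1 := congrArg Real.log (prod_abs_eq_one hx)
  rw [finprod_eq_prod_of_mulSupport_subset (s := T) _ fun v hv => by
    by_contra h
    exact hv (hT v h)] at h1
  have hpos : ∀ v : InfinitePlace k, v x ^ v.mult ≠ 0 := fun v =>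
    pow_ne_zero _ ((map_ne_zero v).2 hx)
  have hpos' : ∀ v : FinitePlace k, v x ≠ 0 := fun v => (map_ne_zero v).2 hx
  rw [Real.log_one, Real.log_mul (Finset.prod_ne_zero_iff.2 fun v _ => hpos v)
    (Finset.prod_ne_zero_iff.2 fun v _ => hpos' v), Real.log_prod fun v _ => hpos v,
    Real.log_prod fun v _ => hpos' v] at h1
  rw [Finset.sum_disjSum]
  have h2 := congrArg (fun y => y / (Module.finrank ℚ k : ℝ)) h1
  simp only [add_div, Finset.sum_div, zero_div, Real.log_pow] at h2
  rw [← h2]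
  congr 1
  · refine Finset.sum_congr rfl fun v _ => ?_
    change (v.mult : ℝ) / Module.finrank ℚ k * Real.log (v x) = _
    ring
  · refine Finset.sum_congr rfl fun v _ => ?_
    change 1 / (Module.finrank ℚ k : ℝ) * Real.log (v x) = _
    ring

theorem finite_setOf_posLog_ne_zero {x : k} (hx : x ≠ 0) :
    {v : Place k | Real.posLog (Place.abv v x) ≠ 0}.Finite := by
  have h1 : (Function.mulSupport fun v : FinitePlace k => v x).Finite :=
    FinitePlace.hasFiniteMulSupport hx
  refine ((Set.finite_range (Sum.inl : InfinitePlace k → Place k)).union (h1.image Sum.inr)).subset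
    fun v hv => ?_
  rcases v with v | v
  · exact Or.inl ⟨v, rfl⟩
  · refine Or.inr ⟨v, fun h => ?_, rfl⟩
    rw [Set.mem_ofPred_eq] at hv
    change Real.posLog (v x) ≠ 0 at hv
    rw [show v x = 1 from h] at hv
    simp at hv

theorem finsum_weight_mul_eq (S : Finset (Place k)) {a h : Place k → ℝ} {c : Place k → ℝ}
    (ha : {v | a v ≠ 0}.Finite) (hS : ∀ v ∈ S, h v = a v + c v) (hn : ∀ v ∉ S, h v = a v) :
    ∑ᶠ v, Place.weight v * h v = (∑ᶠ v, Place.weight v * a v) + ∑ v ∈ S, Place.weight v * c v := by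
  classical
  have h1 : ∀ v, Place.weight v * h v = Place.weight v * a v + (if v ∈ S then Place.weight v * c v else 0) := by
    intro v
    by_cases hv : v ∈ S
    · rw [if_pos hv, hS v hv, mul_add]
    · rw [if_neg hv, hn v hv, add_zero]
  have h2 : (Function.support fun v => Place.weight v * a v).Finite :=
    ha.subset fun v hv => right_ne_zero_of_mul hv
  have h3 : (Function.support fun v => if v ∈ S then Place.weight v * c v else 0) ⊆ S := fun v hv => by
    by_contra h
    exact hv (if_neg h)
  rw [finsum_congr h1, finsum_add_distrib h2 (S.finite_toSet.subset h3),
    finsum_eq_sum_of_support_subset _ h3]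
  congr 1
  exact Finset.sum_congr rfl fun v hv => if_pos hv

variable {K : Type*} [Field K] [Algebra k K] {e : PlaceExtension k} {f : K[X]} {P g : K} {M : ℕ}

/-- The variation of the canonical height, from the local contributions. -/
theorem fiberHeight_eq_of_local (hK : IsCurveField k K) (hd : 2 ≤ f.natDegree)
    (hg : IsHeightDatum k f P M g) (E : EscapeFunctions k f P M g) (T : Finset (FinitePlace k))
    {t : RatPoint k K}
    (hT : ∀ v ∉ T, (g⁻¹ ∈ (t.integerRing v).nonunits → v (t.value E.u) = 1) ∧
      (t.GoodReduction f → P ∈ t.localRing → g ∈ t.localRing →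
        localCanonicalHeight (.inr v) (t.specialize f) (t.value P) =
          Real.posLog (v (t.value g)) / ((f.natDegree : ℝ) ^ M * ((f.natDegree : ℝ) - 1))))
    {φ : Place k → GeomPoint k K} {δ : Place k → ℝ}
    (hgood : t.toGeom ∉ divisorSupport k f P → t.GoodReduction f ∧ P ∈ t.localRing ∧ t.value g ≠ 0)
    (hS : ∀ v ∈ Finset.disjSum Finset.univ T,
      (t.toGeom ∈ divisorSupport k f P → φ v = t.toGeom ∧ δ v = 0) ∧
      (t.GoodReduction f → P ∈ t.localRing → g ∈ t.localRing →
        localCanonicalHeight v (t.specialize f) (t.value P) =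
          Real.posLog (Place.abv v (t.value g)) / ((f.natDegree : ℝ) ^ M * ((f.natDegree : ℝ) - 1)) +
            (δ v - Real.log (e.abv v ((φ v).value E.u)) /
              ((f.natDegree : ℝ) ^ E.N * ((f.natDegree : ℝ) - 1)))))
    (ht : t.GoodReduction f) :
    fiberHeight f P t = divisorHeight f P M g t +
      -(∑ v ∈ Finset.disjSum Finset.univ T, Place.weight v * (Real.log (e.abv v ((φ v).value E.u)) /
        ((f.natDegree : ℝ) ^ E.N * ((f.natDegree : ℝ) - 1)))) +
      ∑ v ∈ Finset.disjSum Finset.univ T, Place.weight v * δ v := by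
  by_cases hts : t.toGeom ∈ divisorSupport k f P
  -- Both heights are `0` by convention here, so the constant has to vanish. All `φ v` equal `t`,
  -- and `|u(t)|_v = 1` outside `T` since `g⁻¹` vanishes at `t`; the product formula applies to the
  -- nonzero number `u(t)`.
  · have hts' := (mem_divisorSupport_iff hK _).1 hts
    have hP : P ∉ t.localRing := exists_notMem_of_mem_supportPlaces hK hd hts' ht.1
    have hgt : g ∉ t.localRing := (hg.notMem_iff hK hd (t.isPlace hK)).2 hts'
    rw [fiberHeight, if_neg hP, divisorHeight, if_pos hts]
    have h1 : ∀ v ∈ Finset.disjSum Finset.univ T, Place.weight v * δ v = 0 := fun v hv => by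
      rw [((hS v hv).1 hts).2, mul_zero]
    have hg0 : g ≠ 0 := by
      rintro rfl
      exact hgt t.localRing.zero_mem
    have hgi := inv_mem_nonunits_of_notMem _ hgt
    have hu0 : t.value E.u ≠ 0 := fun h0 => E.u_notMem_nonunits hg0 hts'
      ((t.value_eq_zero_iff (E.u_mem _ hts')).1 h0)
    have h2 := sum_weight_mul_log_eq_zero hu0 T fun v hv => (hT v hv).1 <| by
      rw [RatPoint.mem_nonunits_integerRing, (t.value_eq_zero_iff
        (ValuationSubring.nonunits_subset hgi)).2 hgi, map_zero]
      exact ⟨ValuationSubring.nonunits_subset hgi, zero_lt_one⟩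
    have h3 : ∑ v ∈ Finset.disjSum Finset.univ T, Place.weight v *
        (Real.log (e.abv v ((φ v).value E.u)) /
          ((f.natDegree : ℝ) ^ E.N * ((f.natDegree : ℝ) - 1))) =
        (∑ v ∈ Finset.disjSum Finset.univ T, Place.weight v * Real.log (Place.abv v (t.value E.u))) /
          ((f.natDegree : ℝ) ^ E.N * ((f.natDegree : ℝ) - 1)) := by
      rw [Finset.sum_div]
      refine Finset.sum_congr rfl fun v hv => ?_
      rw [((hS v hv).1 hts).1, t.toGeom_value, e.abv_algebraMap, mul_div_assoc]
    rw [Finset.sum_eq_zero h1, h3, h2]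
    simp
  · obtain ⟨-, hP, hgt0⟩ := hgood hts
    have hgt : g ∈ t.localRing := t.mem_of_value_ne_zero hgt0
    rw [fiberHeight, if_pos hP, divisorHeight, if_neg hts, canonicalHeight,
      finsum_weight_mul_eq (Finset.disjSum Finset.univ T) (a := fun v =>
        Real.posLog (Place.abv v (t.value g)) / ((f.natDegree : ℝ) ^ M * ((f.natDegree : ℝ) - 1)))
        (c := fun v => δ v - Real.log (e.abv v ((φ v).value E.u)) /
              ((f.natDegree : ℝ) ^ E.N * ((f.natDegree : ℝ) - 1))) ?_
        (fun v hv => (hS v hv).2 ht hP hgt) ?_]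
    · simp only [mul_sub, Finset.sum_sub_distrib]
      ring
    · refine (finite_setOf_posLog_ne_zero hgt0).subset fun v hv h0 => hv ?_
      rw [h0, zero_div]
    · intro v hv
      rcases v with v | v
      · exact absurd (Finset.inl_mem_disjSum.2 (Finset.mem_univ v)) hv
      · exact (hT v fun h => hv (Finset.inr_mem_disjSum.2 h)).2 ht hP hgt

end Global

end PolyFamily

namespace PolyFamily

/-! ### Neighbourhoods and simultaneous limits. -/

section Variation

variable {k : Type*} [Field k] [NumberField k] {K : Type*} [Field K] [Algebra k K]
  {e : PlaceExtension k} {f : K[X]} {P g : K} {M : ℕ}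

/-- One open set on which all local statements hold. They presuppose that `g` is regular at `t`,
which for a rational point means exactly that it is off the support. -/
theorem EscapeExpansion.exists_isOpen {E : EscapeFunctions k f P M g} {β : GeomPoint k K} {w : K}
    (X : EscapeExpansion e E β w) (hK : IsCurveField k K) (hd : 2 ≤ f.natDegree)
    (hg : IsHeightDatum k f P M g) (hg0 : g ≠ 0) (hw : β.IsUniformizer w)
    (hβ : β ∈ divisorSupport k f P) {Q : k[X]} (hQ : Q.Monic)
    (hQf : ∀ i, IsIntegral (Algebra.adjoin k {g}) (aeval g Q * f.coeff i))
    (hQl : IsIntegral (Algebra.adjoin k {g}) (aeval g Q * f.leadingCoeff⁻¹))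
    (hQP : IsIntegral (Algebra.adjoin k {g}) (aeval g Q * P)) (v : Place k) :
    ∃ U : Set (e.Pts K v), IsOpen U ∧ e.ofGeom v β ∈ U ∧ (∀ p ∈ U, X.IsAnalyticAt v p) ∧
      ∀ t : RatPoint k K, e.ofRat v t ∈ U →
        (t.toGeom ∈ divisorSupport k f P → t.toGeom = β) ∧
        (t.toGeom ∉ divisorSupport k f P → t.GoodReduction f ∧ P ∈ t.localRing ∧ t.value g ≠ 0 ∧
          t.value (aeval g Q) ≠ 0) ∧
        (t.GoodReduction f → P ∈ t.localRing → g ∈ t.localRing →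
          localCanonicalHeight v (t.specialize f) (t.value P) =
            Real.posLog (v.abv (t.value g)) /
              ((f.natDegree : ℝ) ^ M * ((f.natDegree : ℝ) - 1)) +
            (X.localDeviation v (e.ofRat v t) - Real.log (e.abv v (β.value E.u)) /
              ((f.natDegree : ℝ) ^ E.N * ((f.natDegree : ℝ) - 1)))) := by
  have hf : f ≠ 0 := by
    rintro rfl
    simp at hd
  have hβ' := (mem_divisorSupport_iff hK β).1 hβ
  have hgβ : g ∉ β.localRing := (hg.notMem_iff hK hd (β.isPlace hK)).2 hβ'
  obtain ⟨U, hU, hUo, hUβ⟩ := eventually_nhds_iff.1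
    ((X.eventually_localCanonicalHeight hd hw hg0 hβ' hgβ v).and
      ((e.eventually_eq_of_mem_divisorSupport hK hd v β).and
        (e.eventually_goodReduction hK hf hg0 v hgβ hQ hQf hQl hQP)))
  refine ⟨U, hUo, hUβ, fun p hp => (hU p hp).1.1, fun t ht => ?_⟩
  obtain ⟨⟨-, h1⟩, h2, h3⟩ := hU _ ht
  refine ⟨h2 t rfl, fun hts => h3 t rfl ?_, h1 t rfl⟩
  by_contra hgt
  exact hts ((mem_divisorSupport_iff hK _).2 ((hg.notMem_iff hK hd (t.isPlace hK)).1 hgt))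

theorem exists_finset_of_eventually_cofinite {α : Type*} {p : α → Prop} (h : ∀ᶠ a in cofinite, p a) :
    ∃ T : Finset α, ∀ a ∉ T, p a :=
  ⟨(Filter.eventually_cofinite.1 h).toFinset, fun a ha => by
    by_contra hp
    exact ha ((Filter.eventually_cofinite.1 h).mem_toFinset.2 hp)⟩

/-- Convergence of a finite sum on the product space, unpacked into one neighbourhood per factor. -/
theorem exists_forall_abs_sum_lt {ι : Type*} [Fintype ι] {X : ι → Type*}
    [∀ i, TopologicalSpace (X i)] {a : ∀ i, X i} {F : ∀ i, X i → ℝ}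
    (hF : ∀ i, Tendsto (F i) (𝓝 (a i)) (𝓝 0)) {ε : ℝ} (hε : 0 < ε) :
    ∃ V : ∀ i, Set (X i), (∀ i, V i ∈ 𝓝 (a i)) ∧
      ∀ x : ∀ i, X i, (∀ i, x i ∈ V i) → |∑ i, F i (x i)| < ε := by
  have h : Tendsto (fun x : ∀ i, X i => |∑ i, F i (x i)|) (𝓝 a) (𝓝 0) := by
    have := tendsto_finsetSum Finset.univ fun i _ =>
      (hF i).comp ((continuous_apply i).tendsto a)
    simpa using this.abs
  have h1 := h.eventually (gt_mem_nhds hε)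
  rw [Filter.eventually_iff, nhds_pi, Filter.mem_pi'] at h1
  obtain ⟨I, V, hV, hI⟩ := h1
  exact ⟨V, hV, fun x hx => hI fun i _ => hx i⟩

end Variation

end PolyFamily

open PolyFamily

theorem theorem3 {k : Type*} [Field k] [NumberField k] {K : Type*} [Field K] [Algebra k K]
    (hfg : (⊤ : IntermediateField k K).FG) (htr : Algebra.trdeg k K = 1)
    (e : PlaceExtension k)
    (f : K[X]) (hf : 2 ≤ f.natDegree) (P : K)
    (hD : ∃ β : GeomPoint k K, divisorCoeff f P β ≠ 0)
    (w : divisorSupport k f P → K) (hw : ∀ β : divisorSupport k f P, β.1.IsUniformizer (w β)) :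
    (∃ (N : ℕ) (g : K), IsHeightDatum k f P N g) ∧
    ∀ (N : ℕ) (g : K), IsHeightDatum k f P N g →
      ∃ (S : Finset (Place k)) (hS : ∀ v : InfinitePlace k, Sum.inl v ∈ S)
        (U : ∀ v : Place k, divisorSupport k f P → Set (e.Pts K v))
        (F : ∀ v : InfinitePlace k, divisorSupport k f P → e.Pts K (.inl v) → ℝ)
        (G : divisorSupport k f P → PowerSeries (AlgebraicClosure k)),
        -- the neighbourhoods `U_{β,v}` of `β`
        (∀ v ∈ S, ∀ β, IsOpen (U v β) ∧ e.ofGeom v β.1 ∈ U v β) ∧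
        -- the real-analytic functions `F_{β,v}` vanishing at `β`
        (∀ v β, (∀ p ∈ U (.inl v) β, e.RealAnalyticAt (F v β) p) ∧
          F v β (e.ofGeom (.inl v) β.1) = 0) ∧
        (∀ φ : S → divisorSupport k f P, ∃ C : ℝ,
          -- the formula for the variation of the canonical height
          (∀ t : RatPoint k K, (∀ v : S, e.ofRat v.1 t ∈ U v.1 (φ v)) →
            (t.toGeom ∉ divisorSupport k f P → t.GoodReduction f ∧ P ∈ t.localRing) ∧
            (t.GoodReduction f →
              fiberHeight f P t = divisorHeight f P N g t + C +
                ∑ v : InfinitePlace k, F v (φ ⟨.inl v, hS v⟩) (e.ofRat (.inl v) t))) ∧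
          -- the resulting asymptotic formula, as `t → φ(v)` simultaneously for all `v ∈ S`
          (∀ ε > 0, ∃ V : ∀ v : S, Set (e.Pts K v.1),
            (∀ v, V v ∈ 𝓝 (e.ofGeom v.1 (φ v).1)) ∧
            ∀ t : RatPoint k K, (∀ v : S, e.ofRat v.1 t ∈ V v) → t.GoodReduction f →
              |fiberHeight f P t - (divisorHeight f P N g t + C)| < ε)) ∧
        -- the germs `G_β`, analytic at every place, with `F_{β,v} = log |G_β|_v`
        (∀ β, IsGermAt β.1 (G β) ∧ ∀ v : Place k, e.IsAnalytic v (G β)) ∧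
        (∀ v β, ∀ t ∈ U (.inl v) β, w β ∈ t.localRing ∧
          ∃ z : e.Cv (.inl v), z ≠ 0 ∧
            HasSum (fun n : ℕ => e.emb (.inl v) (PowerSeries.coeff n (G β)) *
              t.value (w β) ^ n) z ∧
            F v β t = (v.mult : ℝ) / Module.finrank ℚ k * Real.log ‖z‖) := by
  have hK : IsCurveField k K := ⟨hfg, htr⟩
  have hD' : (divisorSupport k f P).Nonempty := hD
  refine ⟨exists_isHeightDatum hK hf hD', fun N g hg => ?_⟩
  have hg0 : g ≠ 0 := by
    rintro rfl
    exact hg.transcendental hK hf hD' isAlgebraic_zero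
  obtain ⟨E⟩ := hg.exists_escapeFunctions hK hf hD'
  obtain ⟨Q, hQ, hQf, hQl, hQP, hcof⟩ := hg.eventually_localCanonicalHeight_eq hK hf hD' E
  -- `S` consists of the infinite places and of these exceptional finite ones; it does not depend on
  -- `φ`.
  obtain ⟨T, hT⟩ := exists_finset_of_eventually_cofinite hcof
  have X : ∀ β : divisorSupport k f P, EscapeExpansion e E β.1 (w β) := fun β =>
    (E.exists_escapeExpansion hK hg0 (hw β) ((mem_divisorSupport_iff hK β.1).1 β.2)).some
  choose U hUo hUβ hUa hU using fun (v : Place k) (β : divisorSupport k f P) =>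
    (X β).exists_isOpen hK hf hg hg0 (hw β) β.2 hQ hQf hQl hQP v
  have hS : ∀ v : InfinitePlace k, (Sum.inl v : Place k) ∈ Finset.disjSum Finset.univ T :=
    fun v => Finset.inl_mem_disjSum.2 (Finset.mem_univ v)
  refine ⟨Finset.disjSum Finset.univ T, hS, U,
    fun v β p => (v.mult : ℝ) / Module.finrank ℚ k * (X β).deviation v p, fun β => (X β).germ,
    fun v _ β => ⟨hUo v β, hUβ v β⟩, fun v β => ⟨fun p hp => (hUa _ β p hp).2.2 _, ?_⟩, fun φ => ?_,
    fun β => ⟨(X β).isGermAt, (X β).isAnalytic hf⟩, fun v β t ht => ?_⟩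
  · exact mul_eq_zero_of_right _ ((X β).deviation_self hf (hw β) v)
  · classical
    -- `φ` is extended by an arbitrary point of the support, so that sums over `S` carry no
    -- membership proofs; only its values on `S` are used.
    obtain ⟨φ', hφ'⟩ : ∃ φ' : Place k → divisorSupport k f P,
        ∀ v (h : v ∈ Finset.disjSum Finset.univ T), φ' v = φ ⟨v, h⟩ :=
      ⟨fun v => if h : v ∈ Finset.disjSum Finset.univ T then φ ⟨v, h⟩ else ⟨hD'.some, hD'.some_mem⟩,
        fun v h => dif_pos h⟩
    have hdev : ∀ v (h : v ∈ Finset.disjSum Finset.univ T) (t : RatPoint k K),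
        (X (φ' v)).localDeviation v (e.ofRat v t) =
          (X (φ ⟨v, h⟩)).localDeviation v (e.ofRat v t) := fun v h t => by rw [hφ' v h]
    -- The constant depends on `φ` only through the values of `u` at the points `φ v`.
    let C : ℝ := -(∑ v ∈ Finset.disjSum Finset.univ T, Place.weight v *
      (Real.log (e.abv v ((φ' v).1.value E.u)) /
        ((f.natDegree : ℝ) ^ E.N * ((f.natDegree : ℝ) - 1))))
    have key : ∀ t : RatPoint k K,
        (∀ v : (Finset.disjSum Finset.univ T : Finset (Place k)), e.ofRat v.1 t ∈ U v.1 (φ v)) →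
        (t.toGeom ∉ divisorSupport k f P → t.GoodReduction f ∧ P ∈ t.localRing) ∧
        (t.GoodReduction f → fiberHeight f P t = divisorHeight f P N g t + C +
          ∑ v : InfinitePlace k, (v.mult : ℝ) / Module.finrank ℚ k *
            (X (φ ⟨.inl v, hS v⟩)).deviation v (e.ofRat (.inl v) t)) := by
      intro t ht
      -- Closeness to the support at a single place gives good reduction off the support, and every
      -- number field has an infinite place.
      obtain ⟨v₀⟩ : Nonempty (InfinitePlace k) := inferInstance
      have hgood := (hU _ _ t (ht ⟨.inl v₀, hS v₀⟩)).2.1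
      refine ⟨fun hts => ⟨(hgood hts).1, (hgood hts).2.1⟩, fun htg => ?_⟩
      rw [fiberHeight_eq_of_local (e := e) hK hf hg E T (φ := fun v => (φ' v).1)
        (δ := fun v => (X (φ' v)).localDeviation v (e.ofRat v t)) ?_
        (fun hts => ⟨(hgood hts).1, (hgood hts).2.1, (hgood hts).2.2.1⟩) ?_ htg]
      · congr 1
        rw [Finset.sum_disjSum, Finset.sum_eq_zero (s := T), add_zero]
        · exact Finset.sum_congr rfl fun v _ =>
            congrArg (Place.weight (.inl v) * ·) (hdev (.inl v) (hS v) t)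
        · exact fun v _ => mul_zero _
      · refine fun v hv => ⟨(hT v hv t).1, fun h1 h2 h3 => (hT v hv t).2 h1 h2 h3 (hgood ?_).2.2.2⟩
        rw [mem_divisorSupport_iff hK]
        exact fun h => (hg.notMem_iff hK hf (t.isPlace hK)).2 h h3
      · intro v hv
        rw [hdev v hv t, hφ' v hv]
        have h := hU _ _ t (ht ⟨v, hv⟩)
        refine ⟨fun hts => ?_, h.2.2⟩
        have h1 := h.1 hts
        refine ⟨h1.symm, ?_⟩
        rcases v with v | v
        -- A point of the support inside the neighbourhood is its centre, where the deviation
        -- vanishes.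
        · have h2 : e.ofRat (.inl v) t = e.ofGeom (.inl v) (φ ⟨.inl v, hv⟩).1 := by rw [← h1]; rfl
          rw [h2]
          exact (X _).deviation_self hf (hw _) v
        · rfl
    refine ⟨C, key, fun ε hε => ?_⟩
    obtain ⟨V, hV, hVε⟩ := exists_forall_abs_sum_lt
      (F := fun (v : InfinitePlace k) (p : e.Pts K (.inl v)) =>
        (v.mult : ℝ) / Module.finrank ℚ k * (X (φ ⟨.inl v, hS v⟩)).deviation v p)
      (a := fun v => e.ofGeom (.inl v) (φ ⟨.inl v, hS v⟩).1)
      (fun v => by simpa using ((X (φ ⟨.inl v, hS v⟩)).tendsto_deviation hf (hw _) v).const_mul _)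
      hε
    -- At finite places the formula is already exact on `U`, so no further shrinking is needed.
    let V' : ∀ v : Place k, Set (e.Pts K v) := fun v => Sum.casesOn v V fun _ => Set.univ
    refine ⟨fun v => U v.1 (φ v) ∩ V' v.1, fun v => Filter.inter_mem
      ((hUo _ _).mem_nhds (hUβ _ _)) ?_, fun t ht htg => ?_⟩
    · rcases v with ⟨v | v, hv⟩
      · exact hV v
      · exact Filter.univ_mem
    · rw [(key t fun v => (ht v).1).2 htg, add_sub_cancel_left]
      exact hVε (fun v => e.ofRat (.inl v) t) fun v => (ht ⟨.inl v, hS v⟩).2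
  · obtain ⟨h1, ⟨z, h2, h3, h4⟩, -⟩ := hUa (.inl v) β t ht
    exact ⟨h1, z, h2, h3, congrArg (_ * ·) h4⟩
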